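/- Let $X,Z$ be topological spaces (for instance connected CW-complexes), $Y\subset Z$ a subspace, and $p\ge 0$ an integer. For a map $f:X\to Z$ put $C=f^{-1}(Y)$. A singular $p$-manifold in $C$ is a continuous map $s:N\to C$ from a closed oriented smooth $p$-manifold $N$ (possibly empty); let $M_p(C)$ be the class of all of them. A bordism between $N_0$ and $N_1$ is a compact oriented smooth $(p+1)$-manifold $W$ with $\partial W=N_0\sqcup -N_1$. Two singular $p$-manifolds $s_i:N_i\to C$ $(i=0,1)$ are Nielsen equivalent, $s_0\sim_N s_1$, if there are a bordism $W$ between $N_0$ and $N_1$, a map $H:W\to X$ extending $s_0\sqcup s_1$, and a map $G:W\to Y$ extending $fs_0\sqcup fs_1$, such that $fH$ and $G$ are homotopic, as maps to $Z$, relative to $\partial W$. Write $S'_p(f)=M_p(C)/\sim_N$. A homotopy $F:I\times X\to Z$ from $f_0$ to $f_1$ has its own set of classes $S'_p(F)$, and the inclusions $i_t:X\to I\times X$, $x\mapsto(t,x)$, induce maps $i'_{t*}:S'_p(f_t)\to S'_p(F)$, $[s]\mapsto[i_ts]$, for $t=0,1$. Put $M_p^F=\operatorname{Im}i'_{0*}\cap\operatorname{Im}i'_{1*}$.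 The topologically essential classes of $f$ are $$S_p(f)=\bigcap\{(i'_{0*})^{-1}(M_p^F): F \text{ a homotopy with } F|_{\{0\}\times X}=f\}\subset S'_p(f).$$ Theorem. The relation $\sim_N$ is an equivalence relation, disjoint union makes $S'_p(f)$ an abelian group, and $S_p(f)$ is a subgroup of it. The group $S_p(f)$ is invariant under homotopy of $f$: for every homotopy $F$ from $f$ to $g$ there is an isomorphism $e:S_p(f)\to S_p(g)$ with $i'_{1*}(e(a))=i'_{0*}(a)$ for all $a$. Moreover, for every such $F$ there is a monomorphism $\varphi:S_p(f)\to S'_p(g)$ with $i'_{1*}(\varphi(a))=i'_{0*}(a)$ for all $a$. -/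

import Mathlib

open scoped Manifold ContDiff

noncomputable section

/-- The model `ℝ^p × [0, ∞)` of smooth `(p+1)`-manifolds with boundary. -/
abbrev collarModel (p : ℕ) :
    ModelWithCorners ℝ (EuclideanSpace ℝ (Fin p) × EuclideanSpace ℝ (Fin 1))
      (ModelProd (EuclideanSpace ℝ (Fin p)) (EuclideanHalfSpace 1)) :=
  (𝓡 p).prod (𝓡∂ 1)

/-- An orientation of a smooth manifold `M`: a continuous choice of orientations of the tangent
spaces. The sign at `x` compares the chosen orientation of the tangent space at `x` with the one
which the preferred chart at `x` pulls back from the model vector space; continuity says that, in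
the preferred chart at `x₀`, the orientations at the points near `x₀` agree with the one at `x₀`.
In dimension `0` this is an arbitrary choice of a sign at each point. -/
structure ManifoldOrientation {E H : Type*} [NormedAddCommGroup E] [NormedSpace ℝ E]
    [TopologicalSpace H] (I : ModelWithCorners ℝ E H) (M : Type*) [TopologicalSpace M]
    [ChartedSpace H M] [IsManifold I 1 M] where
  sign : M → ℤˣ
  locally_constant : ∀ x₀ : M, ∀ᶠ x in nhds x₀,
    0 < ((sign x : ℤ) : ℝ) * ((sign x₀ : ℤ) : ℝ) * (tangentCoordChange I x x₀ x).det

/-- The orientation of a disjoint union. -/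
def ManifoldOrientation.sum {E H : Type*} [NormedAddCommGroup E] [NormedSpace ℝ E]
    [TopologicalSpace H] {I : ModelWithCorners ℝ E H} {M N : Type*}
    [TopologicalSpace M] [ChartedSpace H M] [IsManifold I 1 M]
    [TopologicalSpace N] [ChartedSpace H N] [IsManifold I 1 N]
    (o : ManifoldOrientation I M) (o' : ManifoldOrientation I N) :
    ManifoldOrientation I (M ⊕ N) where
  sign := Sum.elim o.sign o'.sign
  locally_constant := by
    rintro (x₀ | x₀)
    · rw [nhds_inl, Filter.eventually_map]
      filter_upwards [o.locally_constant x₀] with x hx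
      have h : tangentCoordChange I (Sum.inl x : M ⊕ N) (Sum.inl x₀) (Sum.inl x)
          = tangentCoordChange I x x₀ x := by
        rw [tangentCoordChange_def, tangentCoordChange_def]
        simp only [extChartAt, ChartedSpace.sum_chartAt_inl]
        congr 1
        · ext e
          simp [Sum.inl_injective.extend_apply]
        · simp [Sum.inl_injective.extend_apply]
      rw [h]
      simpa using hx
    · rw [nhds_inr, Filter.eventually_map]
      filter_upwards [o'.locally_constant x₀] with x hx
      have h : tangentCoordChange I (Sum.inr x : M ⊕ N) (Sum.inr x₀) (Sum.inr x)
          = tangentCoordChange I x x₀ x := by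
        rw [tangentCoordChange_def, tangentCoordChange_def]
        simp only [extChartAt, ChartedSpace.sum_chartAt_inr]
        congr 1
        · ext e
          simp [Sum.inr_injective.extend_apply]
        · simp [Sum.inr_injective.extend_apply]
      rw [h]
      simpa using hx

/-- A singular `p`-manifold in `A`: a continuous map to `A` from a closed (compact, without
boundary) Hausdorff oriented smooth `p`-manifold. -/
structure OrientedSingularManifold (p : ℕ) (A : Type*) [TopologicalSpace A]
    extends SingularManifold.{0} A ∞ (𝓡 p) where
  [t2Space : T2Space M]
  orientation : ManifoldOrientation (𝓡 p) M

namespace OrientedSingularManifold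

variable {p : ℕ} {A B : Type*} [TopologicalSpace A] [TopologicalSpace B]

instance (s : OrientedSingularManifold p A) : T2Space s.M := s.t2Space

/-- The disjoint union of singular manifolds. -/
def sum (s t : OrientedSingularManifold p A) : OrientedSingularManifold p A where
  toSingularManifold := s.toSingularManifold.sum t.toSingularManifold
  t2Space := inferInstanceAs (T2Space (s.M ⊕ t.M))
  orientation := s.orientation.sum t.orientation

/-- The composition of a singular manifold with a continuous map. -/
def map (φ : C(A, B)) (s : OrientedSingularManifold p A) : OrientedSingularManifold p B where
  toSingularManifold := s.toSingularManifold.map φ.continuous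
  t2Space := s.t2Space
  orientation := s.orientation

end OrientedSingularManifold

/-- `N × [0, 1)`, as a subset of `N × [0, ∞)`. -/
def collarDomain (N : Type*) : Set (N × EuclideanHalfSpace 1) := {q | q.2.1 0 < 1}

/-- A collar in `W` of a closed `p`-manifold `N`: a diffeomorphism of `N × [0, 1)` onto an open
subset of `W`, i.e. an injective local diffeomorphism. (The values of `toFun` outside
`N × [0, 1)` are irrelevant.) -/
structure BoundaryCollar (p : ℕ) (N W : Type*)
    [TopologicalSpace N] [ChartedSpace (EuclideanSpace ℝ (Fin p)) N]
    [TopologicalSpace W]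
    [ChartedSpace (ModelProd (EuclideanSpace ℝ (Fin p)) (EuclideanHalfSpace 1)) W] where
  toFun : N × EuclideanHalfSpace 1 → W
  injOn : Set.InjOn toFun (collarDomain N)
  isLocalDiffeomorphOn :
    IsLocalDiffeomorphOn (collarModel p) (collarModel p) ∞ toFun (collarDomain N)

namespace BoundaryCollar

variable {p : ℕ} {N W : Type*}
  [TopologicalSpace N] [ChartedSpace (EuclideanSpace ℝ (Fin p)) N]
  [TopologicalSpace W]
  [ChartedSpace (ModelProd (EuclideanSpace ℝ (Fin p)) (EuclideanHalfSpace 1)) W]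

/-- The restriction of the collar to `N × {0}`. -/
def base (θ : BoundaryCollar p N W) (x : N) : W := θ.toFun (x, ⟨0, le_rfl⟩)

/-- The Jacobian determinant of the collar at `q`, computed in the preferred charts and corrected
by the signs of the orientations: it is positive iff the collar preserves, and negative iff it
reverses, the orientation at `q`, for the product orientation of `N × [0, 1)`. -/
def orientedJacobian [IsManifold (𝓡 p) 1 N] [IsManifold (collarModel p) 1 W]
    (oN : ManifoldOrientation (𝓡 p) N) (oW : ManifoldOrientation (collarModel p) W)
    (θ : BoundaryCollar p N W) (q : N × EuclideanHalfSpace 1) : ℝ :=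
  let D : EuclideanSpace ℝ (Fin p) × EuclideanSpace ℝ (Fin 1) →L[ℝ]
      EuclideanSpace ℝ (Fin p) × EuclideanSpace ℝ (Fin 1) :=
    mfderiv (collarModel p) (collarModel p) θ.toFun q
  ((oN.sign q.1 : ℤ) : ℝ) * ((oW.sign (θ.toFun q) : ℤ) : ℝ) * D.det

end BoundaryCollar

/-- An oriented bordism between the closed oriented `p`-manifolds `N₀` and `N₁`: a compact
Hausdorff oriented smooth `(p+1)`-manifold `W` with boundary `∂W = N₀ ⊔ -N₁`. The identification
of the boundary is given, as usual, by disjoint collars `N₀ × [0, 1) → W` and `N₁ × [0, 1) → W`,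
of which the first preserves and the second reverses the orientation. -/
structure OrientedBordism (p : ℕ) (N₀ N₁ : Type*)
    [TopologicalSpace N₀] [ChartedSpace (EuclideanSpace ℝ (Fin p)) N₀] [IsManifold (𝓡 p) 1 N₀]
    [TopologicalSpace N₁] [ChartedSpace (EuclideanSpace ℝ (Fin p)) N₁] [IsManifold (𝓡 p) 1 N₁]
    (o₀ : ManifoldOrientation (𝓡 p) N₀) (o₁ : ManifoldOrientation (𝓡 p) N₁) where
  W : Type
  [topW : TopologicalSpace W]
  [chartedW : ChartedSpace (ModelProd (EuclideanSpace ℝ (Fin p)) (EuclideanHalfSpace 1)) W]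
  [isManifoldW : IsManifold (collarModel p) ∞ W]
  [compactW : CompactSpace W]
  [t2W : T2Space W]
  orientation : ManifoldOrientation (collarModel p) W
  collar₀ : BoundaryCollar p N₀ W
  collar₁ : BoundaryCollar p N₁ W
  disjoint_collars :
    Disjoint (collar₀.toFun '' collarDomain N₀) (collar₁.toFun '' collarDomain N₁)
  boundary_eq : (collarModel p).boundary W = Set.range collar₀.base ∪ Set.range collar₁.base
  preserves₀ : ∀ q ∈ collarDomain N₀, 0 < collar₀.orientedJacobian o₀ orientation q
  reverses₁ : ∀ q ∈ collarDomain N₁, collar₁.orientedJacobian o₁ orientation q < 0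

instance {p : ℕ} {N₀ N₁ : Type*}
    [TopologicalSpace N₀] [ChartedSpace (EuclideanSpace ℝ (Fin p)) N₀] [IsManifold (𝓡 p) 1 N₀]
    [TopologicalSpace N₁] [ChartedSpace (EuclideanSpace ℝ (Fin p)) N₁] [IsManifold (𝓡 p) 1 N₁]
    {o₀ : ManifoldOrientation (𝓡 p) N₀} {o₁ : ManifoldOrientation (𝓡 p) N₁}
    (b : OrientedBordism p N₀ N₁ o₀ o₁) : TopologicalSpace b.W := b.topW

instance {p : ℕ} {N₀ N₁ : Type*}
    [TopologicalSpace N₀] [ChartedSpace (EuclideanSpace ℝ (Fin p)) N₀] [IsManifold (𝓡 p) 1 N₀]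
    [TopologicalSpace N₁] [ChartedSpace (EuclideanSpace ℝ (Fin p)) N₁] [IsManifold (𝓡 p) 1 N₁]
    {o₀ : ManifoldOrientation (𝓡 p) N₀} {o₁ : ManifoldOrientation (𝓡 p) N₁}
    (b : OrientedBordism p N₀ N₁ o₀ o₁) :
    ChartedSpace (ModelProd (EuclideanSpace ℝ (Fin p)) (EuclideanHalfSpace 1)) b.W := b.chartedW

section Nielsen

variable {X X' Z : Type*} [TopologicalSpace X] [TopologicalSpace X'] [TopologicalSpace Z]

/-- Nielsen equivalence of singular `p`-manifolds in `C = f⁻¹(Y)`: there are a bordism `W` between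
them and maps `h : W → X` and `k : W → Y` extending `s₀ ⊔ s₁` and `f s₀ ⊔ f s₁`, such that `f h`
and `k` are homotopic as maps to `Z` relative to the boundary of `W`. -/
def NielsenEquiv {p : ℕ} (f : C(X, Z)) (Y : Set Z)
    (s₀ s₁ : OrientedSingularManifold p (f ⁻¹' Y)) : Prop :=
  ∃ (b : OrientedBordism p s₀.M s₁.M s₀.orientation s₁.orientation)
    (h : C(b.W, X)) (k : C(b.W, Y)),
    (∀ x, h (b.collar₀.base x) = s₀.f x) ∧ (∀ x, h (b.collar₁.base x) = s₁.f x) ∧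
    (∀ x, (k (b.collar₀.base x) : Z) = f (s₀.f x)) ∧
    (∀ x, (k (b.collar₁.base x) : Z) = f (s₁.f x)) ∧
    (f.comp h).HomotopicRel ((⟨Subtype.val, continuous_subtype_val⟩ : C(Y, Z)).comp k)
      ((collarModel p).boundary b.W)

/-- The set `S'_p(f, Y)` of Nielsen classes of order `p`. -/
def NielsenClass (p : ℕ) (f : C(X, Z)) (Y : Set Z) :=
  Quot (NielsenEquiv (p := p) f Y)

/-- The Nielsen class of a singular manifold. -/
def NielsenClass.mk {p : ℕ} (f : C(X, Z)) (Y : Set Z)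
    (s : OrientedSingularManifold p (f ⁻¹' Y)) : NielsenClass p f Y :=
  Quot.mk _ s

/-- The map of preimage sets `f⁻¹(Y) → f'⁻¹(Y)` given by `k : X → X'` with `f' k = f`. -/
def preimageMap {f : C(X, Z)} {f' : C(X', Z)} (Y : Set Z) (k : C(X, X')) (hk : f'.comp k = f) :
    C(f ⁻¹' Y, f' ⁻¹' Y) where
  toFun x := ⟨k x.1, by
    have h : f' (k x.1) = f x.1 := DFunLike.congr_fun hk x.1
    rw [Set.mem_preimage, h]
    exact x.2⟩
  continuous_toFun := by fun_prop

/-- The map `S'_p(f, Y) → S'_p(f', Y)`, `[s] ↦ [k s]`, induced by `k : X → X'` with `f' k = f`. -/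
def NielsenClass.map {p : ℕ} {f : C(X, Z)} {f' : C(X', Z)} (Y : Set Z) (k : C(X, X'))
    (hk : f'.comp k = f) : NielsenClass p f Y → NielsenClass p f' Y :=
  Quot.map (OrientedSingularManifold.map (preimageMap Y k hk)) (by
    subst hk
    rintro s₀ s₁ ⟨b, h, l, h₀, h₁, l₀, l₁, e⟩
    exact ⟨b, k.comp h, l, fun x => congrArg k (h₀ x), fun x => congrArg k (h₁ x), l₀, l₁, e⟩)

/-- The inclusion `i_t : X → I × X`, `x ↦ (t, x)`. -/
def sliceInclusion (X : Type*) [TopologicalSpace X] (t : unitInterval) : C(X, unitInterval × X) where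
  toFun x := (t, x)
  continuous_toFun := by fun_prop

variable {f g : C(X, Z)}

/-- For a homotopy `F` from `f` to `g`, the map `i'_{0*} : S'_p(f, Y) → S'_p(F, Y)`. -/
def nielsenStart (p : ℕ) (Y : Set Z) (F : f.Homotopy g) :
    NielsenClass p f Y → NielsenClass p F.toContinuousMap Y :=
  NielsenClass.map Y (sliceInclusion X 0) (by ext x; exact F.apply_zero x)

/-- For a homotopy `F` from `f` to `g`, the map `i'_{1*} : S'_p(g, Y) → S'_p(F, Y)`. -/
def nielsenEnd (p : ℕ) (Y : Set Z) (F : f.Homotopy g) :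
    NielsenClass p g Y → NielsenClass p F.toContinuousMap Y :=
  NielsenClass.map Y (sliceInclusion X 1) (by ext x; exact F.apply_one x)

/-- `M_p^F = Im i'_{0*} ∩ Im i'_{1*}`, inside `S'_p(F, Y)`. -/
def preservedClasses (p : ℕ) (Y : Set Z) (F : f.Homotopy g) :
    Set (NielsenClass p F.toContinuousMap Y) :=
  Set.range (nielsenStart p Y F) ∩ Set.range (nielsenEnd p Y F)

/-- `S_p(f, Y)`: the intersection, over all homotopies `F` of `f`, of the sets `M_p^F`, viewed
inside `S'_p(f, Y)` through the maps `i'_{0*}`. -/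
def essentialClasses (p : ℕ) (f : C(X, Z)) (Y : Set Z) : Set (NielsenClass p f Y) :=
  ⋂ (g : C(X, Z)) (F : f.Homotopy g), nielsenStart p Y F ⁻¹' preservedClasses p Y F

end Nielsen

end

/-!
A Nielsen equivalence of two singular manifolds in `f⁻¹(Y)` is the same thing as an oriented bordism
of the corresponding maps into the homotopy pullback of `f` and the inclusion `Y → Z`: the homotopy
from `f ∘ H` to `G` supplies the paths, and it is relative to the boundary exactly when these paths
are constant there. So the Nielsen classes form a group because bordism of maps to a fixed space is
compatible with disjoint unions, with cylinders as identities and, bent, as inverses. Transitivity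
requires gluing two bordisms `W` and `W'` along a common end `N`. Here the two ends are removed and
the points `(x, t)` and `(x, 1 - t)` of the open collars `N × (0, 1)` of `N` in `W` and in `W'` are
identified, which makes the result the quotient of an open subset of `W ⊔ W'` by an involution that
preserves the orientation; collapsing the inner halves of the collars makes the maps on `W` and
`W'` agree.

Since `{t} × X` is a strong deformation retract of `I × X`, the maps `i'_{t*}` are injective.
Concatenating with `F` and reversing it shows that `i'_{0*}` and `i'_{1*}` map `S_p(f)` and `S_p(g)`
onto the same subgroup of `S'_p(F)`, and the isomorphism of the two groups follows.
-/

noncomputable section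

open Set Filter Topology

/-! ### Local diffeomorphisms -/

section LocalDiffeomorph

variable {𝕜 E F G H₁ H₂ H₃ : Type*} [NontriviallyNormedField 𝕜]
  [NormedAddCommGroup E] [NormedSpace 𝕜 E] [NormedAddCommGroup F] [NormedSpace 𝕜 F]
  [NormedAddCommGroup G] [NormedSpace 𝕜 G]
  [TopologicalSpace H₁] [TopologicalSpace H₂] [TopologicalSpace H₃]
  {I : ModelWithCorners 𝕜 E H₁} {J : ModelWithCorners 𝕜 F H₂} {K : ModelWithCorners 𝕜 G H₃}
  {M N P : Type*} [TopologicalSpace M] [ChartedSpace H₁ M] [TopologicalSpace N] [ChartedSpace H₂ N]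
  [TopologicalSpace P] [ChartedSpace H₃ P] {n : WithTop ℕ∞}

theorem isLocalDiffeomorphAt_of_contMDiffOn (e : OpenPartialHomeomorph M N)
    (he : ContMDiffOn I J n e e.source) (he' : ContMDiffOn J I n e.symm e.target) {x : M}
    (hx : x ∈ e.source) : IsLocalDiffeomorphAt I J n e x :=
  ⟨{ e with contMDiffOn_toFun := he, contMDiffOn_invFun := he' }, hx, fun _ _ => rfl⟩

theorem isLocalDiffeomorphAt_of_mem_maximalAtlas {e : OpenPartialHomeomorph M H₁}
    (he : e ∈ IsManifold.maximalAtlas I n M) {x : M} (hx : x ∈ e.source) :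
    IsLocalDiffeomorphAt I I n e x :=
  isLocalDiffeomorphAt_of_contMDiffOn e (contMDiffOn_of_mem_maximalAtlas he)
    (contMDiffOn_symm_of_mem_maximalAtlas he) hx

theorem isLocalDiffeomorphAt_of_invOn {f : M → N} {g : N → M} {s : Set M} {t : Set N}
    (hs : IsOpen s) (ht : IsOpen t) (hf : ContMDiffOn I J n f s) (hg : ContMDiffOn J I n g t)
    (hst : MapsTo f s t) (hts : MapsTo g t s) (hinv : InvOn g f s t) {x : M} (hx : x ∈ s) :
    IsLocalDiffeomorphAt I J n f x :=
  ⟨{ toFun := f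
     invFun := g
     source := s
     target := t
     map_source' := hst
     map_target' := hts
     left_inv' := hinv.1
     right_inv' := hinv.2
     open_source := hs
     open_target := ht
     contMDiffOn_toFun := hf
     contMDiffOn_invFun := hg }, hx, fun _ _ => rfl⟩

theorem isLocalDiffeomorphAt_id (x : M) : IsLocalDiffeomorphAt I I n (id : M → M) x :=
  (Diffeomorph.refl I M n).isLocalDiffeomorph x

theorem isLocalDiffeomorphAt_of_eventuallyEq {f g : M → N} {x : M}
    (hf : IsLocalDiffeomorphAt I J n f x) (h : g =ᶠ[𝓝 x] f) : IsLocalDiffeomorphAt I J n g x := by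
  obtain ⟨Φ, hx, heq⟩ := hf
  obtain ⟨s, hs, hso, hxs⟩ := eventually_nhds_iff.1 h
  exact ⟨{ Φ.toOpenPartialHomeomorph.restrOpen s hso with
           contMDiffOn_toFun := Φ.contMDiffOn_toFun.mono inter_subset_left
           contMDiffOn_invFun := Φ.contMDiffOn_invFun.mono inter_subset_left },
    ⟨hx, hxs⟩, fun y hy => (hs y hy.2).trans (heq hy.1)⟩

theorem isLocalDiffeomorphAt_of_comp {f : M → N} {g : N → P} {x : M}
    (hf : IsLocalDiffeomorphAt I J n f x) (hgf : IsLocalDiffeomorphAt I K n (g ∘ f) x) :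
    IsLocalDiffeomorphAt J K n g (f x) := by
  have hx : hf.localInverse (f x) = x := hf.localInverse_left_inv hf.localInverse_mem_target
  rw [← hx] at hgf
  refine isLocalDiffeomorphAt_of_eventuallyEq
    (hf.localInverse_isLocalDiffeomorphAt.comp K P hgf) ?_
  filter_upwards [hf.localInverse_eventuallyEq_right] with y hy
  exact congrArg g hy.symm

theorem isLocalDiffeomorphAt_of_comp_eventuallyEq_id {f : M → N} {g : N → M} {x : M}
    (hf : IsLocalDiffeomorphAt I J n f x) (h : g ∘ f =ᶠ[𝓝 x] id) :
    IsLocalDiffeomorphAt J I n g (f x) :=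
  isLocalDiffeomorphAt_of_comp hf
    (isLocalDiffeomorphAt_of_eventuallyEq (isLocalDiffeomorphAt_id x) h)

end LocalDiffeomorph

section LocalDiffeomorphProd

variable {𝕜 E F E' F' H₁ H₂ H₁' H₂' : Type*} [NontriviallyNormedField 𝕜]
  [NormedAddCommGroup E] [NormedSpace 𝕜 E] [NormedAddCommGroup F] [NormedSpace 𝕜 F]
  [NormedAddCommGroup E'] [NormedSpace 𝕜 E'] [NormedAddCommGroup F'] [NormedSpace 𝕜 F']
  [TopologicalSpace H₁] [TopologicalSpace H₂] [TopologicalSpace H₁'] [TopologicalSpace H₂']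
  {I : ModelWithCorners 𝕜 E H₁} {J : ModelWithCorners 𝕜 F H₂}
  {I' : ModelWithCorners 𝕜 E' H₁'} {J' : ModelWithCorners 𝕜 F' H₂'}
  {M N M' N' : Type*} [TopologicalSpace M] [ChartedSpace H₁ M]
  [TopologicalSpace N] [ChartedSpace H₂ N] [TopologicalSpace M'] [ChartedSpace H₁' M']
  [TopologicalSpace N'] [ChartedSpace H₂' N'] {n : WithTop ℕ∞}

theorem isLocalDiffeomorphAt_prodMap {f : M → N} {g : M' → N'} {q : M × M'}
    (hf : IsLocalDiffeomorphAt I J n f q.1) (hg : IsLocalDiffeomorphAt I' J' n g q.2) :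
    IsLocalDiffeomorphAt (I.prod I') (J.prod J') n (Prod.map f g) q := by
  obtain ⟨Φ, hx, hΦ⟩ := hf
  obtain ⟨Ψ, hy, hΨ⟩ := hg
  exact ⟨{ Φ.toOpenPartialHomeomorph.prod Ψ.toOpenPartialHomeomorph with
           contMDiffOn_toFun := Φ.contMDiffOn_toFun.prodMap Ψ.contMDiffOn_toFun
           contMDiffOn_invFun := Φ.contMDiffOn_invFun.prodMap Ψ.contMDiffOn_invFun },
    ⟨hx, hy⟩, fun _ hz => Prod.ext (hΦ hz.1) (hΨ hz.2)⟩

end LocalDiffeomorphProd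

section LocalDiffeomorphSum

variable {𝕜 E H : Type*} [NontriviallyNormedField 𝕜] [NormedAddCommGroup E] [NormedSpace 𝕜 E]
  [TopologicalSpace H] {I : ModelWithCorners 𝕜 E H} {M N : Type*}
  [TopologicalSpace M] [ChartedSpace H M] [TopologicalSpace N] [ChartedSpace H N] {n : WithTop ℕ∞}

theorem isLocalDiffeomorphAt_inl (x : M) :
    IsLocalDiffeomorphAt I I n (Sum.inl : M → M ⊕ N) x :=
  isLocalDiffeomorphAt_of_invOn (g := Sum.elim id fun _ => x) isOpen_univ isOpen_range_inl
    ContMDiff.inl.contMDiffOn (ContMDiff.sumElim contMDiff_id contMDiff_const).contMDiffOn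
    (fun y _ => mem_range_self y) (mapsTo_univ _ _)
    ⟨fun _ _ => rfl, by rintro _ ⟨y, rfl⟩; rfl⟩ (mem_univ x)

theorem isLocalDiffeomorphAt_inr (x : N) :
    IsLocalDiffeomorphAt I I n (Sum.inr : N → M ⊕ N) x :=
  isLocalDiffeomorphAt_of_invOn (g := Sum.elim (fun _ => x) id) isOpen_univ isOpen_range_inr
    ContMDiff.inr.contMDiffOn (ContMDiff.sumElim contMDiff_const contMDiff_id).contMDiffOn
    (fun y _ => mem_range_self y) (mapsTo_univ _ _)
    ⟨fun _ _ => rfl, by rintro _ ⟨y, rfl⟩; rfl⟩ (mem_univ x)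

end LocalDiffeomorphSum

/-! ### Signed Jacobians and orientations -/

section SignedJacobian

variable {E H₁ H₂ H₃ : Type*} [NormedAddCommGroup E] [NormedSpace ℝ E]
  [TopologicalSpace H₁] [TopologicalSpace H₂] [TopologicalSpace H₃]
  {I : ModelWithCorners ℝ E H₁} {J : ModelWithCorners ℝ E H₂} {K : ModelWithCorners ℝ E H₃}
  {M N P : Type*} [TopologicalSpace M] [ChartedSpace H₁ M] [TopologicalSpace N] [ChartedSpace H₂ N]
  [TopologicalSpace P] [ChartedSpace H₃ P]

/-- The Jacobian determinant of a map between manifolds with the same model vector space, in the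
preferred charts. -/
def jacobian (I : ModelWithCorners ℝ E H₁) (J : ModelWithCorners ℝ E H₂) (f : M → N) (x : M) : ℝ :=
  ContinuousLinearMap.det (M := E) (mfderiv I J f x)

/-- The Jacobian determinant corrected by signs `s` on the source and `t` on the target, which
compare the preferred charts with orientations: `f` preserves the orientation at `x` iff this is
positive and reverses it iff this is negative. The signs are arbitrary functions, so that the notion
is available before they are known to come from orientations. -/
def signedJacobian (I : ModelWithCorners ℝ E H₁) (J : ModelWithCorners ℝ E H₂)
    (s : M → ℤˣ) (t : N → ℤˣ) (f : M → N) (x : M) : ℝ :=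
  ((s x : ℤ) : ℝ) * ((t (f x) : ℤ) : ℝ) * jacobian I J f x

theorem units_cast_mul_self (u : ℤˣ) : ((u : ℤ) : ℝ) * ((u : ℤ) : ℝ) = 1 :=
  mod_cast Int.units_coe_mul_self u

theorem jacobian_eq_det {f : M → N} {x : M} {A : E →L[ℝ] E}
    (h : HasMFDerivAt I J f x A) : jacobian I J f x = A.det :=
  congrArg (ContinuousLinearMap.det (M := E)) h.mfderiv

theorem jacobian_congr {f g : M → N} {x : M} (h : f =ᶠ[𝓝 x] g) :
    jacobian I J f x = jacobian I J g x :=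
  congrArg (ContinuousLinearMap.det (M := E)) (h.mfderiv_eq (I := I) (I' := J))

theorem signedJacobian_congr {f g : M → N} {x : M} {s : M → ℤˣ} {t : N → ℤˣ}
    (h : f =ᶠ[𝓝 x] g) : signedJacobian I J s t f x = signedJacobian I J s t g x := by
  rw [signedJacobian, signedJacobian, jacobian_congr h, h.eq_of_nhds]

theorem jacobian_id (x : M) : jacobian I I (id : M → M) x = 1 :=
  (jacobian_eq_det (hasMFDerivAt_id x)).trans LinearMap.det_id

theorem signedJacobian_id (s : M → ℤˣ) (x : M) : signedJacobian I I s s id x = 1 := by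
  rw [signedJacobian, jacobian_id, mul_one, id, units_cast_mul_self]

theorem jacobian_comp {f : M → N} {g : N → P} {x : M} (hg : MDifferentiableAt J K g (f x))
    (hf : MDifferentiableAt I J f x) :
    jacobian I K (g ∘ f) x = jacobian J K g (f x) * jacobian I J f x := by
  rw [jacobian, mfderiv_comp x hg hf]
  exact LinearMap.det_comp _ _

theorem signedJacobian_comp {f : M → N} {g : N → P} {x : M} (s : M → ℤˣ) (t : N → ℤˣ) (u : P → ℤˣ)
    (hg : MDifferentiableAt J K g (f x)) (hf : MDifferentiableAt I J f x) :
    signedJacobian I K s u (g ∘ f) x =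
      signedJacobian J K t u g (f x) * signedJacobian I J s t f x := by
  have ht := units_cast_mul_self (t (f x))
  rw [signedJacobian, signedJacobian, signedJacobian, jacobian_comp hg hf, Function.comp_apply]
  linear_combination (-(((s x : ℤ) : ℝ) * ((u (g (f x)) : ℤ) : ℝ) * jacobian J K g (f x) *
    jacobian I J f x)) * ht

theorem signedJacobian_comp_of_isLocalDiffeomorphAt {n : WithTop ℕ∞} (hn : n ≠ 0) {f : M → N}
    {g : N → P} {x : M} (s : M → ℤˣ) (t : N → ℤˣ) (u : P → ℤˣ)
    (hg : IsLocalDiffeomorphAt J K n g (f x)) (hf : IsLocalDiffeomorphAt I J n f x) :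
    signedJacobian I K s u (g ∘ f) x =
      signedJacobian J K t u g (f x) * signedJacobian I J s t f x :=
  signedJacobian_comp s t u (hg.mdifferentiableAt hn) (hf.mdifferentiableAt hn)

theorem signedJacobian_mul_eq_one {n : WithTop ℕ∞} (hn : n ≠ 0) {f : M → N} {g : N → M} {x : M}
    (s : M → ℤˣ) (t : N → ℤˣ) (hf : IsLocalDiffeomorphAt I J n f x) (h : g ∘ f =ᶠ[𝓝 x] id) :
    signedJacobian J I t s g (f x) * signedJacobian I J s t f x = 1 := by
  rw [← signedJacobian_comp_of_isLocalDiffeomorphAt hn s t s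
    (isLocalDiffeomorphAt_of_comp_eventuallyEq_id hf h) hf, signedJacobian_congr h,
    signedJacobian_id]

theorem signedJacobian_neg_left (s : M → ℤˣ) (t : N → ℤˣ) (f : M → N) (x : M) :
    signedJacobian I J (fun x => -s x) t f x = -signedJacobian I J s t f x := by
  simp [signedJacobian]

theorem signedJacobian_neg_right (s : M → ℤˣ) (t : N → ℤˣ) (f : M → N) (x : M) :
    signedJacobian I J s (fun x => -t x) f x = -signedJacobian I J s t f x := by
  simp [signedJacobian]

theorem jacobian_chartAt [IsManifold I 1 M] {x x₀ : M} (hx : x ∈ (chartAt H₁ x₀).source) :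
    jacobian I I (chartAt H₁ x₀) x = (tangentCoordChange I x x₀ x).det :=
  congrArg (ContinuousLinearMap.det (M := E)) (mfderiv_chartAt_eq_tangentCoordChange hx)

theorem jacobian_chartAt_self [IsManifold I 1 M] (x : M) :
    jacobian I I (chartAt H₁ x) x = 1 := by
  have hid : tangentCoordChange I x x x = ContinuousLinearMap.id ℝ E := by
    ext v
    exact tangentCoordChange_self (mem_extChartAt_source x)
  rw [jacobian_chartAt (mem_chart_source _ x), hid]
  exact LinearMap.det_id

namespace ManifoldOrientation

theorem signedJacobian_chartAt_pos [IsManifold I 1 M] (o : ManifoldOrientation I M) (x₀ : M) :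
    ∀ᶠ x in 𝓝 x₀, 0 < signedJacobian I I o.sign (fun _ => o.sign x₀) (chartAt H₁ x₀) x := by
  filter_upwards [o.locally_constant x₀, chart_source_mem_nhds H₁ x₀] with x hx hx'
  rwa [signedJacobian, jacobian_chartAt hx']

/-- The orientation given by signs for which the preferred charts preserve the orientation near
their centres. -/
def ofSignedJacobian [IsManifold I 1 M] (s : M → ℤˣ)
    (hs : ∀ x₀, ∀ᶠ x in 𝓝 x₀, 0 < signedJacobian I I s (fun _ => s x₀) (chartAt H₁ x₀) x) :
    ManifoldOrientation I M where
  sign := s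
  locally_constant x₀ := by
    filter_upwards [hs x₀, chart_source_mem_nhds H₁ x₀] with x hx hx'
    rwa [signedJacobian, jacobian_chartAt hx'] at hx

/-- The opposite orientation. -/
def neg [IsManifold I 1 M] (o : ManifoldOrientation I M) : ManifoldOrientation I M where
  sign x := -o.sign x
  locally_constant x₀ := by
    filter_upwards [o.locally_constant x₀] with x hx
    simpa using hx

end ManifoldOrientation

end SignedJacobian

section SignedJacobianProd

variable {E E' H₁ H₂ H₁' H₂' : Type*} [NormedAddCommGroup E] [NormedSpace ℝ E]
  [NormedAddCommGroup E'] [NormedSpace ℝ E'] [FiniteDimensional ℝ E] [FiniteDimensional ℝ E']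
  [TopologicalSpace H₁] [TopologicalSpace H₂] [TopologicalSpace H₁'] [TopologicalSpace H₂']
  {I : ModelWithCorners ℝ E H₁} {J : ModelWithCorners ℝ E H₂}
  {I' : ModelWithCorners ℝ E' H₁'} {J' : ModelWithCorners ℝ E' H₂'}
  {M N M' N' : Type*} [TopologicalSpace M] [ChartedSpace H₁ M]
  [TopologicalSpace N] [ChartedSpace H₂ N] [TopologicalSpace M'] [ChartedSpace H₁' M']
  [TopologicalSpace N'] [ChartedSpace H₂' N']

theorem jacobian_prodMap {f : M → N} {g : M' → N'} {q : M × M'}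
    (hf : MDifferentiableAt I J f q.1) (hg : MDifferentiableAt I' J' g q.2) :
    jacobian (I.prod I') (J.prod J') (Prod.map f g) q =
      jacobian I J f q.1 * jacobian I' J' g q.2 :=
  (congrArg (ContinuousLinearMap.det (M := E × E')) (mfderiv_prodMap hf hg)).trans
    (LinearMap.det_prodMap _ _)

theorem signedJacobian_prodMap {f : M → N} {g : M' → N'} {q : M × M'}
    (s : M → ℤˣ) (t : N → ℤˣ) (s' : M' → ℤˣ) (t' : N' → ℤˣ)
    (hf : MDifferentiableAt I J f q.1) (hg : MDifferentiableAt I' J' g q.2) :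
    signedJacobian (I.prod I') (J.prod J') (fun q => s q.1 * s' q.2) (fun q => t q.1 * t' q.2)
      (Prod.map f g) q =
      signedJacobian I J s t f q.1 * signedJacobian I' J' s' t' g q.2 := by
  simp only [signedJacobian, jacobian_prodMap hf hg, Prod.map_fst, Prod.map_snd, Units.val_mul,
    Int.cast_mul]
  ring

theorem signedJacobian_prodMap_fst {f : M → N} {g : M' → N'} {q : M × M'}
    (s : M → ℤˣ) (t : N → ℤˣ)
    (hf : MDifferentiableAt I J f q.1) (hg : MDifferentiableAt I' J' g q.2) :
    signedJacobian (I.prod I') (J.prod J') (fun q => s q.1) (fun q => t q.1) (Prod.map f g) q =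
      signedJacobian I J s t f q.1 * jacobian I' J' g q.2 := by
  simpa [signedJacobian] using signedJacobian_prodMap s t (fun _ => 1) (fun _ => 1) hf hg

/-- The product orientation. -/
def ManifoldOrientation.prod [IsManifold I 1 M] [IsManifold I' 1 M']
    (o : ManifoldOrientation I M) (o' : ManifoldOrientation I' M') :
    ManifoldOrientation (I.prod I') (M × M') :=
  .ofSignedJacobian (fun q => o.sign q.1 * o'.sign q.2) (by
    rintro ⟨x₀, y₀⟩
    rw [nhds_prod_eq]
    filter_upwards [((o.signedJacobian_chartAt_pos x₀).and (chart_source_mem_nhds H₁ x₀)).prod_mk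
      ((o'.signedJacobian_chartAt_pos y₀).and (chart_source_mem_nhds H₁' y₀))] with q hq
    have hpos := mul_pos hq.1.1 hq.2.1
    rwa [← signedJacobian_prodMap (q := q) o.sign (fun _ => o.sign x₀) o'.sign
      (fun _ => o'.sign y₀) (mdifferentiableAt_atlas (chart_mem_atlas _ _) hq.1.2)
      (mdifferentiableAt_atlas (chart_mem_atlas _ _) hq.2.2), chartedSpaceSelf_prod] at hpos)

end SignedJacobianProd

section SignedJacobianSum

variable {E H H' : Type*} [NormedAddCommGroup E] [NormedSpace ℝ E] [TopologicalSpace H]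
  [TopologicalSpace H'] {I : ModelWithCorners ℝ E H} {J : ModelWithCorners ℝ E H'} {M N P : Type*}
  [TopologicalSpace M] [ChartedSpace H M] [TopologicalSpace N] [ChartedSpace H N]
  [TopologicalSpace P] [ChartedSpace H' P]

theorem jacobian_inl (x : M) : jacobian I I (Sum.inl : M → M ⊕ N) x = 1 :=
  (jacobian_eq_det (hasMFDerivWithinAt_univ.1 hasMFDerivWithinAt_inl)).trans LinearMap.det_id

theorem jacobian_inr (x : N) : jacobian I I (Sum.inr : N → M ⊕ N) x = 1 :=
  (jacobian_eq_det (hasMFDerivWithinAt_univ.1 hasMFDerivWithinAt_inr)).trans LinearMap.det_id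

theorem signedJacobian_inl (s : M → ℤˣ) (t : N → ℤˣ) (x : M) :
    signedJacobian I I s (Sum.elim s t) Sum.inl x = 1 := by
  rw [signedJacobian, jacobian_inl, Sum.elim_inl, mul_one, units_cast_mul_self]

theorem signedJacobian_inr (s : M → ℤˣ) (t : N → ℤˣ) (x : N) :
    signedJacobian I I t (Sum.elim s t) Sum.inr x = 1 := by
  rw [signedJacobian, jacobian_inr, Sum.elim_inr, mul_one, units_cast_mul_self]

theorem signedJacobian_sum_inl {n : WithTop ℕ∞} (hn : n ≠ 0) {φ : M ⊕ N → P} {x : M}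
    (hφ : IsLocalDiffeomorphAt I J n φ (Sum.inl x)) (s : M → ℤˣ) (t : N → ℤˣ) (u : P → ℤˣ) :
    signedJacobian I J (Sum.elim s t) u φ (Sum.inl x) =
      signedJacobian I J s u (φ ∘ Sum.inl) x := by
  rw [signedJacobian_comp_of_isLocalDiffeomorphAt hn s (Sum.elim s t) u hφ
    (isLocalDiffeomorphAt_inl x), signedJacobian_inl, mul_one]

theorem signedJacobian_sum_inr {n : WithTop ℕ∞} (hn : n ≠ 0) {φ : M ⊕ N → P} {x : N}
    (hφ : IsLocalDiffeomorphAt I J n φ (Sum.inr x)) (s : M → ℤˣ) (t : N → ℤˣ) (u : P → ℤˣ) :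
    signedJacobian I J (Sum.elim s t) u φ (Sum.inr x) =
      signedJacobian I J t u (φ ∘ Sum.inr) x := by
  rw [signedJacobian_comp_of_isLocalDiffeomorphAt hn t (Sum.elim s t) u hφ
    (isLocalDiffeomorphAt_inr x), signedJacobian_inr, mul_one]

end SignedJacobianSum

/-! ### The closed half line and the unit interval -/

section HalfLine

/-- The point of the closed half line with coordinate `r`; negative numbers are sent to `0`. -/
def halfLinePoint (r : ℝ) : EuclideanHalfSpace 1 :=
  ⟨WithLp.toLp 2 fun _ => max r 0, le_max_right _ _⟩

/-- The affine map `t ↦ a t + b` of the closed half line, cut off at `0`. -/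
def halfLineAffine (a b : ℝ) (t : EuclideanHalfSpace 1) : EuclideanHalfSpace 1 :=
  halfLinePoint (a * t.1 0 + b)

theorem halfLinePoint_coord {r : ℝ} (hr : 0 ≤ r) : (halfLinePoint r).1 0 = r :=
  max_eq_left hr

theorem halfLine_ext {t u : EuclideanHalfSpace 1} (h : t.1 0 = u.1 0) : t = u := by
  ext i
  rw [Subsingleton.elim i 0]
  exact h

theorem halfLineAffine_coord {a b : ℝ} {t : EuclideanHalfSpace 1} (h : 0 ≤ a * t.1 0 + b) :
    (halfLineAffine a b t).1 0 = a * t.1 0 + b :=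
  max_eq_left h

theorem continuous_halfLinePoint : Continuous halfLinePoint := by
  unfold halfLinePoint
  fun_prop

theorem continuous_halfLineAffine (a b : ℝ) : Continuous (halfLineAffine a b) :=
  continuous_halfLinePoint.comp (by fun_prop)

theorem writtenInExtChartAt_halfLineAffine {a b : ℝ} {t : EuclideanHalfSpace 1}
    (h : ∀ᶠ u : EuclideanHalfSpace 1 in 𝓝 t, 0 ≤ a * u.1 0 + b) :
    writtenInExtChartAt (𝓡∂ 1) (𝓡∂ 1) t (halfLineAffine a b)
      =ᶠ[𝓝[range (𝓡∂ 1)] (extChartAt (𝓡∂ 1) t t)] fun y => a • y + WithLp.toLp 2 fun _ => b := by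
  have tendsto_symm : Tendsto (𝓡∂ 1).symm (𝓝 (extChartAt (𝓡∂ 1) t t)) (𝓝 t) := by
    simpa only [mfld_simps, chartAt_self_eq] using
      (𝓡∂ 1).continuous_symm.tendsto (extChartAt (𝓡∂ 1) t t)
  filter_upwards [(tendsto_symm.mono_left nhdsWithin_le_nhds).eventually h, self_mem_nhdsWithin]
  rintro _ hu ⟨u, rfl⟩
  rw [ModelWithCorners.left_inv] at hu
  ext i
  rw [Subsingleton.elim i 0]
  simp only [writtenInExtChartAt, mfld_simps]
  exact max_eq_left hu

theorem hasMFDerivAt_halfLineAffine {a b : ℝ} {t : EuclideanHalfSpace 1}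
    (h : ∀ᶠ u : EuclideanHalfSpace 1 in 𝓝 t, 0 ≤ a * u.1 0 + b) :
    HasMFDerivAt (𝓡∂ 1) (𝓡∂ 1) (halfLineAffine a b) t
      (a • ContinuousLinearMap.id ℝ (EuclideanSpace ℝ (Fin 1))) :=
  have hw := writtenInExtChartAt_halfLineAffine h
  ⟨(continuous_halfLineAffine a b).continuousAt,
    (((hasFDerivWithinAt_id _ _).const_smul a).add_const _).congr_of_eventuallyEq hw
      (hw.eq_of_nhdsWithin ⟨t, rfl⟩)⟩

theorem contMDiffAt_halfLineAffine {n : WithTop ℕ∞} {a b : ℝ} {t : EuclideanHalfSpace 1}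
    (h : ∀ᶠ u : EuclideanHalfSpace 1 in 𝓝 t, 0 ≤ a * u.1 0 + b) :
    ContMDiffAt (𝓡∂ 1) (𝓡∂ 1) n (halfLineAffine a b) t :=
  have hw := writtenInExtChartAt_halfLineAffine h
  contMDiffAt_iff.2 ⟨(continuous_halfLineAffine a b).continuousAt,
    ((contDiff_id.const_smul a).add contDiff_const).contDiffWithinAt.congr_of_eventuallyEq hw
      (hw.eq_of_nhdsWithin ⟨t, rfl⟩)⟩

theorem jacobian_halfLineAffine {a b : ℝ} {t : EuclideanHalfSpace 1}
    (h : ∀ᶠ u : EuclideanHalfSpace 1 in 𝓝 t, 0 ≤ a * u.1 0 + b) :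
    jacobian (𝓡∂ 1) (𝓡∂ 1) (halfLineAffine a b) t = a := by
  rw [jacobian_eq_det (hasMFDerivAt_halfLineAffine h)]
  simp [ContinuousLinearMap.det]

/-- The map `t ↦ t / 2` of the closed half line. -/
abbrev halfLineHalve : EuclideanHalfSpace 1 → EuclideanHalfSpace 1 := halfLineAffine (1 / 2) 0

/-- The map `t ↦ 1 - t` of the closed half line, cut off at `0`. -/
abbrev halfLineFlip : EuclideanHalfSpace 1 → EuclideanHalfSpace 1 := halfLineAffine (-1) 1

theorem halfLineHalve_coord (t : EuclideanHalfSpace 1) : (halfLineHalve t).1 0 = t.1 0 / 2 := by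
  have := t.2
  rw [halfLineAffine_coord] <;> linarith

theorem halfLineFlip_coord {t : EuclideanHalfSpace 1} (ht : t.1 0 ≤ 1) :
    (halfLineFlip t).1 0 = 1 - t.1 0 := by
  rw [halfLineAffine_coord] <;> linarith

theorem isLocalDiffeomorphAt_halfLineHalve {n : WithTop ℕ∞} (t : EuclideanHalfSpace 1) :
    IsLocalDiffeomorphAt (𝓡∂ 1) (𝓡∂ 1) n halfLineHalve t := by
  have double_coord (u : EuclideanHalfSpace 1) : (halfLineAffine 2 0 u).1 0 = 2 * u.1 0 := by
    have := u.2
    rw [halfLineAffine_coord] <;> linarith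
  have contMDiff_scale {c : ℝ} (hc : 0 ≤ c) :
      ContMDiff (𝓡∂ 1) (𝓡∂ 1) n (halfLineAffine c 0) := fun _ =>
    contMDiffAt_halfLineAffine (.of_forall fun v => by have := mul_nonneg hc v.2; linarith)
  refine isLocalDiffeomorphAt_of_invOn (g := halfLineAffine 2 0) isOpen_univ isOpen_univ
    (contMDiff_scale (by norm_num)).contMDiffOn (contMDiff_scale (by norm_num)).contMDiffOn
    (mapsTo_univ _ _) (mapsTo_univ _ _) ⟨fun u _ => ?_, fun u _ => ?_⟩ (mem_univ t) <;>
  · apply halfLine_ext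
    simp only [double_coord, halfLineHalve_coord]
    ring

theorem jacobian_halfLineHalve (t : EuclideanHalfSpace 1) :
    jacobian (𝓡∂ 1) (𝓡∂ 1) halfLineHalve t = 1 / 2 :=
  jacobian_halfLineAffine (.of_forall fun v => by have := v.2; linarith)

/-- The open interval `(0, 1)` in the closed half line. -/
def halfLineIoo : Set (EuclideanHalfSpace 1) := {t | 0 < t.1 0 ∧ t.1 0 < 1}

theorem isOpen_halfLineIoo : IsOpen halfLineIoo :=
  isOpen_Ioo.preimage (by fun_prop : Continuous fun t : EuclideanHalfSpace 1 => t.1 0)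

theorem mapsTo_halfLineFlip : MapsTo halfLineFlip halfLineIoo halfLineIoo := by
  rintro t ⟨h0, h1⟩
  constructor <;> rw [halfLineFlip_coord h1.le] <;> linarith

theorem leftInvOn_halfLineFlip : LeftInvOn halfLineFlip halfLineFlip halfLineIoo := by
  intro t ht
  apply halfLine_ext
  rw [halfLineFlip_coord (mapsTo_halfLineFlip ht).2.le, halfLineFlip_coord ht.2.le]
  ring

theorem eventually_flip_nonneg {t : EuclideanHalfSpace 1} (ht : t ∈ halfLineIoo) :
    ∀ᶠ u : EuclideanHalfSpace 1 in 𝓝 t, 0 ≤ (-1) * u.1 0 + 1 := by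
  filter_upwards [isOpen_halfLineIoo.mem_nhds ht] with u hu
  linarith [hu.2]

theorem isLocalDiffeomorphAt_halfLineFlip {n : WithTop ℕ∞} {t : EuclideanHalfSpace 1}
    (ht : t ∈ halfLineIoo) : IsLocalDiffeomorphAt (𝓡∂ 1) (𝓡∂ 1) n halfLineFlip t :=
  have smooth : ContMDiffOn (𝓡∂ 1) (𝓡∂ 1) n halfLineFlip halfLineIoo := fun _ hu =>
    (contMDiffAt_halfLineAffine (eventually_flip_nonneg hu)).contMDiffWithinAt
  isLocalDiffeomorphAt_of_invOn isOpen_halfLineIoo isOpen_halfLineIoo smooth smooth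
    mapsTo_halfLineFlip mapsTo_halfLineFlip ⟨leftInvOn_halfLineFlip, leftInvOn_halfLineFlip⟩ ht

theorem jacobian_halfLineFlip {t : EuclideanHalfSpace 1} (ht : t ∈ halfLineIoo) :
    jacobian (𝓡∂ 1) (𝓡∂ 1) halfLineFlip t = -1 :=
  jacobian_halfLineAffine (eventually_flip_nonneg ht)

end HalfLine

section Interval

theorem isLocalDiffeomorphAt_IccLeftChart {n : WithTop ℕ∞} {t : Icc (0 : ℝ) 1} (ht : t.1 < 1) :
    IsLocalDiffeomorphAt (𝓡∂ 1) (𝓡∂ 1) n (IccLeftChart (0 : ℝ) 1) t :=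
  isLocalDiffeomorphAt_of_mem_maximalAtlas
    (IsManifold.subset_maximalAtlas (mem_insert _ _)) ht

/-- The sign of the standard orientation of `[0, 1]` in the preferred chart at `t`, which is
`t ↦ t` except at `1`, where it is `t ↦ 1 - t`. -/
def unitIntervalSign (t : Icc (0 : ℝ) 1) : ℤˣ := if t.1 < 1 then 1 else -1

theorem signedJacobian_IccLeftChart {t : Icc (0 : ℝ) 1} (ht : t.1 < 1) :
    signedJacobian (𝓡∂ 1) (𝓡∂ 1) unitIntervalSign (fun _ => 1) (IccLeftChart (0 : ℝ) 1) t = 1 := by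
  unfold signedJacobian
  rw [← Icc_chartedSpaceChartAt_of_le_top ht, jacobian_chartAt_self]
  simp [unitIntervalSign, ht]

theorem IccRightChart_eq_halfLineFlip_comp :
    ⇑(IccRightChart (0 : ℝ) 1) = halfLineFlip ∘ IccLeftChart (0 : ℝ) 1 := by
  ext1 t
  apply halfLine_ext
  have := t.2.2
  rw [Function.comp_apply, halfLineFlip_coord] <;> simp [IccLeftChart, IccRightChart, this]

theorem signedJacobian_IccRightChart {t : Icc (0 : ℝ) 1} (ht : 0 < t.1) :
    signedJacobian (𝓡∂ 1) (𝓡∂ 1) unitIntervalSign (fun _ => 1)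
      (IccRightChart (0 : ℝ) 1) t = -1 := by
  by_cases h1 : t.1 < 1
  · have hc : IccLeftChart (0 : ℝ) 1 t ∈ halfLineIoo := by
      simpa [halfLineIoo, IccLeftChart] using ⟨ht, h1⟩
    rw [IccRightChart_eq_halfLineFlip_comp, signedJacobian_comp_of_isLocalDiffeomorphAt one_ne_zero
      _ (fun _ => 1) _ (isLocalDiffeomorphAt_halfLineFlip hc)
      (isLocalDiffeomorphAt_IccLeftChart h1), signedJacobian_IccLeftChart h1]
    simp [signedJacobian, jacobian_halfLineFlip hc]
  · unfold signedJacobian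
    rw [← Icc_chartedSpaceChartAt_of_top_le (not_lt.1 h1), jacobian_chartAt_self]
    simp [unitIntervalSign, h1]

/-- The standard orientation of `[0, 1]`. -/
def unitIntervalOrientation : ManifoldOrientation (𝓡∂ 1) (Icc (0 : ℝ) 1) :=
  .ofSignedJacobian unitIntervalSign (by
    intro t₀
    by_cases h : t₀.1 < 1
    · filter_upwards [continuousAt_subtype_val.eventually_lt continuousAt_const h] with t ht
      rw [Icc_chartedSpaceChartAt_of_le_top h, show unitIntervalSign t₀ = 1 from if_pos h,
        signedJacobian_IccLeftChart ht]
      exact one_pos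
    · filter_upwards [continuousAt_const.eventually_lt continuousAt_subtype_val
        (one_pos.trans_le (not_lt.1 h))] with t ht
      rw [Icc_chartedSpaceChartAt_of_top_le (not_lt.1 h),
        show unitIntervalSign t₀ = -1 from if_neg h,
        signedJacobian_neg_right _ (fun _ => 1), signedJacobian_IccRightChart ht]
      norm_num)

end Interval

/-! ### Boundary collars -/

/-- The endpoint of the closed half line. -/
abbrev halfLineZero : EuclideanHalfSpace 1 := ⟨0, le_rfl⟩

theorem mk_zero_mem_collarDomain {N : Type*} (x : N) : (x, halfLineZero) ∈ collarDomain N := by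
  simp [collarDomain]

theorem isOpen_collarDomain {N : Type*} [TopologicalSpace N] : IsOpen (collarDomain N) :=
  isOpen_lt (by fun_prop) continuous_const

namespace BoundaryCollar

variable {p : ℕ} {N N' W W' : Type*}
  [TopologicalSpace N] [ChartedSpace (EuclideanSpace ℝ (Fin p)) N]
  [TopologicalSpace N'] [ChartedSpace (EuclideanSpace ℝ (Fin p)) N']
  [TopologicalSpace W]
  [ChartedSpace (ModelProd (EuclideanSpace ℝ (Fin p)) (EuclideanHalfSpace 1)) W]
  [TopologicalSpace W']
  [ChartedSpace (ModelProd (EuclideanSpace ℝ (Fin p)) (EuclideanHalfSpace 1)) W']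

theorem isLocalDiffeomorphAt (θ : BoundaryCollar p N W) {q : N × EuclideanHalfSpace 1}
    (hq : q ∈ collarDomain N) :
    IsLocalDiffeomorphAt (collarModel p) (collarModel p) ∞ θ.toFun q :=
  θ.isLocalDiffeomorphOn ⟨q, hq⟩

theorem continuousAt (θ : BoundaryCollar p N W) {q : N × EuclideanHalfSpace 1}
    (hq : q ∈ collarDomain N) : ContinuousAt θ.toFun q :=
  (θ.isLocalDiffeomorphAt hq).contMDiffAt.continuousAt

theorem isOpen_image (θ : BoundaryCollar p N W) {s : Set (N × EuclideanHalfSpace 1)}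
    (hs : IsOpen s) (hsd : s ⊆ collarDomain N) : IsOpen (θ.toFun '' s) := by
  rw [isOpen_iff_mem_nhds]
  rintro _ ⟨q, hq, rfl⟩
  rw [← θ.isLocalDiffeomorphOn.isLocalHomeomorphOn.map_nhds_eq (hsd hq)]
  exact image_mem_map (hs.mem_nhds hq)

theorem orientedJacobian_eq_signedJacobian [IsManifold (𝓡 p) 1 N] [IsManifold (collarModel p) 1 W]
    (oN : ManifoldOrientation (𝓡 p) N) (oW : ManifoldOrientation (collarModel p) W)
    (θ : BoundaryCollar p N W) (q : N × EuclideanHalfSpace 1) :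
    θ.orientedJacobian oN oW q =
      signedJacobian (collarModel p) (collarModel p) (fun q => oN.sign q.1) oW.sign θ.toFun q :=
  rfl

/-- The image of a collar under a map which is an injective local diffeomorphism on it. -/
def postcomp (θ : BoundaryCollar p N W) (g : W → W')
    (hg : ∀ q ∈ collarDomain N,
      IsLocalDiffeomorphAt (collarModel p) (collarModel p) ∞ g (θ.toFun q))
    (hinj : InjOn g (θ.toFun '' collarDomain N)) : BoundaryCollar p N W' where
  toFun := g ∘ θ.toFun
  injOn := hinj.comp θ.injOn (mapsTo_image _ _)
  isLocalDiffeomorphOn q := (θ.isLocalDiffeomorphAt q.2).comp _ _ (hg q q.2)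

/-- The collar `θ ∘ (f × g)`. -/
def precomp (θ : BoundaryCollar p N W) (f : N' → N)
    (g : EuclideanHalfSpace 1 → EuclideanHalfSpace 1)
    (hf : ∀ x, IsLocalDiffeomorphAt (𝓡 p) (𝓡 p) ∞ f x)
    (hg : ∀ t : EuclideanHalfSpace 1, t.1 0 < 1 → IsLocalDiffeomorphAt (𝓡∂ 1) (𝓡∂ 1) ∞ g t)
    (hgd : ∀ t : EuclideanHalfSpace 1, t.1 0 < 1 → (g t).1 0 < 1)
    (hfi : Function.Injective f) (hgi : Function.Injective g) : BoundaryCollar p N' W where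
  toFun := θ.toFun ∘ Prod.map f g
  injOn := θ.injOn.comp (hfi.prodMap hgi).injOn fun q hq => hgd q.2 hq
  isLocalDiffeomorphOn q :=
    (isLocalDiffeomorphAt_prodMap (hf q.1.1) (hg q.1.2 q.2)).comp _ _
      (θ.isLocalDiffeomorphAt (hgd q.1.2 q.2))

/-- The collar of a disjoint union given by disjoint collars. -/
def sum (θ : BoundaryCollar p N W) (θ' : BoundaryCollar p N' W)
    (h : Disjoint (θ.toFun '' collarDomain N) (θ'.toFun '' collarDomain N')) :
    BoundaryCollar p (N ⊕ N') W where
  toFun q := Sum.elim (fun x => θ.toFun (x, q.2)) (fun x => θ'.toFun (x, q.2)) q.1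
  injOn := by
    rw [disjoint_left] at h
    rintro ⟨x | x, t⟩ ht ⟨y | y, u⟩ hu hxy
    · simpa using θ.injOn (x₁ := (x, t)) (x₂ := (y, u)) ht hu hxy
    · exact (h ⟨(x, t), ht, rfl⟩ ⟨(y, u), hu, hxy.symm⟩).elim
    · exact (h ⟨(y, u), hu, rfl⟩ ⟨(x, t), ht, hxy⟩).elim
    · simpa using θ'.injOn (x₁ := (x, t)) (x₂ := (y, u)) ht hu hxy
  isLocalDiffeomorphOn := by
    rintro ⟨⟨x | x, t⟩, ht⟩
    · exact isLocalDiffeomorphAt_of_comp (f := Prod.map Sum.inl id) (x := (x, t))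
        (isLocalDiffeomorphAt_prodMap (isLocalDiffeomorphAt_inl x) (isLocalDiffeomorphAt_id t))
        (θ.isLocalDiffeomorphAt ht)
    · exact isLocalDiffeomorphAt_of_comp (f := Prod.map Sum.inr id) (x := (x, t))
        (isLocalDiffeomorphAt_prodMap (isLocalDiffeomorphAt_inr x) (isLocalDiffeomorphAt_id t))
        (θ'.isLocalDiffeomorphAt ht)

/-- The collar of the empty manifold. -/
def ofIsEmpty [IsEmpty N] : BoundaryCollar p N W where
  toFun q := isEmptyElim q.1
  injOn q := isEmptyElim q.1
  isLocalDiffeomorphOn q := isEmptyElim q.1.1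

/-- A collar in the first summand of a disjoint union. -/
abbrev inl (θ : BoundaryCollar p N W) : BoundaryCollar p N (W ⊕ W') :=
  θ.postcomp Sum.inl (fun _ _ => isLocalDiffeomorphAt_inl _) Sum.inl_injective.injOn

/-- A collar in the second summand of a disjoint union. -/
abbrev inr (θ : BoundaryCollar p N W') : BoundaryCollar p N (W ⊕ W') :=
  θ.postcomp Sum.inr (fun _ _ => isLocalDiffeomorphAt_inr _) Sum.inr_injective.injOn

theorem image_postcomp (θ : BoundaryCollar p N W) (g : W → W')
    (hg : ∀ q ∈ collarDomain N,
      IsLocalDiffeomorphAt (collarModel p) (collarModel p) ∞ g (θ.toFun q))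
    (hinj : InjOn g (θ.toFun '' collarDomain N)) (s : Set (N × EuclideanHalfSpace 1)) :
    (θ.postcomp g hg hinj).toFun '' s = g '' (θ.toFun '' s) :=
  image_comp g θ.toFun s

theorem range_base_postcomp (θ : BoundaryCollar p N W) (g : W → W')
    (hg : ∀ q ∈ collarDomain N,
      IsLocalDiffeomorphAt (collarModel p) (collarModel p) ∞ g (θ.toFun q))
    (hinj : InjOn g (θ.toFun '' collarDomain N)) :
    range (θ.postcomp g hg hinj).base = g '' range θ.base :=
  range_comp g θ.base

theorem disjoint_inl_inr (θ : BoundaryCollar p N W) (θ' : BoundaryCollar p N' W') :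
    Disjoint ((θ.inl (W' := W')).toFun '' collarDomain N)
      ((θ'.inr (W := W)).toFun '' collarDomain N') := by
  rw [image_postcomp, image_postcomp]
  exact disjoint_image_inl_image_inr

theorem image_sum (θ : BoundaryCollar p N W) (θ' : BoundaryCollar p N' W)
    (h : Disjoint (θ.toFun '' collarDomain N) (θ'.toFun '' collarDomain N')) :
    (θ.sum θ' h).toFun '' collarDomain (N ⊕ N') =
      θ.toFun '' collarDomain N ∪ θ'.toFun '' collarDomain N' := by
  ext w
  constructor
  · rintro ⟨⟨x | x, t⟩, ht, rfl⟩
    · exact Or.inl ⟨(x, t), ht, rfl⟩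
    · exact Or.inr ⟨(x, t), ht, rfl⟩
  · rintro (⟨⟨x, t⟩, ht, rfl⟩ | ⟨⟨x, t⟩, ht, rfl⟩)
    · exact ⟨(Sum.inl x, t), ht, rfl⟩
    · exact ⟨(Sum.inr x, t), ht, rfl⟩

theorem range_base_sum (θ : BoundaryCollar p N W) (θ' : BoundaryCollar p N' W)
    (h : Disjoint (θ.toFun '' collarDomain N) (θ'.toFun '' collarDomain N')) :
    range (θ.sum θ' h).base = range θ.base ∪ range θ'.base := by
  ext w
  simp only [mem_range, mem_union, Sum.exists]
  rfl

variable [IsManifold (𝓡 p) 1 N] [IsManifold (𝓡 p) 1 N'] [IsManifold (collarModel p) 1 W]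
  [IsManifold (collarModel p) 1 W']

theorem orientedJacobian_postcomp (oN : ManifoldOrientation (𝓡 p) N)
    (oW : ManifoldOrientation (collarModel p) W) (oW' : ManifoldOrientation (collarModel p) W')
    (θ : BoundaryCollar p N W) (g : W → W')
    (hg : ∀ q ∈ collarDomain N,
      IsLocalDiffeomorphAt (collarModel p) (collarModel p) ∞ g (θ.toFun q))
    (hinj : InjOn g (θ.toFun '' collarDomain N)) {q : N × EuclideanHalfSpace 1}
    (hq : q ∈ collarDomain N) :
    (θ.postcomp g hg hinj).orientedJacobian oN oW' q =
      signedJacobian (collarModel p) (collarModel p) oW.sign oW'.sign g (θ.toFun q) *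
        θ.orientedJacobian oN oW q := by
  rw [orientedJacobian_eq_signedJacobian, orientedJacobian_eq_signedJacobian]
  exact signedJacobian_comp_of_isLocalDiffeomorphAt (by simp) _ _ _ (hg q hq)
    (θ.isLocalDiffeomorphAt hq)

theorem orientedJacobian_precomp (oN : ManifoldOrientation (𝓡 p) N)
    (oN' : ManifoldOrientation (𝓡 p) N') (oW : ManifoldOrientation (collarModel p) W)
    (θ : BoundaryCollar p N W) (f : N' → N)
    (g : EuclideanHalfSpace 1 → EuclideanHalfSpace 1)
    (hf : ∀ x, IsLocalDiffeomorphAt (𝓡 p) (𝓡 p) ∞ f x)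
    (hg : ∀ t : EuclideanHalfSpace 1, t.1 0 < 1 → IsLocalDiffeomorphAt (𝓡∂ 1) (𝓡∂ 1) ∞ g t)
    (hgd : ∀ t : EuclideanHalfSpace 1, t.1 0 < 1 → (g t).1 0 < 1)
    (hfi : Function.Injective f) (hgi : Function.Injective g) {q : N' × EuclideanHalfSpace 1}
    (hq : q ∈ collarDomain N') :
    (θ.precomp f g hf hg hgd hfi hgi).orientedJacobian oN' oW q =
      θ.orientedJacobian oN oW (Prod.map f g q) *
        (signedJacobian (𝓡 p) (𝓡 p) oN'.sign oN.sign f q.1 * jacobian (𝓡∂ 1) (𝓡∂ 1) g q.2) := by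
  rw [← signedJacobian_prodMap_fst _ _ ((hf q.1).mdifferentiableAt (by simp))
    ((hg q.2 hq).mdifferentiableAt (by simp)), orientedJacobian_eq_signedJacobian,
    orientedJacobian_eq_signedJacobian]
  exact signedJacobian_comp_of_isLocalDiffeomorphAt (by simp) _ (fun q => oN.sign q.1) _
    (θ.isLocalDiffeomorphAt (hgd q.2 hq)) (isLocalDiffeomorphAt_prodMap (hf q.1) (hg q.2 hq))

theorem orientedJacobian_sum_inl (oN : ManifoldOrientation (𝓡 p) N)
    (oN' : ManifoldOrientation (𝓡 p) N') (oW : ManifoldOrientation (collarModel p) W)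
    (θ : BoundaryCollar p N W) (θ' : BoundaryCollar p N' W)
    (h : Disjoint (θ.toFun '' collarDomain N) (θ'.toFun '' collarDomain N')) {x : N}
    {t : EuclideanHalfSpace 1} (ht : (x, t) ∈ collarDomain N) :
    (θ.sum θ' h).orientedJacobian (oN.sum oN') oW (Sum.inl x, t) =
      θ.orientedJacobian oN oW (x, t) := by
  have inl_diffeo : IsLocalDiffeomorphAt (𝓡 p) (𝓡 p) ∞ (Sum.inl : N → N ⊕ N') (x, t).1 :=
    isLocalDiffeomorphAt_inl x
  have id_diffeo : IsLocalDiffeomorphAt (𝓡∂ 1) (𝓡∂ 1) ∞ id (x, t).2 := isLocalDiffeomorphAt_id t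
  have comp_inl := signedJacobian_comp_of_isLocalDiffeomorphAt (f := Prod.map Sum.inl id)
    (x := (x, t)) (by simp) (fun q => oN.sign q.1) (fun q => (oN.sum oN').sign q.1) oW.sign
    ((θ.sum θ' h).isLocalDiffeomorphAt (q := (Sum.inl x, t)) ht)
    (isLocalDiffeomorphAt_prodMap inl_diffeo id_diffeo)
  rw [signedJacobian_prodMap_fst _ _ (inl_diffeo.mdifferentiableAt (by simp))
    (id_diffeo.mdifferentiableAt (by simp)), jacobian_id, mul_one] at comp_inl
  rwa [show signedJacobian (𝓡 p) (𝓡 p) oN.sign (oN.sum oN').sign Sum.inl x = 1 from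
    signedJacobian_inl _ _ _, mul_one, eq_comm] at comp_inl

theorem orientedJacobian_sum_inr (oN : ManifoldOrientation (𝓡 p) N)
    (oN' : ManifoldOrientation (𝓡 p) N') (oW : ManifoldOrientation (collarModel p) W)
    (θ : BoundaryCollar p N W) (θ' : BoundaryCollar p N' W)
    (h : Disjoint (θ.toFun '' collarDomain N) (θ'.toFun '' collarDomain N')) {x : N'}
    {t : EuclideanHalfSpace 1} (ht : (x, t) ∈ collarDomain N') :
    (θ.sum θ' h).orientedJacobian (oN.sum oN') oW (Sum.inr x, t) =
      θ'.orientedJacobian oN' oW (x, t) := by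
  have inr_diffeo : IsLocalDiffeomorphAt (𝓡 p) (𝓡 p) ∞ (Sum.inr : N' → N ⊕ N') (x, t).1 :=
    isLocalDiffeomorphAt_inr x
  have id_diffeo : IsLocalDiffeomorphAt (𝓡∂ 1) (𝓡∂ 1) ∞ id (x, t).2 := isLocalDiffeomorphAt_id t
  have comp_inr := signedJacobian_comp_of_isLocalDiffeomorphAt (f := Prod.map Sum.inr id)
    (x := (x, t)) (by simp) (fun q => oN'.sign q.1) (fun q => (oN.sum oN').sign q.1) oW.sign
    ((θ.sum θ' h).isLocalDiffeomorphAt (q := (Sum.inr x, t)) ht)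
    (isLocalDiffeomorphAt_prodMap inr_diffeo id_diffeo)
  rw [signedJacobian_prodMap_fst _ _ (inr_diffeo.mdifferentiableAt (by simp))
    (id_diffeo.mdifferentiableAt (by simp)), jacobian_id, mul_one] at comp_inr
  rwa [show signedJacobian (𝓡 p) (𝓡 p) oN'.sign (oN.sum oN').sign Sum.inr x = 1 from
    signedJacobian_inr _ _ _, mul_one, eq_comm] at comp_inr

theorem orientedJacobian_inl (oN : ManifoldOrientation (𝓡 p) N)
    (oW : ManifoldOrientation (collarModel p) W) (oW' : ManifoldOrientation (collarModel p) W')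
    (θ : BoundaryCollar p N W) {q : N × EuclideanHalfSpace 1} (hq : q ∈ collarDomain N) :
    (θ.inl (W' := W')).orientedJacobian oN (oW.sum oW') q = θ.orientedJacobian oN oW q := by
  rw [orientedJacobian_postcomp oN oW _ _ _ _ _ hq,
    show signedJacobian (collarModel p) (collarModel p) oW.sign (oW.sum oW').sign Sum.inl
      (θ.toFun q) = 1 from signedJacobian_inl _ _ _, one_mul]

theorem orientedJacobian_inr (oN : ManifoldOrientation (𝓡 p) N)
    (oW : ManifoldOrientation (collarModel p) W) (oW' : ManifoldOrientation (collarModel p) W')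
    (θ : BoundaryCollar p N W') {q : N × EuclideanHalfSpace 1} (hq : q ∈ collarDomain N) :
    (θ.inr (W := W)).orientedJacobian oN (oW.sum oW') q = θ.orientedJacobian oN oW' q := by
  rw [orientedJacobian_postcomp oN oW' _ _ _ _ _ hq,
    show signedJacobian (collarModel p) (collarModel p) oW'.sign (oW.sum oW').sign Sum.inr
      (θ.toFun q) = 1 from signedJacobian_inr _ _ _, one_mul]

theorem orientedJacobian_neg_left (oN : ManifoldOrientation (𝓡 p) N)
    (oW : ManifoldOrientation (collarModel p) W) (θ : BoundaryCollar p N W)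
    (q : N × EuclideanHalfSpace 1) :
    θ.orientedJacobian oN.neg oW q = -θ.orientedJacobian oN oW q :=
  signedJacobian_neg_left (fun q : N × EuclideanHalfSpace 1 => oN.sign q.1) oW.sign _ _

theorem orientedJacobian_neg_right (oN : ManifoldOrientation (𝓡 p) N)
    (oW : ManifoldOrientation (collarModel p) W) (θ : BoundaryCollar p N W)
    (q : N × EuclideanHalfSpace 1) :
    θ.orientedJacobian oN oW.neg q = -θ.orientedJacobian oN oW q :=
  signedJacobian_neg_right (fun q : N × EuclideanHalfSpace 1 => oN.sign q.1) oW.sign _ _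

end BoundaryCollar

/-! ### Oriented bordisms and bordant maps -/

section OrientedBordism

variable {p : ℕ} {N₀ N₁ N₀' N₁' : Type*}
  [TopologicalSpace N₀] [ChartedSpace (EuclideanSpace ℝ (Fin p)) N₀] [IsManifold (𝓡 p) 1 N₀]
  [TopologicalSpace N₁] [ChartedSpace (EuclideanSpace ℝ (Fin p)) N₁] [IsManifold (𝓡 p) 1 N₁]
  [TopologicalSpace N₀'] [ChartedSpace (EuclideanSpace ℝ (Fin p)) N₀'] [IsManifold (𝓡 p) 1 N₀']
  [TopologicalSpace N₁'] [ChartedSpace (EuclideanSpace ℝ (Fin p)) N₁'] [IsManifold (𝓡 p) 1 N₁']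
  {o₀ : ManifoldOrientation (𝓡 p) N₀} {o₁ : ManifoldOrientation (𝓡 p) N₁}
  {o₀' : ManifoldOrientation (𝓡 p) N₀'} {o₁' : ManifoldOrientation (𝓡 p) N₁'}

instance (b : OrientedBordism p N₀ N₁ o₀ o₁) : IsManifold (collarModel p) ∞ b.W := b.isManifoldW

instance (b : OrientedBordism p N₀ N₁ o₀ o₁) : CompactSpace b.W := b.compactW

instance (b : OrientedBordism p N₀ N₁ o₀ o₁) : T2Space b.W := b.t2W

/-- The bordism with the opposite orientation and direction. -/
def OrientedBordism.symm (b : OrientedBordism p N₀ N₁ o₀ o₁) :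
    OrientedBordism p N₁ N₀ o₁ o₀ where
  W := b.W
  orientation := b.orientation.neg
  collar₀ := b.collar₁
  collar₁ := b.collar₀
  disjoint_collars := b.disjoint_collars.symm
  boundary_eq := b.boundary_eq.trans (union_comm _ _)
  preserves₀ q hq :=
    (neg_pos.2 (b.reverses₁ q hq)).trans_eq (b.collar₁.orientedJacobian_neg_right ..).symm
  reverses₁ q hq :=
    (b.collar₀.orientedJacobian_neg_right ..).trans_lt (neg_neg_of_pos (b.preserves₀ q hq))

/-- The bordism with all orientations reversed. -/
def OrientedBordism.neg (b : OrientedBordism p N₀ N₁ o₀ o₁) :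
    OrientedBordism p N₀ N₁ o₀.neg o₁.neg where
  W := b.W
  orientation := b.orientation.neg
  collar₀ := b.collar₀
  collar₁ := b.collar₁
  disjoint_collars := b.disjoint_collars
  boundary_eq := b.boundary_eq
  preserves₀ q hq := by
    rw [b.collar₀.orientedJacobian_neg_left, b.collar₀.orientedJacobian_neg_right, neg_neg]
    exact b.preserves₀ q hq
  reverses₁ q hq := by
    rw [b.collar₁.orientedJacobian_neg_left, b.collar₁.orientedJacobian_neg_right, neg_neg]
    exact b.reverses₁ q hq

/-- The disjoint union of bordisms. -/
def OrientedBordism.sum (b : OrientedBordism p N₀ N₁ o₀ o₁)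
    (b' : OrientedBordism p N₀' N₁' o₀' o₁') :
    OrientedBordism p (N₀ ⊕ N₀') (N₁ ⊕ N₁') (o₀.sum o₀') (o₁.sum o₁') where
  W := b.W ⊕ b'.W
  orientation := b.orientation.sum b'.orientation
  collar₀ := b.collar₀.inl.sum b'.collar₀.inr (BoundaryCollar.disjoint_inl_inr _ _)
  collar₁ := b.collar₁.inl.sum b'.collar₁.inr (BoundaryCollar.disjoint_inl_inr _ _)
  disjoint_collars := by
    simp only [BoundaryCollar.image_sum, BoundaryCollar.image_postcomp, disjoint_union_left,
      disjoint_union_right]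
    exact ⟨⟨(disjoint_image_iff Sum.inl_injective).2 b.disjoint_collars,
      disjoint_image_inl_image_inr.symm⟩, disjoint_image_inl_image_inr,
      (disjoint_image_iff Sum.inr_injective).2 b'.disjoint_collars⟩
  boundary_eq := by
    simp only [BoundaryCollar.range_base_sum, BoundaryCollar.range_base_postcomp,
      ModelWithCorners.boundary_disjointUnion, b.boundary_eq, b'.boundary_eq, image_union]
    exact union_union_union_comm _ _ _ _
  preserves₀ := by
    rintro ⟨x | x, t⟩ (ht : t.1 0 < 1)
    · rw [BoundaryCollar.orientedJacobian_sum_inl _ _ _ _ _ _ ht,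
        BoundaryCollar.orientedJacobian_inl _ _ _ _ ht]
      exact b.preserves₀ (x, t) ht
    · rw [BoundaryCollar.orientedJacobian_sum_inr _ _ _ _ _ _ ht,
        BoundaryCollar.orientedJacobian_inr _ _ _ _ ht]
      exact b'.preserves₀ (x, t) ht
  reverses₁ := by
    rintro ⟨x | x, t⟩ (ht : t.1 0 < 1)
    · rw [BoundaryCollar.orientedJacobian_sum_inl _ _ _ _ _ _ ht,
        BoundaryCollar.orientedJacobian_inl _ _ _ _ ht]
      exact b.reverses₁ (x, t) ht
    · rw [BoundaryCollar.orientedJacobian_sum_inr _ _ _ _ _ _ ht,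
        BoundaryCollar.orientedJacobian_inr _ _ _ _ ht]
      exact b'.reverses₁ (x, t) ht

/-- Two maps from closed oriented manifolds to a space are bordant if they extend to an oriented
bordism. -/
def BordantMaps {E : Type*} [TopologicalSpace E] (o₀ : ManifoldOrientation (𝓡 p) N₀)
    (o₁ : ManifoldOrientation (𝓡 p) N₁) (s₀ : N₀ → E) (s₁ : N₁ → E) : Prop :=
  ∃ (b : OrientedBordism p N₀ N₁ o₀ o₁) (Φ : C(b.W, E)),
    (∀ x, Φ (b.collar₀.base x) = s₀ x) ∧ ∀ x, Φ (b.collar₁.base x) = s₁ x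

variable {E : Type*} [TopologicalSpace E] {s₀ : N₀ → E} {s₁ : N₁ → E} {s₀' : N₀' → E}
  {s₁' : N₁' → E}

theorem BordantMaps.symm (h : BordantMaps o₀ o₁ s₀ s₁) : BordantMaps o₁ o₀ s₁ s₀ :=
  let ⟨b, Φ, h₀, h₁⟩ := h
  ⟨b.symm, Φ, h₁, h₀⟩

theorem BordantMaps.neg (h : BordantMaps o₀ o₁ s₀ s₁) : BordantMaps o₀.neg o₁.neg s₀ s₁ :=
  let ⟨b, Φ, h₀, h₁⟩ := h
  ⟨b.neg, Φ, h₀, h₁⟩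

theorem BordantMaps.sum (h : BordantMaps o₀ o₁ s₀ s₁) (h' : BordantMaps o₀' o₁' s₀' s₁') :
    BordantMaps (o₀.sum o₀') (o₁.sum o₁') (Sum.elim s₀ s₀') (Sum.elim s₁ s₁') := by
  obtain ⟨b, Φ, h₀, h₁⟩ := h
  obtain ⟨b', Φ', h₀', h₁'⟩ := h'
  refine ⟨b.sum b', ⟨Sum.elim Φ Φ', Φ.continuous.sumElim Φ'.continuous⟩, ?_, ?_⟩
  · rintro (x | x)
    exacts [h₀ x, h₀' x]
  · rintro (x | x)
    exacts [h₁ x, h₁' x]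

end OrientedBordism

/-! ### Cylinders -/

section IntervalCollars

variable {E H M : Type*} [NormedAddCommGroup E] [NormedSpace ℝ E] [TopologicalSpace H]
  {I : ModelWithCorners ℝ E H} [TopologicalSpace M] [ChartedSpace H M]

theorem isLocalDiffeomorphAt_symm_of_mem_maximalAtlas {n : WithTop ℕ∞}
    {e : OpenPartialHomeomorph M H} (he : e ∈ IsManifold.maximalAtlas I n M) {y : H}
    (hy : y ∈ e.target) : IsLocalDiffeomorphAt I I n e.symm y :=
  isLocalDiffeomorphAt_of_contMDiffOn e.symm (contMDiffOn_symm_of_mem_maximalAtlas he)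
    (contMDiffOn_of_mem_maximalAtlas he) hy

theorem signedJacobian_symm_mul_signedJacobian {e : OpenPartialHomeomorph M H}
    (he : e ∈ IsManifold.maximalAtlas I 1 M) {y : H} (hy : y ∈ e.target) (s : M → ℤˣ)
    (t : H → ℤˣ) :
    signedJacobian I I t s e.symm y * signedJacobian I I s t e (e.symm y) = 1 := by
  rw [mul_comm]
  exact signedJacobian_mul_eq_one one_ne_zero t s
    (isLocalDiffeomorphAt_symm_of_mem_maximalAtlas he hy) (e.eventually_right_inverse hy)

/-- The collar `t ↦ t / 2` of the lower end of `[0, 1]`. -/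
def intervalCollarBot : EuclideanHalfSpace 1 → Icc (0 : ℝ) 1 :=
  (IccLeftChart (0 : ℝ) 1).symm ∘ halfLineHalve

/-- The collar `t ↦ 1 - t / 2` of the upper end of `[0, 1]`. -/
def intervalCollarTop : EuclideanHalfSpace 1 → Icc (0 : ℝ) 1 :=
  (IccRightChart (0 : ℝ) 1).symm ∘ halfLineHalve

theorem intervalCollarBot_coe {t : EuclideanHalfSpace 1} (ht : t.1 0 < 1) :
    (intervalCollarBot t : ℝ) = t.1 0 / 2 := by
  rw [intervalCollarBot, Function.comp_apply, IccLeftChart_symm_apply, Subtype.coe_mk,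
    halfLineHalve_coord, min_eq_left] <;> linarith

theorem intervalCollarTop_coe {t : EuclideanHalfSpace 1} (ht : t.1 0 < 1) :
    (intervalCollarTop t : ℝ) = 1 - t.1 0 / 2 := by
  rw [intervalCollarTop, Function.comp_apply, IccRightChart_symm_apply, Subtype.coe_mk,
    halfLineHalve_coord, max_eq_left]
  linarith

theorem intervalCollarBot_zero : intervalCollarBot halfLineZero = ⊥ :=
  Subtype.ext ((intervalCollarBot_coe (by simp)).trans (by simp))

theorem intervalCollarTop_zero : intervalCollarTop halfLineZero = ⊤ :=
  Subtype.ext ((intervalCollarTop_coe (by simp)).trans (by simp))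

theorem halfLineHalve_lt {t : EuclideanHalfSpace 1} (ht : t.1 0 < 1) :
    (halfLineHalve t).1 0 < 1 := by
  rw [halfLineHalve_coord]
  linarith

theorem IccLeftChart_mem_maximalAtlas {n : WithTop ℕ∞} :
    IccLeftChart (0 : ℝ) 1 ∈ IsManifold.maximalAtlas (𝓡∂ 1) n (Icc (0 : ℝ) 1) :=
  IsManifold.subset_maximalAtlas (mem_insert _ _)

theorem IccRightChart_mem_maximalAtlas {n : WithTop ℕ∞} :
    IccRightChart (0 : ℝ) 1 ∈ IsManifold.maximalAtlas (𝓡∂ 1) n (Icc (0 : ℝ) 1) :=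
  IsManifold.subset_maximalAtlas (mem_insert_of_mem _ rfl)

theorem isLocalDiffeomorphAt_intervalCollarBot {n : WithTop ℕ∞} {t : EuclideanHalfSpace 1}
    (ht : t.1 0 < 1) : IsLocalDiffeomorphAt (𝓡∂ 1) (𝓡∂ 1) n intervalCollarBot t :=
  (isLocalDiffeomorphAt_halfLineHalve t).comp _ _
    (isLocalDiffeomorphAt_symm_of_mem_maximalAtlas IccLeftChart_mem_maximalAtlas
      ((halfLineHalve_lt ht).trans_eq (sub_zero 1).symm))

theorem isLocalDiffeomorphAt_intervalCollarTop {n : WithTop ℕ∞} {t : EuclideanHalfSpace 1}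
    (ht : t.1 0 < 1) : IsLocalDiffeomorphAt (𝓡∂ 1) (𝓡∂ 1) n intervalCollarTop t :=
  (isLocalDiffeomorphAt_halfLineHalve t).comp _ _
    (isLocalDiffeomorphAt_symm_of_mem_maximalAtlas IccRightChart_mem_maximalAtlas
      ((halfLineHalve_lt ht).trans_eq (sub_zero 1).symm))

theorem signedJacobian_halfLineHalve (t : EuclideanHalfSpace 1) :
    signedJacobian (𝓡∂ 1) (𝓡∂ 1) (fun _ => 1) (fun _ => 1) halfLineHalve t = 1 / 2 := by
  simp [signedJacobian, jacobian_halfLineHalve]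

theorem signedJacobian_intervalCollarBot_pos {t : EuclideanHalfSpace 1} (ht : t.1 0 < 1) :
    0 < signedJacobian (𝓡∂ 1) (𝓡∂ 1) (fun _ => 1) unitIntervalSign intervalCollarBot t := by
  have hy := (halfLineHalve_lt ht).trans_eq (sub_zero 1).symm
  have inv := signedJacobian_symm_mul_signedJacobian IccLeftChart_mem_maximalAtlas hy
    unitIntervalSign fun _ => 1
  rw [signedJacobian_IccLeftChart ((IccLeftChart (0 : ℝ) 1).map_target hy), mul_one] at inv
  rw [intervalCollarBot, signedJacobian_comp_of_isLocalDiffeomorphAt one_ne_zero _ (fun _ => 1) _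
    (isLocalDiffeomorphAt_symm_of_mem_maximalAtlas IccLeftChart_mem_maximalAtlas hy)
    (isLocalDiffeomorphAt_halfLineHalve t), inv, signedJacobian_halfLineHalve]
  norm_num

theorem signedJacobian_intervalCollarTop_neg {t : EuclideanHalfSpace 1} (ht : t.1 0 < 1) :
    signedJacobian (𝓡∂ 1) (𝓡∂ 1) (fun _ => 1) unitIntervalSign intervalCollarTop t < 0 := by
  have hy := (halfLineHalve_lt ht).trans_eq (sub_zero 1).symm
  have inv := signedJacobian_symm_mul_signedJacobian IccRightChart_mem_maximalAtlas hy
    unitIntervalSign fun _ => 1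
  rw [signedJacobian_IccRightChart ((IccRightChart (0 : ℝ) 1).map_target hy), mul_neg_one,
    neg_eq_iff_eq_neg] at inv
  rw [intervalCollarTop, signedJacobian_comp_of_isLocalDiffeomorphAt one_ne_zero _ (fun _ => 1) _
    (isLocalDiffeomorphAt_symm_of_mem_maximalAtlas IccRightChart_mem_maximalAtlas hy)
    (isLocalDiffeomorphAt_halfLineHalve t), inv, signedJacobian_halfLineHalve]
  norm_num

end IntervalCollars

section CylinderCollars

variable {p : ℕ} {N : Type*} [TopologicalSpace N] [ChartedSpace (EuclideanSpace ℝ (Fin p)) N]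

/-- The collar `id × γ` in the cylinder `N × [0, 1]`. -/
def cylinderCollar (γ : EuclideanHalfSpace 1 → Icc (0 : ℝ) 1) (hinj : InjOn γ {t | t.1 0 < 1})
    (hγ : ∀ t : EuclideanHalfSpace 1, t.1 0 < 1 → IsLocalDiffeomorphAt (𝓡∂ 1) (𝓡∂ 1) ∞ γ t) :
    BoundaryCollar p N (N × Icc (0 : ℝ) 1) where
  toFun := Prod.map id γ
  injOn _ hq _ hr h :=
    Prod.ext (congrArg Prod.fst h :) (hinj hq hr (congrArg Prod.snd h))
  isLocalDiffeomorphOn q :=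
    isLocalDiffeomorphAt_prodMap (isLocalDiffeomorphAt_id q.1.1) (hγ _ q.2)

theorem orientedJacobian_cylinderCollar [IsManifold (𝓡 p) 1 N]
    (γ : EuclideanHalfSpace 1 → Icc (0 : ℝ) 1) (hinj : InjOn γ {t | t.1 0 < 1})
    (hγ : ∀ t : EuclideanHalfSpace 1, t.1 0 < 1 → IsLocalDiffeomorphAt (𝓡∂ 1) (𝓡∂ 1) ∞ γ t)
    (oN : ManifoldOrientation (𝓡 p) N) (o : ManifoldOrientation (𝓡∂ 1) (Icc (0 : ℝ) 1))
    {q : N × EuclideanHalfSpace 1} (hq : q ∈ collarDomain N) :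
    (cylinderCollar γ hinj hγ).orientedJacobian oN (oN.prod o) q =
      signedJacobian (𝓡∂ 1) (𝓡∂ 1) (fun _ => 1) o.sign γ q.2 := by
  have h := signedJacobian_prodMap (q := q) oN.sign oN.sign (fun _ => 1) o.sign
    ((isLocalDiffeomorphAt_id (I := 𝓡 p) (n := ∞) q.1).mdifferentiableAt (by simp))
    ((hγ _ hq).mdifferentiableAt (by simp))
  simp only [mul_one] at h
  rwa [signedJacobian_id, one_mul] at h

/-- The standard collar of the lower end of the cylinder `N × [0, 1]`. -/
def cylinderCollarBot : BoundaryCollar p N (N × Icc (0 : ℝ) 1) :=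
  cylinderCollar intervalCollarBot
    (fun t ht u hu h => halfLine_ext <| by
      have := congrArg Subtype.val h
      rw [intervalCollarBot_coe ht, intervalCollarBot_coe hu] at this
      linarith)
    fun _ => isLocalDiffeomorphAt_intervalCollarBot

/-- The standard collar of the upper end of the cylinder `N × [0, 1]`. -/
def cylinderCollarTop : BoundaryCollar p N (N × Icc (0 : ℝ) 1) :=
  cylinderCollar intervalCollarTop
    (fun t ht u hu h => halfLine_ext <| by
      have := congrArg Subtype.val h
      rw [intervalCollarTop_coe ht, intervalCollarTop_coe hu] at this
      linarith)
    fun _ => isLocalDiffeomorphAt_intervalCollarTop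

theorem disjoint_cylinderCollars :
    Disjoint ((cylinderCollarBot (p := p) (N := N)).toFun '' collarDomain N)
      ((cylinderCollarTop (p := p) (N := N)).toFun '' collarDomain N) := by
  rw [disjoint_left]
  rintro _ ⟨⟨x, t⟩, (ht : t.1 0 < 1), rfl⟩ ⟨⟨y, u⟩, (hu : u.1 0 < 1), h⟩
  have top_eq_bot : (intervalCollarTop u : ℝ) = intervalCollarBot t :=
    congrArg (fun q : N × Icc (0 : ℝ) 1 => (q.2 : ℝ)) h
  rw [intervalCollarTop_coe hu, intervalCollarBot_coe ht] at top_eq_bot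
  linarith

theorem cylinderCollarBot_base (x : N) : (cylinderCollarBot (p := p)).base x = (x, ⊥) :=
  Prod.ext rfl intervalCollarBot_zero

theorem cylinderCollarTop_base (x : N) : (cylinderCollarTop (p := p)).base x = (x, ⊤) :=
  Prod.ext rfl intervalCollarTop_zero

theorem boundary_cylinder :
    (collarModel p).boundary (N × Icc (0 : ℝ) 1) =
      range (cylinderCollarBot (p := p) (N := N)).base ∪
        range (cylinderCollarTop (p := p) (N := N)).base := by
  rw [boundary_product]
  ext ⟨x, t⟩
  simp only [mem_union, mem_range, cylinderCollarBot_base, cylinderCollarTop_base,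
    Prod.mk.injEq, exists_eq_left]
  simp [Set.prod, eq_comm]

variable [IsManifold (𝓡 p) 1 N]

theorem orientedJacobian_cylinderCollarBot_pos (o : ManifoldOrientation (𝓡 p) N)
    {q : N × EuclideanHalfSpace 1} (hq : q ∈ collarDomain N) :
    0 < cylinderCollarBot.orientedJacobian o (o.prod unitIntervalOrientation) q :=
  (signedJacobian_intervalCollarBot_pos hq).trans_eq
    (orientedJacobian_cylinderCollar _ _ _ o unitIntervalOrientation hq).symm

theorem orientedJacobian_cylinderCollarTop_neg (o : ManifoldOrientation (𝓡 p) N)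
    {q : N × EuclideanHalfSpace 1} (hq : q ∈ collarDomain N) :
    cylinderCollarTop.orientedJacobian o (o.prod unitIntervalOrientation) q < 0 :=
  (orientedJacobian_cylinderCollar _ _ _ o unitIntervalOrientation hq).trans_lt
    (signedJacobian_intervalCollarTop_neg hq)

end CylinderCollars

section CylinderBordism

variable {p : ℕ} {N N' : Type} [TopologicalSpace N] [ChartedSpace (EuclideanSpace ℝ (Fin p)) N]
  [TopologicalSpace N'] [ChartedSpace (EuclideanSpace ℝ (Fin p)) N']
  [IsManifold (𝓡 p) 1 N'] [IsManifold (𝓡 p) ∞ N] [CompactSpace N] [T2Space N]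

/-- The cylinder of an orientation preserving diffeomorphism. -/
def OrientedBordism.cylinder (o : ManifoldOrientation (𝓡 p) N) (o' : ManifoldOrientation (𝓡 p) N')
    (φ : Diffeomorph (𝓡 p) (𝓡 p) N' N ∞)
    (hφ : ∀ x, 0 < signedJacobian (𝓡 p) (𝓡 p) o'.sign o.sign φ x) :
    OrientedBordism p N' N o' o where
  W := N × Icc (0 : ℝ) 1
  orientation := o.prod unitIntervalOrientation
  collar₀ := cylinderCollarBot.precomp φ id φ.isLocalDiffeomorph
    (fun _ _ => isLocalDiffeomorphAt_id _) (fun _ h => h) φ.injective Function.injective_id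
  collar₁ := cylinderCollarTop
  disjoint_collars := by
    refine disjoint_cylinderCollars.mono_left ?_
    rintro _ ⟨q, hq, rfl⟩
    exact ⟨(φ q.1, q.2), hq, rfl⟩
  boundary_eq := by
    rw [boundary_cylinder]
    congr 1
    exact (φ.surjective.range_comp _).symm
  preserves₀ q hq := by
    refine (mul_pos (orientedJacobian_cylinderCollarBot_pos o hq) ?_).trans_eq
      (BoundaryCollar.orientedJacobian_precomp o o' (o.prod unitIntervalOrientation)
        cylinderCollarBot φ id φ.isLocalDiffeomorph (fun _ _ => isLocalDiffeomorphAt_id _)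
        (fun _ h => h) φ.injective Function.injective_id hq).symm
    rw [jacobian_id, mul_one]
    exact hφ q.1
  reverses₁ _ := orientedJacobian_cylinderCollarTop_neg o

variable {E : Type*} [TopologicalSpace E]

theorem BordantMaps.of_diffeomorph {o : ManifoldOrientation (𝓡 p) N}
    {o' : ManifoldOrientation (𝓡 p) N'} (φ : Diffeomorph (𝓡 p) (𝓡 p) N' N ∞)
    (hφ : ∀ x, 0 < signedJacobian (𝓡 p) (𝓡 p) o'.sign o.sign φ x) {s : N → E} {s' : N' → E}
    (hs : Continuous s) (h : ∀ x, s (φ x) = s' x) : BordantMaps o' o s' s :=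
  ⟨.cylinder o o' φ hφ, ⟨fun q : N × Icc (0 : ℝ) 1 => s q.1, hs.comp continuous_fst⟩, h,
    fun _ => rfl⟩

theorem BordantMaps.refl (o : ManifoldOrientation (𝓡 p) N) {s : N → E} (hs : Continuous s) :
    BordantMaps o o s s :=
  .of_diffeomorph (Diffeomorph.refl (𝓡 p) N ∞)
    (fun x => one_pos.trans_eq (signedJacobian_id o.sign x).symm) hs fun _ => rfl

/-- The cylinder, as a bordism from two copies of the manifold with opposite orientations to the
empty manifold. -/
def OrientedBordism.bentCylinder [IsEmpty N'] (o : ManifoldOrientation (𝓡 p) N)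
    (o' : ManifoldOrientation (𝓡 p) N') : OrientedBordism p (N ⊕ N) N' (o.sum o.neg) o' where
  W := N × Icc (0 : ℝ) 1
  orientation := o.prod unitIntervalOrientation
  collar₀ := cylinderCollarBot.sum cylinderCollarTop disjoint_cylinderCollars
  collar₁ := .ofIsEmpty
  disjoint_collars := by
    rw [disjoint_right]
    rintro _ ⟨q, _⟩
    exact isEmptyElim q.1
  boundary_eq := by
    rw [BoundaryCollar.range_base_sum, range_eq_empty (BoundaryCollar.base _ : N' → _),
      union_empty, boundary_cylinder]
  preserves₀ := by
    rintro ⟨x | x, t⟩ (ht : t.1 0 < 1)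
    · rw [BoundaryCollar.orientedJacobian_sum_inl _ _ _ _ _ _ ht]
      exact orientedJacobian_cylinderCollarBot_pos o (q := (x, t)) ht
    · rw [BoundaryCollar.orientedJacobian_sum_inr _ _ _ _ _ _ ht,
        BoundaryCollar.orientedJacobian_neg_left]
      exact neg_pos.2 (orientedJacobian_cylinderCollarTop_neg o (q := (x, t)) ht)
  reverses₁ q := isEmptyElim q.1

theorem BordantMaps.add_neg [IsEmpty N'] (o : ManifoldOrientation (𝓡 p) N)
    (o' : ManifoldOrientation (𝓡 p) N') {s : N → E} (hs : Continuous s) {s' : N' → E} :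
    BordantMaps (o.sum o.neg) o' (Sum.elim s s) s' := by
  refine ⟨.bentCylinder o o', ⟨fun q : N × Icc (0 : ℝ) 1 => s q.1, hs.comp continuous_fst⟩,
    ?_, fun x => isEmptyElim x⟩
  rintro (x | x) <;> rfl

end CylinderBordism

/-! ### Manifolds modelled on local homeomorphisms -/

section LocallyModelled

variable {E H : Type*} [NormedAddCommGroup E] [NormedSpace ℝ E] [TopologicalSpace H]
  {I : ModelWithCorners ℝ E H} {n : WithTop ℕ∞} {M W : Type*} [TopologicalSpace M]
  [ChartedSpace H M] [TopologicalSpace W]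

/-- The charted space whose charts are those of `M`, transported by the local homeomorphisms
`e w`. -/
abbrev chartedSpaceOfLocalHomeomorphs (e : W → OpenPartialHomeomorph W M)
    (he : ∀ w, w ∈ (e w).source) : ChartedSpace H W where
  atlas := range fun w => (e w).trans (chartAt H (e w w))
  chartAt w := (e w).trans (chartAt H (e w w))
  mem_chart_source w := ⟨he w, mem_chart_source H (e w w)⟩
  chart_mem_atlas w := ⟨w, rfl⟩

variable [ChartedSpace H W]

/-- The charts of `W` are those of `M`, transported by the local homeomorphisms `e w`. -/
structure IsLocallyModelled (H : Type*) [TopologicalSpace H] {M W : Type*} [TopologicalSpace M]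
    [ChartedSpace H M] [TopologicalSpace W] [ChartedSpace H W]
    (e : W → OpenPartialHomeomorph W M) : Prop where
  mem_source : ∀ w, w ∈ (e w).source
  chartAt_eq : ∀ w, chartAt H w = (e w).trans (chartAt H (e w w))
  atlas_eq : ∀ c ∈ atlas H W, ∃ w, c = chartAt H w

/-- The transition maps of the local homeomorphisms `e w` are local diffeomorphisms. -/
def SmoothTransitions (I : ModelWithCorners ℝ E H) (n : WithTop ℕ∞)
    (e : W → OpenPartialHomeomorph W M) : Prop :=
  ∀ w w' m, m ∈ ((e w).symm.trans (e w')).source →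
    IsLocalDiffeomorphAt I I n ((e w).symm.trans (e w')) m

variable {e : W → OpenPartialHomeomorph W M}

namespace IsLocallyModelled

theorem mem_transition_source (he : IsLocallyModelled H e) {w w' : W} (hw' : w' ∈ (e w).source) :
    e w' w' ∈ ((e w').symm.trans (e w)).source :=
  ⟨(e w').map_source (he.mem_source w'),
    mem_preimage.2 (((e w').left_inv (he.mem_source w')).symm ▸ hw')⟩

theorem eventuallyEq_transition (he : IsLocallyModelled H e) (w w' : W) :
    e w =ᶠ[𝓝 w'] (e w').symm.trans (e w) ∘ e w' := by
  filter_upwards [(e w').open_source.mem_nhds (he.mem_source w')] with v hv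
  exact congrArg (e w) ((e w').left_inv hv).symm

theorem isManifold [IsManifold I n M] (he : IsLocallyModelled H e)
    (ht : SmoothTransitions I n e) : IsManifold I n W := by
  refine isManifold_of_contDiffOn I n W fun c c' hc hc' => ?_
  obtain ⟨w, rfl⟩ := he.atlas_eq c hc
  obtain ⟨w', rfl⟩ := he.atlas_eq c' hc'
  rw [← contMDiffOn_iff_contDiffOn, he.chartAt_eq w, he.chartAt_eq w']
  set a := chartAt H (e w w)
  set a' := chartAt H (e w' w')
  rintro y ⟨hy, z, rfl⟩
  rw [mem_preimage, ModelWithCorners.left_inv] at hy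
  obtain ⟨⟨hz, hzw⟩, hzw', hza'⟩ := hy
  have smooth_a_symm : ContMDiffAt I I n a.symm z :=
    contMDiffOn_chart_symm.contMDiffAt (a.open_target.mem_nhds hz)
  have smooth_transition : ContMDiffAt I I n ((e w).symm.trans (e w')) (a.symm z) :=
    (ht w w' _ ⟨hzw, hzw'⟩).contMDiffAt
  have smooth_a' : ContMDiffAt I I n a' ((e w).symm.trans (e w') (a.symm z)) :=
    contMDiffOn_chart.contMDiffAt (a'.open_source.mem_nhds hza')
  have smooth_comp := I.contMDiff.contMDiffAt.comp z
    (smooth_a'.comp z (smooth_transition.comp z smooth_a_symm))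
  exact (smooth_comp.comp_contMDiffWithinAt_of_eq (x := I z) (I.contMDiffOn_symm (I z) ⟨z, rfl⟩)
    (I.left_inv z)).mono inter_subset_right

theorem isLocalDiffeomorphAt_self [IsManifold I n M] [IsManifold I n W]
    (he : IsLocallyModelled H e) (w : W) : IsLocalDiffeomorphAt I I n (e w) w := by
  have hm : e w w ∈ (chartAt H (e w w)).source := mem_chart_source H (e w w)
  have hchart : chartAt H w w = chartAt H (e w w) (e w w) := by rw [he.chartAt_eq w]; rfl
  have hsymm : IsLocalDiffeomorphAt I I n (chartAt H (e w w)).symm (chartAt H w w) :=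
    isLocalDiffeomorphAt_of_contMDiffOn (chartAt H (e w w)).symm contMDiffOn_chart_symm
      contMDiffOn_chart (hchart ▸ (chartAt H (e w w)).map_source hm)
  refine isLocalDiffeomorphAt_of_eventuallyEq ((isLocalDiffeomorphAt_of_contMDiffOn _
    contMDiffOn_chart contMDiffOn_chart_symm (mem_chart_source H w)).comp _ _ hsymm) ?_
  have hcont := (e w).continuousAt (he.mem_source w)
  filter_upwards [hcont.preimage_mem_nhds ((chartAt H (e w w)).open_source.mem_nhds hm)] with v hv
  rw [Function.comp_apply, he.chartAt_eq w]
  exact ((chartAt H (e w w)).left_inv hv).symm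

theorem isLocalDiffeomorphAt [IsManifold I n M] [IsManifold I n W] (he : IsLocallyModelled H e)
    (ht : SmoothTransitions I n e) {w w' : W} (hw' : w' ∈ (e w).source) :
    IsLocalDiffeomorphAt I I n (e w) w' :=
  isLocalDiffeomorphAt_of_eventuallyEq ((he.isLocalDiffeomorphAt_self w').comp _ _
    (ht w' w _ (he.mem_transition_source hw'))) (he.eventuallyEq_transition w w')

theorem signedJacobian_self [IsManifold I 1 M] [IsManifold I 1 W] (he : IsLocallyModelled H e)
    (s : M → ℤˣ) (w : W) : signedJacobian I I (fun w => s (e w w)) s (e w) w = 1 := by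
  have hw : jacobian I I (chartAt H (e w w) ∘ e w) w = 1 := by
    rw [← jacobian_chartAt_self (I := I) w, he.chartAt_eq w]
    rfl
  rw [jacobian_comp (I := I) (J := I)
    ((isLocalDiffeomorphAt_of_contMDiffOn _ contMDiffOn_chart contMDiffOn_chart_symm
      (mem_chart_source H (e w w))).mdifferentiableAt one_ne_zero)
    ((he.isLocalDiffeomorphAt_self w).mdifferentiableAt one_ne_zero), jacobian_chartAt_self,
    one_mul] at hw
  rw [signedJacobian, units_cast_mul_self, one_mul, hw]

variable [IsManifold I ∞ M] [IsManifold I ∞ W]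

theorem signedJacobian_pos (he : IsLocallyModelled H e) (ht : SmoothTransitions I ∞ e)
    {s : M → ℤˣ} (hs : ∀ w w' m, m ∈ ((e w).symm.trans (e w')).source →
      0 < signedJacobian I I s s ((e w).symm.trans (e w')) m) {w w' : W}
    (hw' : w' ∈ (e w).source) :
    0 < signedJacobian I I (fun w => s (e w w)) s (e w) w' := by
  rw [signedJacobian_congr (he.eventuallyEq_transition w w'),
    signedJacobian_comp_of_isLocalDiffeomorphAt (by simp) _ s _
      (ht w' w _ (he.mem_transition_source hw')) (he.isLocalDiffeomorphAt_self w'),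
    he.signedJacobian_self, mul_one]
  exact hs w' w _ (he.mem_transition_source hw')

/-- The orientation transported by local homeomorphisms with orientation preserving transition
maps. -/
def orientation (he : IsLocallyModelled H e) (ht : SmoothTransitions I ∞ e)
    (o : ManifoldOrientation I M)
    (hs : ∀ w w' m, m ∈ ((e w).symm.trans (e w')).source →
      0 < signedJacobian I I o.sign o.sign ((e w).symm.trans (e w')) m) :
    ManifoldOrientation I W :=
  .ofSignedJacobian (fun w => o.sign (e w w)) fun w₀ => by
    have hcont := (e w₀).continuousAt (he.mem_source w₀)
    filter_upwards [hcont.eventually (o.signedJacobian_chartAt_pos (e w₀ w₀)),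
      hcont.preimage_mem_nhds (chart_source_mem_nhds H (e w₀ w₀)),
      (e w₀).open_source.mem_nhds (he.mem_source w₀)] with w chart_pos hchart hw
    rw [he.chartAt_eq w₀]
    refine (mul_pos chart_pos (he.signedJacobian_pos ht hs hw)).trans_eq
      (signedJacobian_comp_of_isLocalDiffeomorphAt (n := ∞) (f := e w₀)
        (g := chartAt H (e w₀ w₀)) (by simp) _ o.sign _ ?_ (he.isLocalDiffeomorphAt ht hw)).symm
    exact isLocalDiffeomorphAt_of_contMDiffOn _ contMDiffOn_chart contMDiffOn_chart_symm hchart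

end IsLocallyModelled

end LocallyModelled

/-! ### Gluing along an involution -/

/-- A free orientation preserving smooth involution `σ` of an open subset `D` of an open subset `U`
of an oriented manifold. The closedness of its graph in `U × U` makes the quotient of `U` by `σ`
Hausdorff. The values of `σ` outside `D` are irrelevant. -/
structure GluingInvolution {E H : Type*} [NormedAddCommGroup E] [NormedSpace ℝ E]
    [TopologicalSpace H] (I : ModelWithCorners ℝ E H) {M : Type*} [TopologicalSpace M]
    [ChartedSpace H M] [IsManifold I 1 M] (o : ManifoldOrientation I M) where
  U : Set M
  D : Set M
  σ : M → M
  isOpen_U : IsOpen U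
  isOpen_D : IsOpen D
  subset : D ⊆ U
  map_mem : MapsTo σ D D
  involutive : LeftInvOn σ σ D
  free : ∀ x ∈ D, σ x ≠ x
  isLocalDiffeomorphAt : ∀ x ∈ D, IsLocalDiffeomorphAt I I ∞ σ x
  preserves : ∀ x ∈ D, 0 < signedJacobian I I o.sign o.sign σ x
  isClosed_graph : IsClosed {q : U × U | q.1.1 ∈ D ∧ q.2.1 = σ q.1.1}

namespace GluingInvolution

variable {E H : Type*} [NormedAddCommGroup E] [NormedSpace ℝ E]
  [TopologicalSpace H] {I : ModelWithCorners ℝ E H} {M : Type*} [TopologicalSpace M]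
  [ChartedSpace H M] [IsManifold I 1 M] {o : ManifoldOrientation I M} (G : GluingInvolution I o)

theorem continuousAt_σ {x : M} (hx : x ∈ G.D) : ContinuousAt G.σ x :=
  (G.isLocalDiffeomorphAt x hx).contMDiffAt.continuousAt

/-- The identification of the points of `U` with their images under the involution. -/
def setoid : Setoid G.U where
  r x y := y = x ∨ (x.1 ∈ G.D ∧ y.1 = G.σ x.1)
  iseqv := by
    refine ⟨fun x => .inl rfl, ?_, ?_⟩
    · rintro x y (rfl | ⟨hx, hy⟩)
      · exact .inl rfl
      · right
        rw [hy]
        exact ⟨G.map_mem hx, (G.involutive hx).symm⟩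
    · rintro x y z (rfl | ⟨hx, hy⟩) (rfl | ⟨hy', hz⟩)
      · exact .inl rfl
      · exact .inr ⟨hy', hz⟩
      · exact .inr ⟨hx, hy⟩
      · exact .inl (Subtype.ext (by rw [hz, hy, G.involutive hx]))

/-- The manifold obtained by gluing along the involution. -/
def Glued : Type _ := Quotient G.setoid

instance : TopologicalSpace G.Glued := inferInstanceAs (TopologicalSpace (Quotient G.setoid))

/-- The projection of `U` to the glued manifold. -/
def toGlued (u : G.U) : G.Glued := Quotient.mk G.setoid u

theorem toGlued_surjective : Function.Surjective G.toGlued := Quotient.mk_surjective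

theorem continuous_toGlued : Continuous G.toGlued := continuous_quotient_mk'

variable {G} in
theorem toGlued_eq {x y : G.U} : G.toGlued x = G.toGlued y ↔ y = x ∨ (x.1 ∈ G.D ∧ y.1 = G.σ x.1) :=
  Quotient.eq (r := G.setoid)

theorem toGlued_σ {x : M} (hx : x ∈ G.D) :
    G.toGlued ⟨G.σ x, G.subset (G.map_mem hx)⟩ = G.toGlued ⟨x, G.subset hx⟩ :=
  (toGlued_eq.2 (.inr ⟨hx, rfl⟩)).symm

theorem toGlued_preimage_image (s : Set G.U) :
    G.toGlued ⁻¹' (G.toGlued '' s) = s ∪ Subtype.val ⁻¹' (G.D ∩ G.σ ⁻¹' (Subtype.val '' s)) := by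
  ext x
  constructor
  · rintro ⟨y, hy, hxy⟩
    rcases toGlued_eq.1 hxy.symm with rfl | ⟨hx, hyx⟩
    · exact .inl hy
    · exact .inr ⟨hx, y, hy, hyx⟩
  · rintro (hx | ⟨hx, y, hy, hyx⟩)
    · exact ⟨x, hx, rfl⟩
    · exact ⟨y, hy, (toGlued_eq.2 (.inr ⟨hx, hyx⟩)).symm⟩

theorem isOpenMap_toGlued : IsOpenMap G.toGlued := fun s hs => by
  change IsOpen (G.toGlued ⁻¹' (G.toGlued '' s))
  rw [G.toGlued_preimage_image s]
  exact hs.union (continuous_subtype_val.isOpen_preimage _ (ContinuousOn.isOpen_inter_preimage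
    (fun x hx => (G.continuousAt_σ hx).continuousWithinAt) G.isOpen_D
    (G.isOpen_U.isOpenMap_subtype_val s hs)))

instance [T2Space M] : T2Space G.Glued := by
  rw [t2Space_iff_of_isOpenQuotientMap
    ⟨G.toGlued_surjective, G.continuous_toGlued, G.isOpenMap_toGlued⟩]
  have ker_eq : {q : G.U × G.U | G.toGlued q.1 = G.toGlued q.2} =
      diagonal G.U ∪ {q : G.U × G.U | q.1.1 ∈ G.D ∧ q.2.1 = G.σ q.1.1} := by
    ext ⟨x, y⟩
    simp only [mem_ofPred_eq, toGlued_eq, mem_union, mem_diagonal_iff, eq_comm (a := y)]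
  rw [ker_eq]
  exact isClosed_diagonal.union G.isClosed_graph

theorem exists_isOpen_injOn_toGlued (u : G.U) :
    ∃ s : Set G.U, IsOpen s ∧ u ∈ s ∧ InjOn G.toGlued s := by
  have not_mem : (u, u) ∉ {q : G.U × G.U | q.1.1 ∈ G.D ∧ q.2.1 = G.σ q.1.1} :=
    fun h => G.free _ h.1 h.2.symm
  have compl_mem := G.isClosed_graph.isOpen_compl.mem_nhds not_mem
  rw [nhds_prod_eq, mem_prod_self_iff] at compl_mem
  obtain ⟨t, ht, hts⟩ := compl_mem
  obtain ⟨s, hst, hs, hus⟩ := mem_nhds_iff.1 ht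
  refine ⟨s, hs, hus, fun x hx y hy hxy => ?_⟩
  rcases toGlued_eq.1 hxy with h | h
  · exact h.symm
  · exact (hts (a := (x, y)) ⟨hst hx, hst hy⟩ h).elim

theorem exists_section (w : G.Glued) : ∃ e : OpenPartialHomeomorph G.Glued M,
    w ∈ e.source ∧ (∀ w ∈ e.source, ∃ h : e w ∈ G.U, G.toGlued ⟨e w, h⟩ = w) ∧
    ∀ m ∈ e.target, ∃ h : m ∈ G.U, e.symm m = G.toGlued ⟨m, h⟩ ∧ e (G.toGlued ⟨m, h⟩) = m := by
  obtain ⟨u, rfl⟩ := G.toGlued_surjective w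
  obtain ⟨s, hs, hus, hinj⟩ := G.exists_isOpen_injOn_toGlued u
  have : Nonempty s := ⟨⟨u, hus⟩⟩
  have toGlued_embedding : IsOpenEmbedding fun x : s => G.toGlued x.1 :=
    .of_continuous_injective_isOpenMap (G.continuous_toGlued.comp continuous_subtype_val)
      (fun x y h => Subtype.ext (hinj x.2 y.2 h))
      (G.isOpenMap_toGlued.comp hs.isOpenMap_subtype_val)
  have val_embedding : IsOpenEmbedding fun x : s => (x.1 : M) :=
    G.isOpen_U.isOpenEmbedding_subtypeVal.comp hs.isOpenEmbedding_subtypeVal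
  let a := toGlued_embedding.toOpenPartialHomeomorph
  let b := val_embedding.toOpenPartialHomeomorph
  have ha (x : s) : a.symm (G.toGlued x.1) = x := a.left_inv (x := x) (mem_univ x)
  have hb (x : s) : b.symm x.1.1 = x := b.left_inv (x := x) (mem_univ x)
  refine ⟨a.symm.trans b, ⟨⟨⟨u, hus⟩, trivial, rfl⟩, mem_univ _⟩, ?_, ?_⟩
  · rintro _ ⟨⟨x, -, rfl⟩, -⟩
    have hx : (a.symm.trans b) (G.toGlued x.1) = x.1.1 := congrArg b (ha x)
    change ∃ h : (a.symm.trans b) (G.toGlued x.1) ∈ G.U,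
      G.toGlued ⟨(a.symm.trans b) (G.toGlued x.1), h⟩ = G.toGlued x.1
    simp only [hx]
    exact ⟨x.1.2, trivial⟩
  · rintro _ ⟨⟨x, -, rfl⟩, -⟩
    exact ⟨x.1.2, congrArg a (hb x), congrArg b (ha x)⟩

/-- A local section of the projection near `w`. -/
def lift (w : G.Glued) : OpenPartialHomeomorph G.Glued M :=
  (G.exists_section w).choose

theorem mem_lift_source (w : G.Glued) : w ∈ (G.lift w).source :=
  (G.exists_section w).choose_spec.1

theorem lift_mem {w w' : G.Glued} (h : w' ∈ (G.lift w).source) : G.lift w w' ∈ G.U :=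
  ((G.exists_section w).choose_spec.2.1 w' h).1

theorem toGlued_lift {w w' : G.Glued} (h : w' ∈ (G.lift w).source) :
    G.toGlued ⟨G.lift w w', G.lift_mem h⟩ = w' :=
  ((G.exists_section w).choose_spec.2.1 w' h).2

theorem lift_target_subset (w : G.Glued) : (G.lift w).target ⊆ G.U := fun m hm =>
  ((G.exists_section w).choose_spec.2.2 m hm).1

theorem lift_symm {w : G.Glued} {m : M} (hm : m ∈ (G.lift w).target) :
    (G.lift w).symm m = G.toGlued ⟨m, G.lift_target_subset w hm⟩ :=
  ((G.exists_section w).choose_spec.2.2 m hm).2.1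

theorem lift_toGlued {w : G.Glued} {m : M} (hm : m ∈ (G.lift w).target) :
    G.lift w (G.toGlued ⟨m, G.lift_target_subset w hm⟩) = m :=
  ((G.exists_section w).choose_spec.2.2 m hm).2.2

theorem eventually_lift_toGlued (w : G.Glued) {m : M} (hm : m ∈ G.U)
    (hw : G.toGlued ⟨m, hm⟩ ∈ (G.lift w).source) :
    (∀ᶠ x in 𝓝 m, ∃ h : x ∈ G.U, G.lift w (G.toGlued ⟨x, h⟩) = x) ∨
      (m ∈ G.D ∧ ∀ᶠ x in 𝓝 m, ∃ h : x ∈ G.U, G.lift w (G.toGlued ⟨x, h⟩) = G.σ x) := by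
  have lift_mem_target := (G.lift w).map_source hw
  rcases toGlued_eq.1 (G.toGlued_lift hw) with h | ⟨hlift, h⟩
  · left
    have lift_eq : m = G.lift w (G.toGlued ⟨m, hm⟩) := congrArg Subtype.val h
    rw [← lift_eq] at lift_mem_target
    filter_upwards [(G.lift w).open_target.mem_nhds lift_mem_target] with x hx
    exact ⟨_, G.lift_toGlued hx⟩
  · right
    have eq_σ : m = G.σ (G.lift w (G.toGlued ⟨m, hm⟩)) := h
    have hmD : m ∈ G.D := eq_σ ▸ G.map_mem hlift
    have σ_eq : G.σ m = G.lift w (G.toGlued ⟨m, hm⟩) :=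
      (congrArg G.σ eq_σ).trans (G.involutive hlift)
    rw [← σ_eq] at lift_mem_target
    refine ⟨hmD, ?_⟩
    filter_upwards [G.isOpen_D.mem_nhds hmD, (G.continuousAt_σ hmD).preimage_mem_nhds
      ((G.lift w).open_target.mem_nhds lift_mem_target)] with x hx hσx
    exact ⟨G.subset hx, by rw [← G.toGlued_σ hx]; exact G.lift_toGlued hσx⟩

theorem isLocalDiffeomorphAt_of_eventuallyEq_id_or_σ {m : M} {f : M → M}
    (h : f =ᶠ[𝓝 m] id ∨ (m ∈ G.D ∧ f =ᶠ[𝓝 m] G.σ)) : IsLocalDiffeomorphAt I I ∞ f m := by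
  rcases h with h | ⟨hm, h⟩
  · exact isLocalDiffeomorphAt_of_eventuallyEq (isLocalDiffeomorphAt_id m) h
  · exact isLocalDiffeomorphAt_of_eventuallyEq (G.isLocalDiffeomorphAt m hm) h

theorem signedJacobian_pos_of_eventuallyEq_id_or_σ {m : M} {f : M → M}
    (h : f =ᶠ[𝓝 m] id ∨ (m ∈ G.D ∧ f =ᶠ[𝓝 m] G.σ)) :
    0 < signedJacobian I I o.sign o.sign f m := by
  rcases h with h | ⟨hm, h⟩
  · rw [signedJacobian_congr h, signedJacobian_id]
    exact one_pos
  · rw [signedJacobian_congr h]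
    exact G.preserves m hm

theorem transition_eventuallyEq {w w' : G.Glued} {m : M}
    (hm : m ∈ ((G.lift w).symm.trans (G.lift w')).source) :
    (⇑((G.lift w).symm.trans (G.lift w')) =ᶠ[𝓝 m] id) ∨
      (m ∈ G.D ∧ ⇑((G.lift w).symm.trans (G.lift w')) =ᶠ[𝓝 m] G.σ) := by
  obtain ⟨hmw, hmw' : (G.lift w).symm m ∈ (G.lift w').source⟩ := hm
  rw [G.lift_symm hmw] at hmw'
  refine (G.eventually_lift_toGlued w' _ hmw').imp ?_ (And.imp_right ?_) <;>
  · intro h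
    filter_upwards [h, (G.lift w).open_target.mem_nhds hmw] with x ⟨_, hx⟩ hxw
    exact (congrArg (G.lift w') (G.lift_symm hxw)).trans hx

instance : ChartedSpace H G.Glued :=
  chartedSpaceOfLocalHomeomorphs G.lift G.mem_lift_source

theorem isLocallyModelled : IsLocallyModelled H G.lift where
  mem_source := G.mem_lift_source
  chartAt_eq _ := rfl
  atlas_eq := by
    rintro _ ⟨w, rfl⟩
    exact ⟨w, rfl⟩

theorem smoothTransitions : SmoothTransitions I ∞ G.lift := fun _ _ _ hm =>
  G.isLocalDiffeomorphAt_of_eventuallyEq_id_or_σ (G.transition_eventuallyEq hm)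

/-- The projection, extended to all of `M` by the value `w₀`. -/
def proj (w₀ : G.Glued) (m : M) : G.Glued := by
  classical
  exact if h : m ∈ G.U then G.toGlued ⟨m, h⟩ else w₀

theorem proj_of_mem (w₀ : G.Glued) {m : M} (h : m ∈ G.U) : G.proj w₀ m = G.toGlued ⟨m, h⟩ :=
  dif_pos h

theorem continuousAt_proj (w₀ : G.Glued) {m : M} (hm : m ∈ G.U) : ContinuousAt (G.proj w₀) m := by
  have continuousOn_proj : ContinuousOn (G.proj w₀) G.U := by
    rw [continuousOn_iff_continuous_domRestrict]
    exact G.continuous_toGlued.congr fun x => (G.proj_of_mem w₀ x.2).symm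
  exact continuousOn_proj.continuousAt (G.isOpen_U.mem_nhds hm)

theorem lift_comp_proj_eventuallyEq (w₀ : G.Glued) {m : M} (hm : m ∈ G.U) :
    (G.lift (G.proj w₀ m) ∘ G.proj w₀ =ᶠ[𝓝 m] id) ∨
      (m ∈ G.D ∧ G.lift (G.proj w₀ m) ∘ G.proj w₀ =ᶠ[𝓝 m] G.σ) := by
  have mem_source : G.toGlued ⟨m, hm⟩ ∈ (G.lift (G.proj w₀ m)).source := by
    rw [← G.proj_of_mem w₀ hm]
    exact G.mem_lift_source _
  refine (G.eventually_lift_toGlued _ hm mem_source).imp ?_ (And.imp_right ?_) <;>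
  · intro h
    filter_upwards [h] with x ⟨hU, hx⟩
    exact (congrArg (G.lift (G.proj w₀ m)) (G.proj_of_mem w₀ hU)).trans hx

theorem proj_eventuallyEq (w₀ : G.Glued) {m : M} (hm : m ∈ G.U) :
    G.proj w₀ =ᶠ[𝓝 m] (G.lift (G.proj w₀ m)).symm ∘ (G.lift (G.proj w₀ m) ∘ G.proj w₀) := by
  filter_upwards [(G.continuousAt_proj w₀ hm).preimage_mem_nhds
    ((G.lift (G.proj w₀ m)).open_source.mem_nhds (G.mem_lift_source _))] with x hx
  exact ((G.lift (G.proj w₀ m)).left_inv hx).symm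

end GluingInvolution

namespace GluingInvolution

variable {E H : Type*} [NormedAddCommGroup E] [NormedSpace ℝ E]
  [TopologicalSpace H] {I : ModelWithCorners ℝ E H} {M : Type*} [TopologicalSpace M]
  [ChartedSpace H M] [IsManifold I ∞ M] {o : ManifoldOrientation I M} (G : GluingInvolution I o)

instance : IsManifold I ∞ G.Glued := G.isLocallyModelled.isManifold G.smoothTransitions

/-- The orientation of the glued manifold. -/
def orientation : ManifoldOrientation I G.Glued :=
  G.isLocallyModelled.orientation G.smoothTransitions o fun _ _ _ hm =>
    G.signedJacobian_pos_of_eventuallyEq_id_or_σ (G.transition_eventuallyEq hm)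

theorem isLocalDiffeomorphAt_proj (w₀ : G.Glued) {m : M} (hm : m ∈ G.U) :
    IsLocalDiffeomorphAt I I ∞ (G.proj w₀) m :=
  isLocalDiffeomorphAt_of_eventuallyEq
    ((G.isLocalDiffeomorphAt_of_eventuallyEq_id_or_σ (G.lift_comp_proj_eventuallyEq w₀ hm)).comp _ _
      (isLocalDiffeomorphAt_of_comp_eventuallyEq_id
        (G.isLocallyModelled.isLocalDiffeomorphAt_self (G.proj w₀ m))
        ((G.lift (G.proj w₀ m)).eventually_left_inverse (G.mem_lift_source _))))
    (G.proj_eventuallyEq w₀ hm)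

theorem signedJacobian_proj_pos (w₀ : G.Glued) {m : M} (hm : m ∈ G.U) :
    0 < signedJacobian I I o.sign G.orientation.sign (G.proj w₀) m := by
  have lift_self :
      signedJacobian I I G.orientation.sign o.sign (G.lift (G.proj w₀ m)) (G.proj w₀ m) = 1 :=
    G.isLocallyModelled.signedJacobian_self o.sign (G.proj w₀ m)
  have comp := signedJacobian_comp_of_isLocalDiffeomorphAt (by simp) o.sign G.orientation.sign
    o.sign (G.isLocallyModelled.isLocalDiffeomorphAt_self (G.proj w₀ m))
    (G.isLocalDiffeomorphAt_proj w₀ hm)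
  rw [lift_self, one_mul] at comp
  rw [← comp]
  exact G.signedJacobian_pos_of_eventuallyEq_id_or_σ (G.lift_comp_proj_eventuallyEq w₀ hm)

theorem isBoundaryPoint_toGlued {m : M} (hm : m ∈ G.U) :
    I.IsBoundaryPoint (G.toGlued ⟨m, hm⟩) ↔ I.IsBoundaryPoint m := by
  rw [(G.isLocalDiffeomorphAt_proj (G.toGlued ⟨m, hm⟩) hm).isBoundaryPoint_iff (by simp),
    G.proj_of_mem]

end GluingInvolution

/-! ### Collapsing a collar onto its base -/

theorem isCompact_setOf_coord_le {N : Type*} [TopologicalSpace N] [CompactSpace N] (c : ℝ) :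
    IsCompact {q : N × EuclideanHalfSpace 1 | q.2.1 0 ≤ c} := by
  have eq_prod : {q : N × EuclideanHalfSpace 1 | q.2.1 0 ≤ c} =
      univ ×ˢ (halfLinePoint '' Icc 0 c) := by
    ext ⟨x, t⟩
    constructor
    · intro ht
      exact ⟨trivial, t.1 0, ⟨t.2, ht⟩, halfLine_ext (halfLinePoint_coord t.2)⟩
    · rintro ⟨-, r, ⟨hr, hrc⟩, rfl⟩
      exact (halfLinePoint_coord hr).trans_le hrc
  rw [eq_prod]
  exact isCompact_univ.prod (isCompact_Icc.image continuous_halfLinePoint)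

/-- The map of the closed half line which collapses `[0, 1/2]` and is the identity beyond `3/4`. -/
def halfLineCollapse (t : EuclideanHalfSpace 1) : EuclideanHalfSpace 1 :=
  halfLinePoint (min (t.1 0) (3 * t.1 0 - 3 / 2))

theorem continuous_halfLineCollapse : Continuous halfLineCollapse :=
  continuous_halfLinePoint.comp (by fun_prop)

theorem halfLineCollapse_of_le {t : EuclideanHalfSpace 1} (ht : t.1 0 ≤ 1 / 2) :
    halfLineCollapse t = halfLineZero :=
  halfLine_ext (max_eq_right ((min_le_right _ _).trans (by linarith)))

theorem halfLineCollapse_of_ge {t : EuclideanHalfSpace 1} (ht : 3 / 4 ≤ t.1 0) :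
    halfLineCollapse t = t := by
  refine halfLine_ext ?_
  rw [halfLineCollapse, min_eq_left (by linarith), halfLinePoint_coord t.2]

theorem halfLineCollapse_lt {t : EuclideanHalfSpace 1} (ht : t.1 0 < 1) :
    (halfLineCollapse t).1 0 < 1 :=
  max_lt ((min_le_left _ _).trans_lt ht) one_pos

theorem halfLineHalve_zero : halfLineHalve halfLineZero = halfLineZero :=
  halfLine_ext (by simp [halfLineHalve_coord])

theorem halfLineHalve_injective : Function.Injective halfLineHalve := by
  intro t u h
  have coord_eq := congrArg (fun v : EuclideanHalfSpace 1 => v.1 0) h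
  simp only [halfLineHalve_coord] at coord_eq
  exact halfLine_ext (by linarith)

namespace BoundaryCollar

variable {p : ℕ} {N W : Type*} [TopologicalSpace N] [ChartedSpace (EuclideanSpace ℝ (Fin p)) N]
  [TopologicalSpace W]
  [ChartedSpace (ModelProd (EuclideanSpace ℝ (Fin p)) (EuclideanHalfSpace 1)) W]
  (θ : BoundaryCollar p N W)

/-- The self map of `W` which collapses the inner half of a collar to its base and is the identity
outside the collar. -/
def collapse : W → W :=
  Function.extend (fun q : collarDomain N => θ.toFun q)
    (fun q => θ.toFun (q.1.1, halfLineCollapse q.1.2)) id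

theorem collapse_apply {q : N × EuclideanHalfSpace 1} (hq : q ∈ collarDomain N) :
    θ.collapse (θ.toFun q) = θ.toFun (q.1, halfLineCollapse q.2) :=
  (injOn_iff_injective.1 θ.injOn).extend_apply _ _ (⟨q, hq⟩ : collarDomain N)

theorem collapse_of_notMem {w : W} (hw : w ∉ θ.toFun '' collarDomain N) : θ.collapse w = w :=
  Function.extend_apply' _ _ _ fun ⟨q, hq⟩ => hw ⟨q, q.2, hq⟩

theorem collapse_of_notMem_image_le {w : W} (hw : w ∉ θ.toFun '' {q | q.2.1 0 ≤ 3 / 4}) :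
    θ.collapse w = w := by
  by_cases hw' : w ∈ θ.toFun '' collarDomain N
  · obtain ⟨q, hq, rfl⟩ := hw'
    have hq' : 3 / 4 ≤ q.2.1 0 := (not_le.1 fun h => hw ⟨q, h, rfl⟩).le
    rw [θ.collapse_apply hq, halfLineCollapse_of_ge hq']
  · exact θ.collapse_of_notMem hw'

theorem isClosed_image_setOf_coord_le [CompactSpace N] [T2Space W] {c : ℝ} (hc : c < 1) :
    IsClosed (θ.toFun '' {q | q.2.1 0 ≤ c}) :=
  ((isCompact_setOf_coord_le c).image_of_continuousOn fun _ hq =>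
    (θ.continuousAt (lt_of_le_of_lt hq hc)).continuousWithinAt).isClosed

theorem continuousAt_collapse {q : N × EuclideanHalfSpace 1} (hq : q ∈ collarDomain N) :
    ContinuousAt θ.collapse (θ.toFun q) := by
  rw [ContinuousAt, ← θ.isLocalDiffeomorphOn.isLocalHomeomorphOn.map_nhds_eq hq, tendsto_map'_iff,
    θ.collapse_apply hq]
  have continuousAt_inner :
      ContinuousAt (fun q : N × EuclideanHalfSpace 1 => θ.toFun (q.1, halfLineCollapse q.2)) q :=
    ContinuousAt.comp (f := fun q : N × EuclideanHalfSpace 1 => (q.1, halfLineCollapse q.2))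
      (θ.continuousAt (halfLineCollapse_lt hq))
      (continuous_fst.prodMk (continuous_halfLineCollapse.comp continuous_snd)).continuousAt
  refine continuousAt_inner.tendsto.congr' ?_
  filter_upwards [isOpen_collarDomain.mem_nhds hq] with q' hq'
  exact (θ.collapse_apply hq').symm

theorem continuous_collapse [CompactSpace N] [T2Space W] : Continuous θ.collapse := by
  refine continuous_iff_continuousAt.2 fun w => ?_
  by_cases hw : w ∈ θ.toFun '' {q | q.2.1 0 ≤ 3 / 4}
  · obtain ⟨q, hq, rfl⟩ := hw
    exact θ.continuousAt_collapse (lt_of_le_of_lt (b := (3 / 4 : ℝ)) hq (by norm_num))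
  · refine continuousAt_id.congr ?_
    filter_upwards [(θ.isClosed_image_setOf_coord_le (by norm_num)).isOpen_compl.mem_nhds hw]
      with v hv
    exact (θ.collapse_of_notMem_image_le hv).symm

/-- The inner half of a collar, reparametrized by `N × [0, 1)`. Unlike a general collar it is
continuous on `N × [0, 1]`. -/
def halve : BoundaryCollar p N W :=
  θ.precomp id halfLineHalve isLocalDiffeomorphAt_id
    (fun t _ => isLocalDiffeomorphAt_halfLineHalve t) (fun _ => halfLineHalve_lt)
    Function.injective_id halfLineHalve_injective

theorem halve_apply (q : N × EuclideanHalfSpace 1) :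
    θ.halve.toFun q = θ.toFun (q.1, halfLineHalve q.2) :=
  rfl

theorem halve_base : θ.halve.base = θ.base := by
  funext x
  rw [base, halve_apply, halfLineHalve_zero, base]

theorem continuousAt_halve {q : N × EuclideanHalfSpace 1} (hq : q.2.1 0 ≤ 1) :
    ContinuousAt θ.halve.toFun q := by
  have halve_mem : (q.1, halfLineHalve q.2) ∈ collarDomain N := by
    change (halfLineHalve q.2).1 0 < 1
    rw [halfLineHalve_coord]
    linarith
  exact ContinuousAt.comp (f := fun q : N × EuclideanHalfSpace 1 => (q.1, halfLineHalve q.2))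
    (θ.continuousAt halve_mem)
    (continuous_fst.prodMk ((continuous_halfLineAffine _ _).comp continuous_snd)).continuousAt

theorem image_halve_subset : θ.halve.toFun '' collarDomain N ⊆ θ.toFun '' collarDomain N := by
  rintro _ ⟨q, hq, rfl⟩
  exact ⟨(q.1, halfLineHalve q.2), halfLineHalve_lt hq, rfl⟩

theorem collapse_halve {q : N × EuclideanHalfSpace 1} (hq : q.2.1 0 < 1) :
    θ.collapse (θ.halve.toFun q) = θ.base q.1 := by
  rw [halve_apply, θ.collapse_apply (halfLineHalve_lt hq),
    halfLineCollapse_of_le (by rw [halfLineHalve_coord]; linarith), base]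

theorem orientedJacobian_halve [IsManifold (𝓡 p) 1 N] [IsManifold (collarModel p) 1 W]
    (oN : ManifoldOrientation (𝓡 p) N) (oW : ManifoldOrientation (collarModel p) W)
    {q : N × EuclideanHalfSpace 1} (hq : q ∈ collarDomain N) :
    θ.halve.orientedJacobian oN oW q =
      θ.orientedJacobian oN oW (q.1, halfLineHalve q.2) * (1 / 2) := by
  rw [halve, orientedJacobian_precomp oN oN oW θ id halfLineHalve isLocalDiffeomorphAt_id
    (fun t _ => isLocalDiffeomorphAt_halfLineHalve t) (fun _ => halfLineHalve_lt)
    Function.injective_id halfLineHalve_injective hq, signedJacobian_id, one_mul,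
    jacobian_halfLineHalve]
  rfl

end BoundaryCollar

/-! ### Exchanging two collars -/

section CollarSwap

/-- `N × (0, 1)`, as a subset of `N × [0, ∞)`. -/
def openCollarDomain (N : Type*) : Set (N × EuclideanHalfSpace 1) := {q | q.2 ∈ halfLineIoo}

/-- The map `(x, t) ↦ (x, 1 - t)`, cut off at `0`. -/
abbrev collarFlip {N : Type*} : N × EuclideanHalfSpace 1 → N × EuclideanHalfSpace 1 :=
  Prod.map id halfLineFlip

theorem openCollarDomain_subset {N : Type*} : openCollarDomain N ⊆ collarDomain N :=
  fun _ hq => hq.2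

theorem mapsTo_collarFlip {N : Type*} :
    MapsTo collarFlip (openCollarDomain N) (openCollarDomain N) :=
  fun _ hq => mapsTo_halfLineFlip hq

theorem collarFlip_mem_collarDomain {N : Type*} {q : N × EuclideanHalfSpace 1}
    (hq : q ∈ openCollarDomain N) : collarFlip q ∈ collarDomain N :=
  openCollarDomain_subset (mapsTo_collarFlip hq)

theorem leftInvOn_collarFlip {N : Type*} :
    LeftInvOn collarFlip collarFlip (openCollarDomain N) :=
  fun _ hq => Prod.ext rfl (leftInvOn_halfLineFlip hq)

variable {p : ℕ} {N M : Type*} [TopologicalSpace N] [ChartedSpace (EuclideanSpace ℝ (Fin p)) N]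
  [TopologicalSpace M]
  [ChartedSpace (ModelProd (EuclideanSpace ℝ (Fin p)) (EuclideanHalfSpace 1)) M]

theorem isOpen_openCollarDomain : IsOpen (openCollarDomain N) :=
  isOpen_halfLineIoo.preimage continuous_snd

theorem continuous_collarFlip : Continuous (collarFlip (N := N)) :=
  continuous_id.prodMap (continuous_halfLineAffine _ _)

theorem isLocalDiffeomorphAt_collarFlip {q : N × EuclideanHalfSpace 1}
    (hq : q ∈ openCollarDomain N) :
    IsLocalDiffeomorphAt (collarModel p) (collarModel p) ∞ collarFlip q :=
  isLocalDiffeomorphAt_prodMap (isLocalDiffeomorphAt_id q.1) (isLocalDiffeomorphAt_halfLineFlip hq)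

theorem signedJacobian_collarFlip (s : N → ℤˣ)
    {q : N × EuclideanHalfSpace 1} (hq : q ∈ openCollarDomain N) :
    signedJacobian (collarModel p) (collarModel p) (fun q => s q.1) (fun q => s q.1)
      collarFlip q = -1 := by
  rw [signedJacobian_prodMap_fst s s mdifferentiableAt_id
    ((isLocalDiffeomorphAt_halfLineFlip (n := ∞) hq).mdifferentiableAt (by simp)),
    signedJacobian_id, one_mul, jacobian_halfLineFlip hq]

theorem BoundaryCollar.isCompact_range_base [CompactSpace N] (θ : BoundaryCollar p N M) :
    IsCompact (range θ.base) :=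
  isCompact_range (continuous_iff_continuousAt.2 fun x =>
    ContinuousAt.comp (f := fun x : N => (x, halfLineZero))
      (θ.continuousAt (mk_zero_mem_collarDomain x)) (by fun_prop))

theorem BoundaryCollar.toFun_mem_range_base_iff (θ : BoundaryCollar p N M)
    {q : N × EuclideanHalfSpace 1} (hq : q ∈ collarDomain N) :
    θ.toFun q ∈ range θ.base ↔ q ∉ openCollarDomain N := by
  have zero_iff : q.2 = halfLineZero ↔ q ∉ openCollarDomain N := by
    refine ⟨fun h h' => h'.1.ne' (by rw [h]; rfl), fun h => halfLine_ext ?_⟩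
    exact (not_lt.1 fun h' => h ⟨h', hq⟩).antisymm q.2.2
  rw [← zero_iff]
  constructor
  · rintro ⟨x, hx⟩
    rw [← θ.injOn (mk_zero_mem_collarDomain x) hq hx]
  · exact fun h => ⟨q.1, congrArg θ.toFun (Prod.ext rfl h.symm)⟩

/-- The map exchanging the points `β(x, t)` and `γ(x, 1 - t)` of two collars. -/
def collarSwap (β γ : BoundaryCollar p N M) : M → M :=
  Function.extend (fun q : openCollarDomain N => β.toFun q) (fun q => γ.toFun (collarFlip q.1))
    (Function.extend (fun q : openCollarDomain N => γ.toFun q)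
      (fun q => β.toFun (collarFlip q.1)) id)

theorem collarSwap_left (β γ : BoundaryCollar p N M) {q : N × EuclideanHalfSpace 1}
    (hq : q ∈ openCollarDomain N) : collarSwap β γ (β.toFun q) = γ.toFun (collarFlip q) :=
  (injOn_iff_injective.1 (β.injOn.mono openCollarDomain_subset)).extend_apply _ _
    (⟨q, hq⟩ : openCollarDomain N)

theorem collarSwap_right {β γ : BoundaryCollar p N M}
    (hd : Disjoint (β.toFun '' collarDomain N) (γ.toFun '' collarDomain N))
    {q : N × EuclideanHalfSpace 1} (hq : q ∈ openCollarDomain N) :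
    collarSwap β γ (γ.toFun q) = β.toFun (collarFlip q) := by
  have notMem_left : ¬∃ q' : openCollarDomain N, β.toFun q' = γ.toFun q := fun ⟨q', h⟩ =>
    disjoint_left.1 hd ⟨q', openCollarDomain_subset q'.2, h⟩ ⟨q, openCollarDomain_subset hq, rfl⟩
  rw [collarSwap, Function.extend_apply' _ _ _ notMem_left]
  exact (injOn_iff_injective.1 (γ.injOn.mono openCollarDomain_subset)).extend_apply _ _
    (⟨q, hq⟩ : openCollarDomain N)

theorem isLocalDiffeomorphAt_of_eqOn_collarFlip {β γ : BoundaryCollar p N M} {σ : M → M}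
    (hσ : EqOn (σ ∘ β.toFun) (γ.toFun ∘ collarFlip) (openCollarDomain N))
    {q : N × EuclideanHalfSpace 1} (hq : q ∈ openCollarDomain N) :
    IsLocalDiffeomorphAt (collarModel p) (collarModel p) ∞ σ (β.toFun q) :=
  isLocalDiffeomorphAt_of_comp (β.isLocalDiffeomorphAt (openCollarDomain_subset hq))
    (isLocalDiffeomorphAt_of_eventuallyEq
      ((isLocalDiffeomorphAt_collarFlip hq).comp _ _
        (γ.isLocalDiffeomorphAt (collarFlip_mem_collarDomain hq)))
      (hσ.eventuallyEq_of_mem (isOpen_openCollarDomain.mem_nhds hq)))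

theorem signedJacobian_of_eqOn_collarFlip [IsManifold (𝓡 p) 1 N] [IsManifold (collarModel p) 1 M]
    (oN : ManifoldOrientation (𝓡 p) N) (o : ManifoldOrientation (collarModel p) M)
    {β γ : BoundaryCollar p N M} {σ : M → M}
    (hσ : EqOn (σ ∘ β.toFun) (γ.toFun ∘ collarFlip) (openCollarDomain N))
    {q : N × EuclideanHalfSpace 1} (hq : q ∈ openCollarDomain N) :
    signedJacobian (collarModel p) (collarModel p) o.sign o.sign σ (β.toFun q) *
      β.orientedJacobian oN o q = -γ.orientedJacobian oN o (collarFlip q) := by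
  have comp_flip := signedJacobian_comp_of_isLocalDiffeomorphAt (by simp) (fun q => oN.sign q.1)
    (fun q => oN.sign q.1) o.sign (γ.isLocalDiffeomorphAt (collarFlip_mem_collarDomain hq))
    (isLocalDiffeomorphAt_collarFlip hq)
  rw [signedJacobian_collarFlip oN.sign hq, mul_neg_one] at comp_flip
  rw [BoundaryCollar.orientedJacobian_eq_signedJacobian,
    BoundaryCollar.orientedJacobian_eq_signedJacobian, ← comp_flip,
    ← signedJacobian_comp_of_isLocalDiffeomorphAt (by simp) _ o.sign _
      (isLocalDiffeomorphAt_of_eqOn_collarFlip hσ hq)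
      (β.isLocalDiffeomorphAt (openCollarDomain_subset hq)),
    signedJacobian_congr (hσ.eventuallyEq_of_mem (isOpen_openCollarDomain.mem_nhds hq))]

end CollarSwap

/-! ### Gluing collars -/

section GluableCollars

variable {p : ℕ} {N M : Type*} [TopologicalSpace N] [ChartedSpace (EuclideanSpace ℝ (Fin p)) N]
  [TopologicalSpace M]
  [ChartedSpace (ModelProd (EuclideanSpace ℝ (Fin p)) (EuclideanHalfSpace 1)) M]

/-- The pairs of points of the closed collars `N × [0, 1]` which are to be glued. -/
def collarSwapGraph (β γ : BoundaryCollar p N M) : Set (M × M) :=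
  (fun q => (β.toFun q, γ.toFun (collarFlip q))) '' {q : N × EuclideanHalfSpace 1 | q.2.1 0 ≤ 1}

/-- The region on which two collars are exchanged. -/
def collarSwapDomain (β γ : BoundaryCollar p N M) : Set M :=
  β.toFun '' openCollarDomain N ∪ γ.toFun '' openCollarDomain N

theorem exists_of_mem_collarSwapGraph {β γ : BoundaryCollar p N M} {m m' : M}
    (h : (m, m') ∈ collarSwapGraph β γ) (hm : m ∉ range β.base) (hm' : m' ∉ range γ.base) :
    ∃ q ∈ openCollarDomain N, m = β.toFun q ∧ m' = γ.toFun (collarFlip q) := by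
  obtain ⟨q, hq, ⟨⟩⟩ := h
  have pos : 0 < q.2.1 0 := lt_of_le_of_ne q.2.2 fun h₀ => hm ⟨q.1, congrArg β.toFun
    (Prod.ext rfl (halfLine_ext h₀))⟩
  have lt_one : q.2.1 0 < 1 := lt_of_le_of_ne hq fun h₁ => hm' ⟨q.1, congrArg γ.toFun
    (Prod.ext rfl (halfLine_ext ((halfLineFlip_coord hq).trans (sub_eq_zero.2 h₁.symm)).symm))⟩
  exact ⟨q, ⟨pos, lt_one⟩, rfl, rfl⟩

variable [IsManifold (𝓡 p) 1 N] [IsManifold (collarModel p) 1 M]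

/-- Two disjoint collars of `N`, extending continuously to `N × [0, 1]`, of which the first
reverses and the second preserves the orientation. -/
structure GluableCollars (oN : ManifoldOrientation (𝓡 p) N)
    (o : ManifoldOrientation (collarModel p) M) (β γ : BoundaryCollar p N M) : Prop where
  disjoint : Disjoint (β.toFun '' collarDomain N) (γ.toFun '' collarDomain N)
  reverses : ∀ q ∈ collarDomain N, β.orientedJacobian oN o q < 0
  preserves : ∀ q ∈ collarDomain N, 0 < γ.orientedJacobian oN o q
  continuousAt_left : ∀ q : N × EuclideanHalfSpace 1, q.2.1 0 ≤ 1 → ContinuousAt β.toFun q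
  continuousAt_right : ∀ q : N × EuclideanHalfSpace 1, q.2.1 0 ≤ 1 → ContinuousAt γ.toFun q

namespace GluableCollars

variable {oN : ManifoldOrientation (𝓡 p) N} {o : ManifoldOrientation (collarModel p) M}
  {β γ : BoundaryCollar p N M} (h : GluableCollars oN o β γ)

include h

theorem ne {q q' : N × EuclideanHalfSpace 1} (hq : q ∈ collarDomain N) (hq' : q' ∈ collarDomain N) :
    β.toFun q ≠ γ.toFun q' := fun h' =>
  disjoint_left.1 h.disjoint ⟨q, hq, rfl⟩ ⟨q', hq', h'.symm⟩

theorem collarSwapDomain_subset :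
    collarSwapDomain β γ ⊆ (range β.base ∪ range γ.base)ᶜ := by
  rintro _ (⟨q, hq, rfl⟩ | ⟨q, hq, rfl⟩) (hx | hx)
  · exact (β.toFun_mem_range_base_iff (openCollarDomain_subset hq)).1 hx hq
  · obtain ⟨x, hx⟩ := hx
    exact h.ne (openCollarDomain_subset hq) (mk_zero_mem_collarDomain x) hx.symm
  · obtain ⟨x, hx⟩ := hx
    exact h.ne (mk_zero_mem_collarDomain x) (openCollarDomain_subset hq) hx
  · exact (γ.toFun_mem_range_base_iff (openCollarDomain_subset hq)).1 hx hq

theorem mapsTo_collarSwap :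
    MapsTo (collarSwap β γ) (collarSwapDomain β γ) (collarSwapDomain β γ) := by
  rintro _ (⟨q, hq, rfl⟩ | ⟨q, hq, rfl⟩)
  · rw [collarSwap_left β γ hq]
    exact .inr ⟨_, mapsTo_collarFlip hq, rfl⟩
  · rw [collarSwap_right h.disjoint hq]
    exact .inl ⟨_, mapsTo_collarFlip hq, rfl⟩

theorem leftInvOn_collarSwap :
    LeftInvOn (collarSwap β γ) (collarSwap β γ) (collarSwapDomain β γ) := by
  rintro _ (⟨q, hq, rfl⟩ | ⟨q, hq, rfl⟩)
  · rw [collarSwap_left β γ hq, collarSwap_right h.disjoint (mapsTo_collarFlip hq),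
      leftInvOn_collarFlip hq]
  · rw [collarSwap_right h.disjoint hq, collarSwap_left β γ (mapsTo_collarFlip hq),
      leftInvOn_collarFlip hq]

theorem collarSwap_ne : ∀ m ∈ collarSwapDomain β γ, collarSwap β γ m ≠ m := by
  rintro _ (⟨q, hq, rfl⟩ | ⟨q, hq, rfl⟩)
  · rw [collarSwap_left β γ hq]
    exact (h.ne (openCollarDomain_subset hq) (collarFlip_mem_collarDomain hq)).symm
  · rw [collarSwap_right h.disjoint hq]
    exact h.ne (collarFlip_mem_collarDomain hq) (openCollarDomain_subset hq)

theorem isLocalDiffeomorphAt_collarSwap : ∀ m ∈ collarSwapDomain β γ,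
    IsLocalDiffeomorphAt (collarModel p) (collarModel p) ∞ (collarSwap β γ) m := by
  rintro _ (⟨q, hq, rfl⟩ | ⟨q, hq, rfl⟩)
  · exact isLocalDiffeomorphAt_of_eqOn_collarFlip (fun _ => collarSwap_left β γ) hq
  · exact isLocalDiffeomorphAt_of_eqOn_collarFlip (fun _ => collarSwap_right h.disjoint) hq

theorem signedJacobian_collarSwap_pos : ∀ m ∈ collarSwapDomain β γ,
    0 < signedJacobian (collarModel p) (collarModel p) o.sign o.sign (collarSwap β γ) m := by
  rintro _ (⟨q, hq, rfl⟩ | ⟨q, hq, rfl⟩)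
  · have mul_eq := signedJacobian_of_eqOn_collarFlip oN o (fun _ => collarSwap_left β γ) hq
    have mul_neg := mul_eq.trans_lt
      (neg_neg_of_pos (h.preserves _ (collarFlip_mem_collarDomain hq)))
    exact pos_of_mul_neg_left mul_neg (h.reverses q (openCollarDomain_subset hq)).le
  · have mul_eq := signedJacobian_of_eqOn_collarFlip oN o (fun _ => collarSwap_right h.disjoint) hq
    have mul_pos := (neg_pos.2 (h.reverses _ (collarFlip_mem_collarDomain hq))).trans_eq mul_eq.symm
    exact pos_of_mul_pos_left mul_pos (h.preserves q (openCollarDomain_subset hq)).le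

theorem eq_collarSwap_iff {m m' : M} (hm : m ∉ range β.base ∪ range γ.base)
    (hm' : m' ∉ range β.base ∪ range γ.base) :
    m ∈ collarSwapDomain β γ ∧ m' = collarSwap β γ m ↔
      (m, m') ∈ collarSwapGraph β γ ∨ (m', m) ∈ collarSwapGraph β γ := by
  rw [mem_union, not_or] at hm hm'
  constructor
  · rintro ⟨⟨q, hq, rfl⟩ | ⟨q, hq, rfl⟩, rfl⟩
    · rw [collarSwap_left β γ hq]
      exact .inl ⟨q, hq.2.le, rfl⟩
    · rw [collarSwap_right h.disjoint hq]
      exact .inr ⟨collarFlip q, (mapsTo_collarFlip hq).2.le,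
        Prod.ext rfl (congrArg γ.toFun (leftInvOn_collarFlip hq))⟩
  · rintro (hmm' | hmm')
    · obtain ⟨q, hq, rfl, rfl⟩ := exists_of_mem_collarSwapGraph hmm' hm.1 hm'.2
      exact ⟨.inl ⟨q, hq, rfl⟩, (collarSwap_left β γ hq).symm⟩
    · obtain ⟨q, hq, rfl, rfl⟩ := exists_of_mem_collarSwapGraph hmm' hm'.1 hm.2
      refine ⟨.inr ⟨_, mapsTo_collarFlip hq, rfl⟩, ?_⟩
      rw [collarSwap_right h.disjoint (mapsTo_collarFlip hq), leftInvOn_collarFlip hq]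

theorem collarSwap_notMem_image_lt {m : M} (hm : m ∉ range β.base ∪ range γ.base)
    (hm' : m ∈ β.toFun '' {q | q.2.1 0 < 1 / 2} ∪ γ.toFun '' {q | q.2.1 0 < 1 / 2}) :
    m ∈ collarSwapDomain β γ ∧ collarSwap β γ m ∉
      β.toFun '' {q | q.2.1 0 < 1 / 2} ∪ γ.toFun '' {q | q.2.1 0 < 1 / 2} := by
  have half_subset : {q : N × EuclideanHalfSpace 1 | q.2.1 0 < 1 / 2} ⊆ collarDomain N :=
    fun q hq => lt_trans (b := (1 / 2 : ℝ)) hq (by norm_num)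
  have half_lt_flip {q : N × EuclideanHalfSpace 1} (hq : q.2.1 0 < 1 / 2) :
      ¬(collarFlip q).2.1 0 < 1 / 2 := by
    change ¬(halfLineFlip q.2).1 0 < 1 / 2
    rw [halfLineFlip_coord] <;> linarith
  rw [mem_union, not_or] at hm
  rcases hm' with ⟨q, hq, rfl⟩ | ⟨q, hq, rfl⟩
  · have hq' := not_not.1 (mt (β.toFun_mem_range_base_iff (half_subset hq)).2 hm.1)
    have flip_mem := collarFlip_mem_collarDomain hq'
    refine ⟨.inl ⟨q, hq', rfl⟩, ?_⟩
    rw [collarSwap_left β γ hq', mem_union, γ.injOn.mem_image_iff half_subset flip_mem]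
    exact not_or.2 ⟨fun ⟨_, hr, h'⟩ => h.ne (half_subset hr) flip_mem h', half_lt_flip hq⟩
  · have hq' := not_not.1 (mt (γ.toFun_mem_range_base_iff (half_subset hq)).2 hm.2)
    have flip_mem := collarFlip_mem_collarDomain hq'
    refine ⟨.inr ⟨q, hq', rfl⟩, ?_⟩
    rw [collarSwap_right h.disjoint hq', mem_union, β.injOn.mem_image_iff half_subset flip_mem]
    exact not_or.2 ⟨half_lt_flip hq, fun ⟨_, hr, h'⟩ => h.ne flip_mem (half_subset hr) h'.symm⟩

variable [CompactSpace N] [T2Space M]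

theorem isClosed_collarSwapGraph : IsClosed (collarSwapGraph β γ) := by
  refine ((isCompact_setOf_coord_le 1).image_of_continuousOn fun q hq => ?_).isClosed
  have flip_le : (halfLineFlip q.2).1 0 ≤ 1 := by
    rw [halfLineFlip_coord hq]
    exact sub_le_self _ q.2.2
  exact ((h.continuousAt_left q hq).prodMk (ContinuousAt.comp (f := collarFlip)
    (h.continuousAt_right _ flip_le) continuous_collarFlip.continuousAt)).continuousWithinAt

/-- The gluing of two collars: their bases are removed and `β(x, t)` is identified with
`γ(x, 1 - t)` for `0 < t < 1`. -/
def gluing : GluingInvolution (collarModel p) o where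
  U := (range β.base ∪ range γ.base)ᶜ
  D := collarSwapDomain β γ
  σ := collarSwap β γ
  isOpen_U := (β.isCompact_range_base.union γ.isCompact_range_base).isClosed.isOpen_compl
  isOpen_D := (β.isOpen_image isOpen_openCollarDomain openCollarDomain_subset).union
    (γ.isOpen_image isOpen_openCollarDomain openCollarDomain_subset)
  subset := h.collarSwapDomain_subset
  map_mem := h.mapsTo_collarSwap
  involutive := h.leftInvOn_collarSwap
  free := h.collarSwap_ne
  isLocalDiffeomorphAt := h.isLocalDiffeomorphAt_collarSwap
  preserves := h.signedJacobian_collarSwap_pos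
  isClosed_graph := by
    simp only [fun q : ↥(range β.base ∪ range γ.base)ᶜ × ↥(range β.base ∪ range γ.base)ᶜ =>
      h.eq_collarSwap_iff q.1.2 q.2.2]
    exact (h.isClosed_collarSwapGraph.preimage (by fun_prop)).union
      (h.isClosed_collarSwapGraph.preimage (by fun_prop))

instance [CompactSpace M] : CompactSpace h.gluing.Glued := by
  -- The complement of the inner halves of the two collars is compact and meets every class.
  set V : Set (N × EuclideanHalfSpace 1) := {q | q.2.1 0 < 1 / 2}
  have isOpen_V : IsOpen V := isOpen_lt (by fun_prop) continuous_const
  have V_subset : V ⊆ collarDomain N := fun q hq => lt_trans (b := (1 / 2 : ℝ)) hq (by norm_num)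
  have zero_mem_V (x : N) : (x, halfLineZero) ∈ V := by simp [V]
  set K : Set M := (β.toFun '' V ∪ γ.toFun '' V)ᶜ
  have isCompact_K : IsCompact K :=
    ((β.isOpen_image isOpen_V V_subset).union (γ.isOpen_image isOpen_V V_subset)).isClosed_compl
      |>.isCompact
  have K_subset : K ⊆ h.gluing.U := by
    refine compl_subset_compl.2 (union_subset_union ?_ ?_) <;>
    · rintro _ ⟨x, rfl⟩
      exact ⟨_, zero_mem_V x, rfl⟩
  have isCompact_preimage : IsCompact ((Subtype.val : h.gluing.U → M) ⁻¹' K) :=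
    (IsInducing.subtypeVal.isCompact_preimage_iff (by simpa using K_subset)).2 isCompact_K
  have image_eq_univ : h.gluing.toGlued '' (Subtype.val ⁻¹' K) = univ := by
    refine eq_univ_of_forall fun w => ?_
    obtain ⟨⟨m, hm⟩, rfl⟩ := h.gluing.toGlued_surjective w
    by_cases hmK : m ∈ K
    · exact ⟨⟨m, hm⟩, hmK, rfl⟩
    · obtain ⟨hmD, hm'⟩ := h.collarSwap_notMem_image_lt hm (not_not.1 hmK)
      exact ⟨_, hm', h.gluing.toGlued_σ hmD⟩
  exact ⟨image_eq_univ ▸ isCompact_preimage.image h.gluing.continuous_toGlued⟩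

end GluableCollars

end GluableCollars

/-! ### Gluing bordisms -/

namespace GluingInvolution

variable {p : ℕ} {N M : Type*} [TopologicalSpace N] [ChartedSpace (EuclideanSpace ℝ (Fin p)) N]
  [TopologicalSpace M]
  [ChartedSpace (ModelProd (EuclideanSpace ℝ (Fin p)) (EuclideanHalfSpace 1)) M]
  [IsManifold (collarModel p) ∞ M] {o : ManifoldOrientation (collarModel p) M}
  (G : GluingInvolution (collarModel p) o) {α : BoundaryCollar p N M}

/-- The image in the glued manifold of the base of a collar. -/
def toGluedBase (hU : MapsTo α.toFun (collarDomain N) G.U) (x : N) : G.Glued :=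
  G.toGlued ⟨α.base x, hU (mk_zero_mem_collarDomain x)⟩

theorem proj_comp_collar_eventuallyEq (hU : MapsTo α.toFun (collarDomain N) G.U)
    (f : N → G.Glued) (w₀ : G.Glued) {q : N × EuclideanHalfSpace 1} (hq : q ∈ collarDomain N) :
    (fun q => G.proj (f q.1) (α.toFun q)) =ᶠ[𝓝 q] G.proj w₀ ∘ α.toFun := by
  filter_upwards [isOpen_collarDomain.mem_nhds hq] with r hr
  exact (G.proj_of_mem _ (hU hr)).trans (G.proj_of_mem _ (hU hr)).symm

/-- The image in the glued manifold of a collar which is not involved in the gluing. -/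
def collar (hU : MapsTo α.toFun (collarDomain N) G.U)
    (hD : Disjoint (α.toFun '' collarDomain N) G.D) : BoundaryCollar p N G.Glued where
  toFun q := G.proj (G.toGluedBase hU q.1) (α.toFun q)
  injOn q hq q' hq' h := by
    change G.proj _ (α.toFun q) = G.proj _ (α.toFun q') at h
    rw [G.proj_of_mem _ (hU hq), G.proj_of_mem _ (hU hq'), toGlued_eq] at h
    rcases h with h | ⟨h, -⟩
    · exact α.injOn hq hq' (congrArg Subtype.val h).symm
    · exact (disjoint_left.1 hD ⟨q, hq, rfl⟩ h).elim
  isLocalDiffeomorphOn := fun ⟨_, hq⟩ =>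
    isLocalDiffeomorphAt_of_eventuallyEq
      ((α.isLocalDiffeomorphAt hq).comp _ _ (G.isLocalDiffeomorphAt_proj _ (hU hq)))
      (G.proj_comp_collar_eventuallyEq hU (G.toGluedBase hU) (G.toGlued ⟨_, hU hq⟩) hq)

variable (hU : MapsTo α.toFun (collarDomain N) G.U) (hD : Disjoint (α.toFun '' collarDomain N) G.D)

theorem collar_apply {q : N × EuclideanHalfSpace 1} (hq : q ∈ collarDomain N) :
    (G.collar hU hD).toFun q = G.toGlued ⟨α.toFun q, hU hq⟩ :=
  G.proj_of_mem _ (hU hq)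

theorem collar_base (x : N) :
    (G.collar hU hD).base x = G.toGluedBase hU x :=
  G.collar_apply hU hD (mk_zero_mem_collarDomain x)

theorem toGlued_mem_image_collar_iff {s : Set (N × EuclideanHalfSpace 1)} (hs : s ⊆ collarDomain N)
    {m : M} (hm : m ∈ G.U) :
    G.toGlued ⟨m, hm⟩ ∈ (G.collar hU hD).toFun '' s ↔ m ∈ α.toFun '' s := by
  refine exists_congr fun q => and_congr_right fun hq => ?_
  have notMem : α.toFun q ∉ G.D := disjoint_left.1 hD ⟨q, hs hq, rfl⟩
  rw [G.collar_apply hU hD (hs hq), toGlued_eq, or_iff_left fun h => notMem h.1,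
    Subtype.mk_eq_mk, eq_comm]

theorem toGlued_mem_range_base_collar_iff {m : M} (hm : m ∈ G.U) :
    G.toGlued ⟨m, hm⟩ ∈ range (G.collar hU hD).base ↔ m ∈ range α.base := by
  have range_base {W : Type _} [TopologicalSpace W]
      [ChartedSpace (ModelProd (EuclideanSpace ℝ (Fin p)) (EuclideanHalfSpace 1)) W]
      (θ : BoundaryCollar p N W) : range θ.base = θ.toFun '' range fun x => (x, halfLineZero) :=
    range_comp θ.toFun _
  rw [range_base, range_base]
  exact G.toGlued_mem_image_collar_iff hU hD (range_subset_iff.2 mk_zero_mem_collarDomain) hm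

theorem orientedJacobian_collar [IsManifold (𝓡 p) 1 N] (oN : ManifoldOrientation (𝓡 p) N)
    {q : N × EuclideanHalfSpace 1} (hq : q ∈ collarDomain N) :
    (G.collar hU hD).orientedJacobian oN G.orientation q =
      signedJacobian (collarModel p) (collarModel p) o.sign G.orientation.sign
        (G.proj (G.toGlued ⟨_, hU hq⟩)) (α.toFun q) * α.orientedJacobian oN o q := by
  rw [BoundaryCollar.orientedJacobian_eq_signedJacobian,
    BoundaryCollar.orientedJacobian_eq_signedJacobian,
    ← signedJacobian_comp_of_isLocalDiffeomorphAt (by simp) _ _ _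
      (G.isLocalDiffeomorphAt_proj _ (hU hq)) (α.isLocalDiffeomorphAt hq)]
  exact signedJacobian_congr (G.proj_comp_collar_eventuallyEq hU (G.toGluedBase hU) _ hq)

end GluingInvolution

namespace GluableCollars

variable {p : ℕ} {N N₀ N₁ M : Type*} [TopologicalSpace N]
  [ChartedSpace (EuclideanSpace ℝ (Fin p)) N] [IsManifold (𝓡 p) 1 N] [CompactSpace N]
  [TopologicalSpace N₀] [ChartedSpace (EuclideanSpace ℝ (Fin p)) N₀]
  [TopologicalSpace N₁] [ChartedSpace (EuclideanSpace ℝ (Fin p)) N₁]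
  [TopologicalSpace M]
  [ChartedSpace (ModelProd (EuclideanSpace ℝ (Fin p)) (EuclideanHalfSpace 1)) M] [T2Space M]
  {β γ : BoundaryCollar p N M} {α : BoundaryCollar p N₀ M} {δ : BoundaryCollar p N₁ M}

section

variable [IsManifold (collarModel p) 1 M] {oN : ManifoldOrientation (𝓡 p) N}
  {o : ManifoldOrientation (collarModel p) M} (h : GluableCollars oN o β γ)
  (hα : Disjoint (α.toFun '' collarDomain N₀)
    (β.toFun '' collarDomain N ∪ γ.toFun '' collarDomain N))

include hα

theorem mapsTo_U : MapsTo α.toFun (collarDomain N₀) h.gluing.U := by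
  refine fun q hq hx => disjoint_left.1 hα ⟨q, hq, rfl⟩ ?_
  exact hx.imp (fun ⟨x, hx⟩ => ⟨_, mk_zero_mem_collarDomain x, hx⟩)
    fun ⟨x, hx⟩ => ⟨_, mk_zero_mem_collarDomain x, hx⟩

theorem disjoint_D : Disjoint (α.toFun '' collarDomain N₀) h.gluing.D :=
  hα.mono_right (union_subset_union (image_mono openCollarDomain_subset)
    (image_mono openCollarDomain_subset))

end

variable [IsManifold (collarModel p) ∞ M] {oN : ManifoldOrientation (𝓡 p) N}
  {o : ManifoldOrientation (collarModel p) M} (h : GluableCollars oN o β γ)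

/-- The image in the glued manifold of a collar disjoint from the glued ones. -/
abbrev collar (hα : Disjoint (α.toFun '' collarDomain N₀)
    (β.toFun '' collarDomain N ∪ γ.toFun '' collarDomain N)) :
    BoundaryCollar p N₀ h.gluing.Glued :=
  h.gluing.collar (h.mapsTo_U hα) (h.disjoint_D hα)

variable (hα : Disjoint (α.toFun '' collarDomain N₀)
    (β.toFun '' collarDomain N ∪ γ.toFun '' collarDomain N))
  (hδ : Disjoint (δ.toFun '' collarDomain N₁)
    (β.toFun '' collarDomain N ∪ γ.toFun '' collarDomain N))

theorem disjoint_collar (hαδ : Disjoint (α.toFun '' collarDomain N₀) (δ.toFun '' collarDomain N₁)) :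
    Disjoint ((h.collar hα).toFun '' collarDomain N₀)
      ((h.collar hδ).toFun '' collarDomain N₁) := by
  refine disjoint_left.2 fun w hw hw' => ?_
  obtain ⟨⟨m, hm⟩, rfl⟩ := h.gluing.toGlued_surjective w
  rw [h.gluing.toGlued_mem_image_collar_iff _ _ subset_rfl] at hw hw'
  exact disjoint_left.1 hαδ hw hw'

theorem boundary_glued
    (hM : (collarModel p).boundary M =
      (range α.base ∪ range β.base) ∪ (range γ.base ∪ range δ.base)) :
    (collarModel p).boundary h.gluing.Glued =
      range (h.collar hα).base ∪ range (h.collar hδ).base := by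
  ext w
  obtain ⟨⟨m, hm⟩, rfl⟩ := h.gluing.toGlued_surjective w
  have notMem : m ∉ range β.base ∧ m ∉ range γ.base := not_or.1 hm
  have mem_boundary_iff : (collarModel p).IsBoundaryPoint m ↔
      (m ∈ range α.base ∨ m ∈ range β.base) ∨ m ∈ range γ.base ∨ m ∈ range δ.base :=
    Set.ext_iff.1 hM m
  change (collarModel p).IsBoundaryPoint _ ↔ _
  rw [mem_union, h.gluing.isBoundaryPoint_toGlued, h.gluing.toGlued_mem_range_base_collar_iff,
    h.gluing.toGlued_mem_range_base_collar_iff, mem_boundary_iff, or_iff_left notMem.1,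
    or_iff_right notMem.2]

/-- The extension to the glued manifold of a map which agrees on the glued collars. -/
def lift {E : Type*} [TopologicalSpace E] (Φ : C(M, E))
    (hΦ : ∀ q ∈ openCollarDomain N, Φ (β.toFun q) = Φ (γ.toFun (collarFlip q))) :
    C(h.gluing.Glued, E) where
  toFun := Quotient.lift (fun u : h.gluing.U => Φ u.1) <| by
    rintro ⟨x, hx⟩ ⟨_, hy⟩ (⟨⟨⟩⟩ | ⟨⟨q, hq, rfl⟩ | ⟨q, hq, rfl⟩, rfl⟩)
    · rfl
    · change Φ _ = Φ (collarSwap β γ _)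
      rw [collarSwap_left β γ hq, hΦ q hq]
    · change Φ _ = Φ (collarSwap β γ _)
      rw [collarSwap_right h.disjoint hq, hΦ _ (mapsTo_collarFlip hq), leftInvOn_collarFlip hq]
  continuous_toFun := (Φ.continuous.comp continuous_subtype_val).quotient_lift _

theorem lift_collar_base {E : Type*} [TopologicalSpace E] (Φ : C(M, E))
    (hΦ : ∀ q ∈ openCollarDomain N, Φ (β.toFun q) = Φ (γ.toFun (collarFlip q))) (x : N₀) :
    h.lift Φ hΦ ((h.collar hα).base x) = Φ (α.base x) := by
  rw [h.gluing.collar_base]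
  rfl

end GluableCollars

section Transitivity

variable {p : ℕ} {N₀ N N₁ : Type*}
  [TopologicalSpace N₀] [ChartedSpace (EuclideanSpace ℝ (Fin p)) N₀] [IsManifold (𝓡 p) 1 N₀]
  [TopologicalSpace N] [ChartedSpace (EuclideanSpace ℝ (Fin p)) N] [IsManifold (𝓡 p) 1 N]
  [TopologicalSpace N₁] [ChartedSpace (EuclideanSpace ℝ (Fin p)) N₁] [IsManifold (𝓡 p) 1 N₁]
  {o₀ : ManifoldOrientation (𝓡 p) N₀} {oN : ManifoldOrientation (𝓡 p) N}
  {o₁ : ManifoldOrientation (𝓡 p) N₁}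

namespace OrientedBordism

section

variable (b₁ : OrientedBordism p N₀ N o₀ oN) (b₂ : OrientedBordism p N N₁ oN o₁)

theorem gluableCollars : GluableCollars oN (b₁.orientation.sum b₂.orientation)
    (b₁.collar₁.halve.inl (W' := b₂.W)) (b₂.collar₀.halve.inr (W := b₁.W)) where
  disjoint := BoundaryCollar.disjoint_inl_inr _ _
  reverses q hq := by
    rw [BoundaryCollar.orientedJacobian_inl _ _ _ _ hq,
      BoundaryCollar.orientedJacobian_halve _ _ _ hq]
    exact mul_neg_of_neg_of_pos (b₁.reverses₁ _ (halfLineHalve_lt hq)) (by norm_num)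
  preserves q hq := by
    rw [BoundaryCollar.orientedJacobian_inr _ _ _ _ hq,
      BoundaryCollar.orientedJacobian_halve _ _ _ hq]
    exact mul_pos (b₂.preserves₀ _ (halfLineHalve_lt hq)) (by norm_num)
  continuousAt_left _ hq := continuous_inl.continuousAt.comp (b₁.collar₁.continuousAt_halve hq)
  continuousAt_right _ hq := continuous_inr.continuousAt.comp (b₂.collar₀.continuousAt_halve hq)

theorem disjoint_inl_collar₀ :
    Disjoint ((b₁.collar₀.inl (W' := b₂.W)).toFun '' collarDomain N₀)
      ((b₁.collar₁.halve.inl (W' := b₂.W)).toFun '' collarDomain N ∪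
        (b₂.collar₀.halve.inr (W := b₁.W)).toFun '' collarDomain N) := by
  simp only [BoundaryCollar.image_postcomp, disjoint_union_right,
    disjoint_image_iff Sum.inl_injective]
  exact ⟨b₁.disjoint_collars.mono_right b₁.collar₁.image_halve_subset, disjoint_image_inl_image_inr⟩

theorem disjoint_inr_collar₁ :
    Disjoint ((b₂.collar₁.inr (W := b₁.W)).toFun '' collarDomain N₁)
      ((b₁.collar₁.halve.inl (W' := b₂.W)).toFun '' collarDomain N ∪
        (b₂.collar₀.halve.inr (W := b₁.W)).toFun '' collarDomain N) := by
  simp only [BoundaryCollar.image_postcomp, disjoint_union_right,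
    disjoint_image_iff Sum.inr_injective]
  exact ⟨disjoint_image_inl_image_inr.symm,
    b₂.disjoint_collars.symm.mono_right b₂.collar₀.image_halve_subset⟩

variable [CompactSpace N]

/-- The composition of two bordisms, obtained by gluing them along half collars. -/
def trans : OrientedBordism p N₀ N₁ o₀ o₁ where
  W := (b₁.gluableCollars b₂).gluing.Glued
  orientation := (b₁.gluableCollars b₂).gluing.orientation
  collar₀ := (b₁.gluableCollars b₂).collar (b₁.disjoint_inl_collar₀ b₂)
  collar₁ := (b₁.gluableCollars b₂).collar (b₁.disjoint_inr_collar₁ b₂)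
  disjoint_collars :=
    (b₁.gluableCollars b₂).disjoint_collar _ _ (BoundaryCollar.disjoint_inl_inr _ _)
  boundary_eq := (b₁.gluableCollars b₂).boundary_glued _ _ <| by
    simp only [BoundaryCollar.range_base_postcomp, BoundaryCollar.halve_base,
      ModelWithCorners.boundary_disjointUnion, b₁.boundary_eq, b₂.boundary_eq, image_union]
  preserves₀ q hq := by
    rw [GluingInvolution.orientedJacobian_collar _ _ _ _ hq,
      BoundaryCollar.orientedJacobian_inl _ _ _ _ hq]
    exact mul_pos (GluingInvolution.signedJacobian_proj_pos _ _
      ((b₁.gluableCollars b₂).mapsTo_U (b₁.disjoint_inl_collar₀ b₂) hq)) (b₁.preserves₀ q hq)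
  reverses₁ q hq := by
    rw [GluingInvolution.orientedJacobian_collar _ _ _ _ hq,
      BoundaryCollar.orientedJacobian_inr _ _ _ _ hq]
    exact mul_neg_of_pos_of_neg (GluingInvolution.signedJacobian_proj_pos _ _
      ((b₁.gluableCollars b₂).mapsTo_U (b₁.disjoint_inr_collar₁ b₂) hq)) (b₂.reverses₁ q hq)

end

theorem collapse_collar₁_base_collar₀ (b : OrientedBordism p N₀ N₁ o₀ o₁) (x : N₀) :
    b.collar₁.collapse (b.collar₀.base x) = b.collar₀.base x :=
  b.collar₁.collapse_of_notMem
    (disjoint_left.1 b.disjoint_collars ⟨_, mk_zero_mem_collarDomain x, rfl⟩)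

end OrientedBordism

theorem BordantMaps.trans [CompactSpace N] {E : Type*} [TopologicalSpace E] {s₀ : N₀ → E}
    {s : N → E} {s₁ : N₁ → E} (h₁ : BordantMaps o₀ oN s₀ s)
    (h₂ : BordantMaps oN o₁ s s₁) : BordantMaps o₀ o₁ s₀ s₁ := by
  obtain ⟨b₁, Φ₁, h₁₀, h₁₁⟩ := h₁
  obtain ⟨b₂, Φ₂, h₂₀, h₂₁⟩ := h₂
  -- The maps on the two bordisms agree on the glued collars once these are collapsed.
  let Φ : C(b₁.W ⊕ b₂.W, E) :=
    ⟨Sum.elim (Φ₁ ∘ b₁.collar₁.collapse) (Φ₂ ∘ b₂.collar₀.collapse),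
      (Φ₁.continuous.comp b₁.collar₁.continuous_collapse).sumElim
        (Φ₂.continuous.comp b₂.collar₀.continuous_collapse)⟩
  have hΦ (q : N × EuclideanHalfSpace 1) (hq : q ∈ openCollarDomain N) :
      Φ (b₁.collar₁.halve.inl.toFun q) = Φ (b₂.collar₀.halve.inr.toFun (collarFlip q)) := by
    change Φ₁ (b₁.collar₁.collapse (b₁.collar₁.halve.toFun q)) =
      Φ₂ (b₂.collar₀.collapse (b₂.collar₀.halve.toFun (collarFlip q)))
    rw [b₁.collar₁.collapse_halve (openCollarDomain_subset hq),
      b₂.collar₀.collapse_halve (collarFlip_mem_collarDomain hq), h₁₁, h₂₀]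
    rfl
  refine ⟨b₁.trans b₂, (b₁.gluableCollars b₂).lift Φ hΦ, fun x => ?_, fun x => ?_⟩
  · refine ((b₁.gluableCollars b₂).lift_collar_base (b₁.disjoint_inl_collar₀ b₂) Φ hΦ x).trans ?_
    exact (congrArg Φ₁ (b₁.collapse_collar₁_base_collar₀ x)).trans (h₁₀ x)
  · refine ((b₁.gluableCollars b₂).lift_collar_base (b₁.disjoint_inr_collar₁ b₂) Φ hΦ x).trans ?_
    exact (congrArg Φ₂ (b₂.symm.collapse_collar₁_base_collar₀ x)).trans (h₂₁ x)

end Transitivity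

/-! ### Rearranging disjoint unions -/

section SumDiffeomorphisms

variable {E H : Type*} [NormedAddCommGroup E] [NormedSpace ℝ E] [TopologicalSpace H]
  {I : ModelWithCorners ℝ E H} {n : WithTop ℕ∞} {M N P : Type*}
  [TopologicalSpace M] [ChartedSpace H M] [TopologicalSpace N] [ChartedSpace H N]
  [TopologicalSpace P] [ChartedSpace H P]

theorem signedJacobian_sumComm (hn : n ≠ 0) (s : M → ℤˣ) (t : N → ℤˣ) (x : M ⊕ N) :
    signedJacobian I I (Sum.elim s t) (Sum.elim t s) (Diffeomorph.sumComm I M n N) x = 1 := by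
  have hcomm := (Diffeomorph.sumComm I M n N).isLocalDiffeomorph
  rcases x with x | x
  · rw [signedJacobian_sum_inl hn (hcomm _), Diffeomorph.sumComm_inl, signedJacobian_inr]
  · rw [signedJacobian_sum_inr hn (hcomm _), Diffeomorph.sumComm_inr, signedJacobian_inl]

theorem signedJacobian_sumEmpty [IsEmpty N] (hn : n ≠ 0) (s : M → ℤˣ) (t : N → ℤˣ) (x : M ⊕ N) :
    signedJacobian I I (Sum.elim s t) s (Diffeomorph.sumEmpty I M (M' := N) n) x = 1 := by
  rcases x with x | x
  · rw [signedJacobian_sum_inl hn (Diffeomorph.isLocalDiffeomorph _ _)]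
    exact signedJacobian_id s x
  · exact isEmptyElim x

theorem signedJacobian_inr_comp (hn : n ≠ 0) (s : M → ℤˣ) (t : N → ℤˣ) (u : P → ℤˣ) {g : P → N}
    {x : P} (hg : IsLocalDiffeomorphAt I I n g x) :
    signedJacobian I I u (Sum.elim s t) (Sum.inr ∘ g : P → M ⊕ N) x =
      signedJacobian I I u t g x := by
  rw [signedJacobian_comp_of_isLocalDiffeomorphAt hn u t _ (isLocalDiffeomorphAt_inr (g x)) hg,
    signedJacobian_inr, one_mul]

theorem signedJacobian_sumAssoc (hn : n ≠ 0) (s : M → ℤˣ) (t : N → ℤˣ) (u : P → ℤˣ)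
    (x : (M ⊕ N) ⊕ P) :
    signedJacobian I I (Sum.elim (Sum.elim s t) u) (Sum.elim s (Sum.elim t u))
      (Diffeomorph.sumAssoc I M n N P) x = 1 := by
  have hassoc := (Diffeomorph.sumAssoc I M n N P).isLocalDiffeomorph
  have hassoc_inl (y : M ⊕ N) :
      IsLocalDiffeomorphAt I I n (Diffeomorph.sumAssoc I M n N P ∘ Sum.inl) y :=
    (isLocalDiffeomorphAt_inl y).comp _ _ (hassoc _)
  rcases x with (x | x) | x
  · rw [signedJacobian_sum_inl hn (hassoc _), signedJacobian_sum_inl hn (hassoc_inl _)]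
    exact signedJacobian_inl _ _ _
  · rw [signedJacobian_sum_inl hn (hassoc _), signedJacobian_sum_inr hn (hassoc_inl _)]
    exact (signedJacobian_inr_comp hn s (Sum.elim t u) t (isLocalDiffeomorphAt_inl x)).trans
      (signedJacobian_inl _ _ _)
  · rw [signedJacobian_sum_inr hn (hassoc _)]
    exact (signedJacobian_inr_comp hn s (Sum.elim t u) u (isLocalDiffeomorphAt_inr x)).trans
      (signedJacobian_inr _ _ _)

end SumDiffeomorphisms

/-! ### Nielsen equivalence as bordism -/

/-- The homotopy pullback of `f` and the inclusion of `Y`: the space of triples of a point `x` of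
`X`, a point `y` of `Y` and a path from `f x` to `y`. -/
def NielsenSpace {X Z : Type*} [TopologicalSpace X] [TopologicalSpace Z] (f : C(X, Z))
    (Y : Set Z) :=
  {e : X × Y × C(unitInterval, Z) // e.2.2 0 = f e.1 ∧ e.2.2 1 = e.2.1}

namespace NielsenSpace

variable {X Z W : Type*} [TopologicalSpace X] [TopologicalSpace Z] [TopologicalSpace W]

instance (f : C(X, Z)) (Y : Set Z) : TopologicalSpace (NielsenSpace f Y) :=
  instTopologicalSpaceSubtype

/-- The points of `f⁻¹(Y)`, with constant paths. -/
def const (f : C(X, Z)) (Y : Set Z) : C(f ⁻¹' Y, NielsenSpace f Y) where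
  toFun c := ⟨(c.1, ⟨f c.1, c.2⟩, .const _ (f c.1)), rfl, rfl⟩
  continuous_toFun := by
    refine Continuous.subtype_mk (continuous_subtype_val.prodMk (Continuous.prodMk ?_ ?_)) _
    · fun_prop
    · exact ContinuousMap.continuous_const'.comp (by fun_prop)

variable {f : C(X, Z)} {Y : Set Z}

/-- The component in `X` of a map to the Nielsen space. -/
def fst (Φ : C(W, NielsenSpace f Y)) : C(W, X) :=
  ⟨fun w => (Φ w).1.1, (continuous_subtype_val.comp Φ.continuous).fst⟩

/-- The component in `Y` of a map to the Nielsen space. -/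
def snd (Φ : C(W, NielsenSpace f Y)) : C(W, Y) :=
  ⟨fun w => (Φ w).1.2.1, (continuous_subtype_val.comp Φ.continuous).snd.fst⟩

/-- The homotopy formed by the paths of a map to the Nielsen space. -/
def homotopy (Φ : C(W, NielsenSpace f Y)) :
    (f.comp (fst Φ)).Homotopy ((⟨Subtype.val, continuous_subtype_val⟩ : C(Y, Z)).comp (snd Φ)) where
  toFun q := (Φ q.2).1.2.2 q.1
  continuous_toFun :=
    (ContinuousMap.continuous_uncurry_of_continuous
      ⟨_, (continuous_subtype_val.comp Φ.continuous).snd.snd⟩).comp continuous_swap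
  map_zero_left w := (Φ w).2.1
  map_one_left w := (Φ w).2.2

/-- The map to the Nielsen space with given components and homotopy. -/
def lift (h : C(W, X)) (k : C(W, Y))
    (H : (f.comp h).Homotopy ((⟨Subtype.val, continuous_subtype_val⟩ : C(Y, Z)).comp k)) :
    C(W, NielsenSpace f Y) where
  toFun w := ⟨(h w, k w, (H.toContinuousMap.comp ContinuousMap.prodSwap).curry w),
    H.apply_zero w, H.apply_one w⟩
  continuous_toFun := Continuous.subtype_mk (by fun_prop) _

theorem lift_eq_const {h : C(W, X)} {k : C(W, Y)}
    {H : (f.comp h).Homotopy ((⟨Subtype.val, continuous_subtype_val⟩ : C(Y, Z)).comp k)} {w : W}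
    {c : f ⁻¹' Y} (hh : h w = c) (hk : (k w : Z) = f c) (hH : ∀ t, H (t, w) = f (h w)) :
    lift h k H w = const f Y c :=
  Subtype.ext (Prod.ext hh (Prod.ext (Subtype.ext hk)
    (ContinuousMap.ext fun t => (hH t).trans (congrArg f hh))))

theorem homotopy_eq_of_eq_const {Φ : C(W, NielsenSpace f Y)} {w : W} {c : f ⁻¹' Y}
    (hc : Φ w = const f Y c) (t : unitInterval) : homotopy Φ (t, w) = f (fst Φ w) := by
  change (Φ w).1.2.2 t = f (Φ w).1.1
  rw [hc]
  rfl

end NielsenSpace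

section NielsenEquiv

variable {X Z : Type*} [TopologicalSpace X] [TopologicalSpace Z] {p : ℕ} {f : C(X, Z)} {Y : Set Z}
  {s₀ s₁ t₀ t₁ : OrientedSingularManifold p (f ⁻¹' Y)}

theorem nielsenEquiv_iff_bordantMaps :
    NielsenEquiv f Y s₀ s₁ ↔ BordantMaps s₀.orientation s₁.orientation
      (NielsenSpace.const f Y ∘ s₀.f) (NielsenSpace.const f Y ∘ s₁.f) := by
  constructor
  · rintro ⟨b, h, k, h₀, h₁, k₀, k₁, ⟨H⟩⟩
    have H_const {w : b.W} (hw : w ∈ range b.collar₀.base ∪ range b.collar₁.base)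
        (t : unitInterval) : H (t, w) = f (h w) :=
      H.eq_fst t (b.boundary_eq ▸ hw)
    exact ⟨b, NielsenSpace.lift h k H.toHomotopy,
      fun x => NielsenSpace.lift_eq_const (h₀ x) (k₀ x) (H_const (.inl ⟨x, rfl⟩)),
      fun x => NielsenSpace.lift_eq_const (h₁ x) (k₁ x) (H_const (.inr ⟨x, rfl⟩))⟩
  · rintro ⟨b, Φ, h₀, h₁⟩
    refine ⟨b, NielsenSpace.fst Φ, NielsenSpace.snd Φ,
      fun x => congrArg (·.1.1) (h₀ x), fun x => congrArg (·.1.1) (h₁ x),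
      fun x => congrArg (·.1.2.1.1) (h₀ x), fun x => congrArg (·.1.2.1.1) (h₁ x),
      ⟨NielsenSpace.homotopy Φ, fun t w hw => ?_⟩⟩
    rw [b.boundary_eq] at hw
    rcases hw with ⟨x, rfl⟩ | ⟨x, rfl⟩
    exacts [NielsenSpace.homotopy_eq_of_eq_const (h₀ x) t,
      NielsenSpace.homotopy_eq_of_eq_const (h₁ x) t]

theorem NielsenEquiv.of_diffeomorph (φ : Diffeomorph (𝓡 p) (𝓡 p) s₀.M s₁.M ∞)
    (hφ : ∀ x, 0 < signedJacobian (𝓡 p) (𝓡 p) s₀.orientation.sign s₁.orientation.sign φ x)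
    (h : ∀ x, s₁.f (φ x) = s₀.f x) : NielsenEquiv f Y s₀ s₁ :=
  nielsenEquiv_iff_bordantMaps.2 (.of_diffeomorph φ hφ
    ((NielsenSpace.const f Y).continuous.comp s₁.hf) fun x => congrArg _ (h x))

theorem nielsenEquiv_refl (s : OrientedSingularManifold p (f ⁻¹' Y)) : NielsenEquiv f Y s s :=
  nielsenEquiv_iff_bordantMaps.2 (.refl _ ((NielsenSpace.const f Y).continuous.comp s.hf))

theorem equivalence_nielsenEquiv : Equivalence (NielsenEquiv (p := p) f Y) where
  refl := nielsenEquiv_refl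
  symm h := nielsenEquiv_iff_bordantMaps.2 (nielsenEquiv_iff_bordantMaps.1 h).symm
  trans h h' := nielsenEquiv_iff_bordantMaps.2
    ((nielsenEquiv_iff_bordantMaps.1 h).trans (nielsenEquiv_iff_bordantMaps.1 h'))

theorem NielsenEquiv.sum (hs : NielsenEquiv f Y s₀ s₁) (ht : NielsenEquiv f Y t₀ t₁) :
    NielsenEquiv f Y (s₀.sum t₀) (s₁.sum t₁) := by
  have h := (nielsenEquiv_iff_bordantMaps.1 hs).sum (nielsenEquiv_iff_bordantMaps.1 ht)
  rw [← Sum.comp_elim, ← Sum.comp_elim] at h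
  exact nielsenEquiv_iff_bordantMaps.2 h

/-- The singular manifold with the opposite orientation. -/
def OrientedSingularManifold.neg {A : Type*} [TopologicalSpace A]
    (s : OrientedSingularManifold p A) : OrientedSingularManifold p A where
  toSingularManifold := s.toSingularManifold
  t2Space := s.t2Space
  orientation := s.orientation.neg

theorem NielsenEquiv.neg (hs : NielsenEquiv f Y s₀ s₁) : NielsenEquiv f Y s₀.neg s₁.neg :=
  nielsenEquiv_iff_bordantMaps.2 (nielsenEquiv_iff_bordantMaps.1 hs).neg

/-- The empty singular manifold. -/
def OrientedSingularManifold.empty (p : ℕ) (A : Type*) [TopologicalSpace A] :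
    OrientedSingularManifold p A :=
  letI : ChartedSpace (EuclideanSpace ℝ (Fin p)) Empty := ChartedSpace.empty _ _
  { toSingularManifold := SingularManifold.empty A Empty (𝓡 p)
    t2Space := inferInstanceAs (T2Space Empty)
    orientation := ⟨fun x : Empty => x.elim, fun x : Empty => x.elim⟩ }

instance {A : Type*} [TopologicalSpace A] : IsEmpty (OrientedSingularManifold.empty p A).M :=
  inferInstanceAs (IsEmpty Empty)

theorem nielsenEquiv_sum_neg (s : OrientedSingularManifold p (f ⁻¹' Y)) :
    NielsenEquiv f Y (s.sum s.neg) (.empty p _) := by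
  have h := BordantMaps.add_neg s.orientation
    (OrientedSingularManifold.empty p (f ⁻¹' Y)).orientation
    ((NielsenSpace.const f Y).continuous.comp s.hf)
    (s' := NielsenSpace.const f Y ∘ (OrientedSingularManifold.empty p (f ⁻¹' Y)).f)
  rw [← Sum.comp_elim] at h
  exact nielsenEquiv_iff_bordantMaps.2 h

theorem nielsenEquiv_sum_assoc (s t u : OrientedSingularManifold p (f ⁻¹' Y)) :
    NielsenEquiv f Y ((s.sum t).sum u) (s.sum (t.sum u)) :=
  .of_diffeomorph (s₀ := (s.sum t).sum u) (s₁ := s.sum (t.sum u))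
    (Diffeomorph.sumAssoc (𝓡 p) s.M ∞ t.M u.M)
    (fun x => one_pos.trans_eq (signedJacobian_sumAssoc (by simp) _ _ _ x).symm)
    (by rintro ((x | x) | x) <;> rfl)

theorem nielsenEquiv_sum_comm (s t : OrientedSingularManifold p (f ⁻¹' Y)) :
    NielsenEquiv f Y (s.sum t) (t.sum s) :=
  .of_diffeomorph (s₀ := s.sum t) (s₁ := t.sum s) (Diffeomorph.sumComm (𝓡 p) s.M ∞ t.M)
    (fun x => one_pos.trans_eq (signedJacobian_sumComm (by simp) _ _ x).symm)
    (by rintro (x | x) <;> rfl)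

theorem nielsenEquiv_sum_empty (s : OrientedSingularManifold p (f ⁻¹' Y)) :
    NielsenEquiv f Y (s.sum (.empty p _)) s :=
  .of_diffeomorph (s₀ := s.sum (.empty p _)) (Diffeomorph.sumEmpty (𝓡 p) s.M ∞)
    (fun x => one_pos.trans_eq (signedJacobian_sumEmpty (by simp) _ _ x).symm)
    (by rintro (x | x); exacts [rfl, isEmptyElim x])

end NielsenEquiv

/-! ### The group of Nielsen classes -/

namespace NielsenClass

variable {X X' X'' Z : Type*} [TopologicalSpace X] [TopologicalSpace X'] [TopologicalSpace X'']
  [TopologicalSpace Z] {p : ℕ} {f : C(X, Z)} {f' : C(X', Z)} {f'' : C(X'', Z)} {Y : Set Z}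

theorem mk_eq_mk {s t : OrientedSingularManifold p (f ⁻¹' Y)} :
    mk f Y s = mk f Y t ↔ NielsenEquiv f Y s t :=
  Quot.eq.trans (by rw [equivalence_nielsenEquiv.eqvGen_eq])

section Operations

/-- Addition of Nielsen classes is disjoint union. -/
abbrev instAdd : Add (NielsenClass p f Y) :=
  ⟨Quot.map₂ OrientedSingularManifold.sum (fun s _ _ h => (nielsenEquiv_refl s).sum h)
    fun _ _ s h => h.sum (nielsenEquiv_refl s)⟩

/-- The zero Nielsen class is that of the empty manifold. -/
abbrev instZero : Zero (NielsenClass p f Y) := ⟨mk f Y (.empty p _)⟩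

/-- The negative of a Nielsen class is given by the opposite orientation. -/
abbrev instNeg : Neg (NielsenClass p f Y) :=
  ⟨Quot.map OrientedSingularManifold.neg fun _ _ => NielsenEquiv.neg⟩

attribute [local instance] instAdd instZero instNeg

/-- The group of Nielsen classes under disjoint union. -/
abbrev addCommGroup : AddCommGroup (NielsenClass p f Y) where
  toAddGroup := AddGroup.ofRightAxioms
    (by rintro ⟨s⟩ ⟨t⟩ ⟨u⟩; exact mk_eq_mk.2 (nielsenEquiv_sum_assoc s t u))
    (by rintro ⟨s⟩; exact mk_eq_mk.2 (nielsenEquiv_sum_empty s))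
    (by rintro ⟨s⟩; exact mk_eq_mk.2 (nielsenEquiv_sum_neg s))
  add_comm := by rintro ⟨s⟩ ⟨t⟩; exact mk_eq_mk.2 (nielsenEquiv_sum_comm s t)

end Operations

attribute [local instance] addCommGroup

theorem mk_add_mk (s t : OrientedSingularManifold p (f ⁻¹' Y)) :
    mk f Y s + mk f Y t = mk f Y (s.sum t) :=
  rfl

theorem map_add (k : C(X, X')) (hk : f'.comp k = f) (a b : NielsenClass p f Y) :
    map Y k hk (a + b) = map Y k hk a + map Y k hk b := by
  rcases a with ⟨s⟩
  rcases b with ⟨t⟩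
  exact mk_eq_mk.2 (.of_diffeomorph
    (s₀ := (s.sum t).map (preimageMap Y k hk))
    (s₁ := (s.map (preimageMap Y k hk)).sum (t.map (preimageMap Y k hk)))
    (Diffeomorph.refl (𝓡 p) (s.M ⊕ t.M) ∞)
    (fun x => one_pos.trans_eq (signedJacobian_id (s.orientation.sum t.orientation).sign x).symm)
    (by rintro (x | x) <;> rfl))

/-- `NielsenClass.map` as a homomorphism of groups. -/
def mapHom (Y : Set Z) (k : C(X, X')) (hk : f'.comp k = f) :
    NielsenClass p f Y →+ NielsenClass p f' Y :=
  .mk' (map Y k hk) (map_add k hk)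

theorem map_map (k : C(X, X')) (hk : f'.comp k = f) (k' : C(X', X'')) (hk' : f''.comp k' = f')
    (l : C(X, X'')) (hl : f''.comp l = f) (h : k'.comp k = l) (a : NielsenClass p f Y) :
    map Y k' hk' (map Y k hk a) = map Y l hl a := by
  subst h
  rcases a with ⟨s⟩
  rfl

theorem map_injective_of_strongDeformationRetract (k : C(X, X')) (hk : f'.comp k = f)
    (r : C(X', X)) (hr : r.comp k = .id X) (hkr : (k.comp r).HomotopicRel (.id X') (range k)) :
    Function.Injective (map (p := p) Y k hk) := by
  rintro ⟨s⟩ ⟨t⟩ hst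
  obtain ⟨b, h, l, h₀, h₁, l₀, l₁, H⟩ := mk_eq_mk.1 hst
  obtain ⟨L⟩ := hkr
  subst hk
  have hr' : ∀ x, r (k x) = x := DFunLike.congr_fun hr
  have hbase : ∀ w ∈ (collarModel p).boundary b.W, h w ∈ range k := by
    rw [b.boundary_eq]
    rintro _ (⟨x, rfl⟩ | ⟨x, rfl⟩)
    exacts [⟨_, (h₀ x).symm⟩, ⟨_, (h₁ x).symm⟩]
  -- The homotopy from `f' k r h` to `f' h` induced by the deformation is constant on `∂W`.
  have retract_homotopic : ((f'.comp k).comp (r.comp h)).HomotopicRel (f'.comp h)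
      ((collarModel p).boundary b.W) :=
    ⟨⟨⟨⟨fun q => f' (L (q.1, h q.2)), by fun_prop⟩, fun w => congrArg f' (L.apply_zero (h w)),
      fun w => congrArg f' (L.apply_one (h w))⟩,
      fun u w hw => congrArg f' (L.eq_fst u (hbase w hw))⟩⟩
  exact mk_eq_mk.2 ⟨b, r.comp h, l, fun x => (congrArg r (h₀ x)).trans (hr' _),
    fun x => (congrArg r (h₁ x)).trans (hr' _), l₀, l₁, retract_homotopic.trans H⟩

end NielsenClass

/-! ### Reparametrized cylinders -/

section Cylinder

/-- The map of the cylinder `I × X` given by a reparametrization of the interval. -/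
def cylinderMap (X : Type*) [TopologicalSpace X] (ρ : C(unitInterval, unitInterval)) :
    C(unitInterval × X, unitInterval × X) :=
  ρ.prodMap (.id X)

/-- The first half of the interval, parametrized by `t ↦ t / 2`. -/
def lowerHalf : C(unitInterval, unitInterval) where
  toFun t := ⟨t / 2, unitInterval.div_mem t.2.1 zero_le_two (t.2.2.trans one_le_two)⟩
  continuous_toFun := by fun_prop

/-- The second half of the interval, parametrized by `t ↦ (t + 1) / 2`. -/
def upperHalf : C(unitInterval, unitInterval) where
  toFun t := ⟨(t + 1) / 2, unitInterval.div_mem (by linarith [t.2.1]) zero_le_two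
    (by linarith [t.2.2])⟩
  continuous_toFun := by fun_prop

/-- The retraction of the interval onto its second half, in the parametrization `upperHalf`. -/
def upperHalfRetraction : C(unitInterval, unitInterval) where
  toFun t := projIcc 0 1 zero_le_one (2 * t - 1)
  continuous_toFun := continuous_projIcc.comp (by fun_prop)

theorem upperHalfRetraction_comp_upperHalf :
    upperHalfRetraction.comp upperHalf = .id unitInterval := by
  ext1 t
  change projIcc 0 1 zero_le_one (2 * (((t : ℝ) + 1) / 2) - 1) = t
  rw [mul_div_cancel₀ _ two_ne_zero, add_sub_cancel_right, projIcc_val]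

variable {X Z : Type*} [TopologicalSpace X] [TopologicalSpace Z]

theorem cylinderMap_homotopicRel_id (ρ : C(unitInterval, unitInterval)) {S : Set (unitInterval × X)}
    (hS : ∀ q ∈ S, ρ q.1 = q.1) : (cylinderMap X ρ).HomotopicRel (.id _) S := by
  refine ⟨⟨⟨⟨fun q => (Icc.convexComb (ρ q.2.1) q.2.1 q.1, q.2.2), ?_⟩, fun q => ?_, fun q => ?_⟩,
    fun u q hq => ?_⟩⟩
  · have endpoints : Continuous fun q : unitInterval × unitInterval × X =>
        (ρ q.2.1, q.2.1, q.1) := by fun_prop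
    exact (Icc.continuous_convexComb_prod.comp endpoints).prodMk continuous_snd.snd
  · exact Prod.ext (Icc.convexComb_zero _ _) rfl
  · exact Prod.ext (Icc.convexComb_one _ _) rfl
  · refine Prod.ext ?_ rfl
    change Icc.convexComb (ρ q.1) q.1 u = ρ q.1
    rw [hS q hq, Icc.convexComb_eq]

variable {f g h : C(X, Z)}

theorem trans_comp_lowerHalf (F : f.Homotopy g) (G : g.Homotopy h) :
    (F.trans G).toContinuousMap.comp (cylinderMap X lowerHalf) = F.toContinuousMap := by
  ext ⟨t, x⟩
  refine (if_pos (div_le_div_of_nonneg_right t.2.2 zero_le_two)).trans ?_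
  change F.extend (2 * ((t : ℝ) / 2)) x = F (t, x)
  rw [mul_div_cancel₀ _ two_ne_zero, F.extend_apply_coe]

theorem trans_comp_upperHalf (F : f.Homotopy g) (G : g.Homotopy h) :
    (F.trans G).toContinuousMap.comp (cylinderMap X upperHalf) = G.toContinuousMap := by
  ext ⟨t, x⟩
  change (if ((t : ℝ) + 1) / 2 ≤ 1 / 2 then F.extend (2 * (((t : ℝ) + 1) / 2)) x
    else G.extend (2 * (((t : ℝ) + 1) / 2) - 1) x) = G (t, x)
  rw [mul_div_cancel₀ _ two_ne_zero, add_sub_cancel_right, G.extend_apply_coe, ite_eq_right_iff]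
  intro ht
  obtain rfl : t = 0 := Subtype.ext (le_antisymm (by rw [Icc.coe_zero]; linarith) t.2.1)
  rw [F.extend_apply_of_one_le (by simp), G.apply_zero]

end Cylinder

/-! ### Homotopy invariance of the essential classes -/

section HomotopyInvariance

variable {p : ℕ} {X Z : Type*} [TopologicalSpace X] [TopologicalSpace Z] {f g h : C(X, Z)}
  {Y : Set Z}

theorem map_cylinderMap_injective {F G : C(unitInterval × X, Z)}
    {ρ r : C(unitInterval, unitInterval)} (hr : r.comp ρ = .id _)
    (hF : F.comp (cylinderMap X ρ) = G) :
    Function.Injective (NielsenClass.map (p := p) Y (cylinderMap X ρ) hF) := by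
  have hrρ : ∀ t, r (ρ t) = t := DFunLike.congr_fun hr
  refine NielsenClass.map_injective_of_strongDeformationRetract _ _ (cylinderMap X r)
    (ContinuousMap.ext fun q => Prod.ext (hrρ q.1) rfl)
    (cylinderMap_homotopicRel_id (ρ.comp r) ?_)
  rintro _ ⟨q, rfl⟩
  exact congrArg ρ (hrρ q.1)

theorem map_sliceInclusion_injective {F : C(unitInterval × X, Z)} (t : unitInterval)
    (hF : F.comp (sliceInclusion X t) = f) :
    Function.Injective (NielsenClass.map (p := p) Y (sliceInclusion X t) hF) := by
  refine NielsenClass.map_injective_of_strongDeformationRetract _ _ ContinuousMap.snd rfl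
    (cylinderMap_homotopicRel_id (.const _ t) ?_)
  rintro _ ⟨x, rfl⟩
  rfl

theorem nielsenStart_injective (F : f.Homotopy g) : Function.Injective (nielsenStart p Y F) :=
  map_sliceInclusion_injective _ _

theorem nielsenEnd_injective (F : f.Homotopy g) : Function.Injective (nielsenEnd p Y F) :=
  map_sliceInclusion_injective _ _

theorem map_cylinderMap_map_sliceInclusion {F G : C(unitInterval × X, Z)}
    {ρ : C(unitInterval, unitInterval)} (hF : F.comp (cylinderMap X ρ) = G) {t u : unitInterval}
    (hG : G.comp (sliceInclusion X t) = f) (hρ : ρ t = u) (a : NielsenClass p f Y) :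
    NielsenClass.map Y (cylinderMap X ρ) hF (NielsenClass.map Y (sliceInclusion X t) hG a) =
      NielsenClass.map Y (sliceInclusion X u) (by rw [← hG, ← hF, ← hρ]; rfl) a :=
  NielsenClass.map_map _ _ _ _ _ _ (by rw [← hρ]; rfl) a

theorem nielsenEnd_eq_nielsenStart_of_symm {F : f.Homotopy g} {a : NielsenClass p f Y}
    {b : NielsenClass p g Y} (hab : nielsenEnd p Y F.symm a = nielsenStart p Y F.symm b) :
    nielsenEnd p Y F b = nielsenStart p Y F a := by
  have flip : F.toContinuousMap.comp (cylinderMap X ⟨_, unitInterval.continuous_symm⟩) =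
      F.symm.toContinuousMap := rfl
  have hab' := congrArg (NielsenClass.map Y _ flip) hab
  rw [nielsenEnd, nielsenStart,
    map_cylinderMap_map_sliceInclusion flip _ unitInterval.symm_one,
    map_cylinderMap_map_sliceInclusion flip _ unitInterval.symm_zero] at hab'
  exact hab'.symm

theorem nielsenEnd_eq_nielsenStart_of_trans {F : f.Homotopy g} {G : g.Homotopy h}
    {a : NielsenClass p f Y} {b : NielsenClass p g Y} {c : NielsenClass p h Y}
    (hab : nielsenEnd p Y F b = nielsenStart p Y F a)
    (hac : nielsenEnd p Y (F.trans G) c = nielsenStart p Y (F.trans G) a) :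
    nielsenEnd p Y G c = nielsenStart p Y G b := by
  have lower := trans_comp_lowerHalf F G
  have upper := trans_comp_upperHalf F G
  have lowerHalf_zero : lowerHalf 0 = 0 := Subtype.ext (by simp [lowerHalf])
  have upperHalf_one : upperHalf 1 = 1 := Subtype.ext (by simp [upperHalf])
  have upperHalf_zero : upperHalf 0 = lowerHalf 1 := Subtype.ext (by simp [upperHalf, lowerHalf])
  apply map_cylinderMap_injective upperHalfRetraction_comp_upperHalf upper
  calc NielsenClass.map Y (cylinderMap X upperHalf) upper (nielsenEnd p Y G c)
      = nielsenEnd p Y (F.trans G) c :=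
        map_cylinderMap_map_sliceInclusion upper _ upperHalf_one c
    _ = nielsenStart p Y (F.trans G) a := hac
    _ = NielsenClass.map Y (cylinderMap X lowerHalf) lower (nielsenStart p Y F a) :=
        (map_cylinderMap_map_sliceInclusion lower _ lowerHalf_zero a).symm
    _ = NielsenClass.map Y (cylinderMap X lowerHalf) lower (nielsenEnd p Y F b) := by rw [hab]
    _ = NielsenClass.map Y (sliceInclusion X (lowerHalf 1)) _ b :=
        map_cylinderMap_map_sliceInclusion lower _ rfl b
    _ = NielsenClass.map Y (cylinderMap X upperHalf) upper (nielsenStart p Y G b) :=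
        (map_cylinderMap_map_sliceInclusion upper _ upperHalf_zero b).symm

theorem mem_essentialClasses {a : NielsenClass p f Y} :
    a ∈ essentialClasses p f Y ↔
      ∀ (g : C(X, Z)) (F : f.Homotopy g), nielsenStart p Y F a ∈ range (nielsenEnd p Y F) := by
  simp [essentialClasses, preservedClasses]

theorem exists_mem_essentialClasses (F : f.Homotopy g) {a : NielsenClass p f Y}
    (ha : a ∈ essentialClasses p f Y) :
    ∃ b ∈ essentialClasses p g Y, nielsenEnd p Y F b = nielsenStart p Y F a := by
  rw [mem_essentialClasses] at ha
  obtain ⟨b, hb⟩ := ha g F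
  refine ⟨b, mem_essentialClasses.2 fun h G => ?_, hb⟩
  obtain ⟨c, hc⟩ := ha h (F.trans G)
  exact ⟨c, nielsenEnd_eq_nielsenStart_of_trans hb hc⟩

theorem image_nielsenStart_essentialClasses (F : f.Homotopy g) :
    nielsenStart p Y F '' essentialClasses p f Y = nielsenEnd p Y F '' essentialClasses p g Y := by
  apply Subset.antisymm
  · rintro _ ⟨a, ha, rfl⟩
    exact exists_mem_essentialClasses F ha
  · rintro _ ⟨b, hb, rfl⟩
    obtain ⟨a, ha, hab⟩ := exists_mem_essentialClasses F.symm hb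
    exact ⟨a, ha, (nielsenEnd_eq_nielsenStart_of_symm hab).symm⟩

attribute [local instance] NielsenClass.addCommGroup

/-- `nielsenStart` as a homomorphism of groups. -/
def nielsenStartHom (p : ℕ) (Y : Set Z) (F : f.Homotopy g) :
    NielsenClass p f Y →+ NielsenClass p F.toContinuousMap Y :=
  NielsenClass.mapHom Y (sliceInclusion X 0) (ContinuousMap.ext F.apply_zero)

/-- `nielsenEnd` as a homomorphism of groups. -/
def nielsenEndHom (p : ℕ) (Y : Set Z) (F : f.Homotopy g) :
    NielsenClass p g Y →+ NielsenClass p F.toContinuousMap Y :=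
  NielsenClass.mapHom Y (sliceInclusion X 1) (ContinuousMap.ext F.apply_one)

/-- The subgroup of topologically essential classes. -/
def essentialSubgroup (p : ℕ) (f : C(X, Z)) (Y : Set Z) : AddSubgroup (NielsenClass p f Y) :=
  ⨅ (g : C(X, Z)) (F : f.Homotopy g), (nielsenEndHom p Y F).range.comap (nielsenStartHom p Y F)

theorem coe_essentialSubgroup : (essentialSubgroup p f Y : Set _) = essentialClasses p f Y := by
  ext a
  rw [mem_essentialClasses]
  simp only [essentialSubgroup, AddSubgroup.coe_iInf, mem_iInter]
  rfl

theorem map_nielsenStartHom_essentialSubgroup (F : f.Homotopy g) :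
    (essentialSubgroup p f Y).map (nielsenStartHom p Y F) =
      (essentialSubgroup p g Y).map (nielsenEndHom p Y F) := by
  apply SetLike.coe_injective
  rw [AddSubgroup.coe_map, AddSubgroup.coe_map, coe_essentialSubgroup, coe_essentialSubgroup]
  exact image_nielsenStart_essentialClasses F

/-- The isomorphism of the groups of essential classes of homotopic maps: both are identified with
the same subgroup of the group of Nielsen classes of the homotopy. -/
def essentialSubgroupEquiv (F : f.Homotopy g) :
    essentialSubgroup p f Y ≃+ essentialSubgroup p g Y :=
  ((essentialSubgroup p f Y).equivMapOfInjective (nielsenStartHom p Y F)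
    (nielsenStart_injective F)).trans
      ((AddEquiv.addSubgroupCongr (map_nielsenStartHom_essentialSubgroup F)).trans
        ((essentialSubgroup p g Y).equivMapOfInjective (nielsenEndHom p Y F)
          (nielsenEnd_injective F)).symm)

theorem nielsenEnd_essentialSubgroupEquiv (F : f.Homotopy g) (a : essentialSubgroup p f Y) :
    nielsenEnd p Y F (essentialSubgroupEquiv F a : NielsenClass p g Y) = nielsenStart p Y F a :=
  congrArg Subtype.val (((essentialSubgroup p g Y).equivMapOfInjective (nielsenEndHom p Y F)
    (nielsenEnd_injective F)).apply_symm_apply _)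

/-- The homomorphism which transports the essential classes of a map to Nielsen classes of a
homotopic map. -/
def essentialTransport (F : f.Homotopy g) : essentialSubgroup p f Y →+ NielsenClass p g Y :=
  (essentialSubgroup p g Y).subtype.comp (essentialSubgroupEquiv F).toAddMonoidHom

theorem essentialTransport_injective (F : f.Homotopy g) :
    Function.Injective (essentialTransport (p := p) (Y := Y) F) :=
  Subtype.val_injective.comp (essentialSubgroupEquiv F).injective

end HomotopyInvariance

end

theorem mainTheorem2 {X Z : Type*} [TopologicalSpace X] [TopologicalSpace Z]
    (Y : Set Z) (p : ℕ) :
    (∀ f : C(X, Z), Equivalence (NielsenEquiv (p := p) f Y)) ∧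
    ∃ grp : ∀ f : C(X, Z), AddCommGroup (NielsenClass p f Y),
      (∀ (f : C(X, Z)) (s t : OrientedSingularManifold p (f ⁻¹' Y)),
        NielsenClass.mk f Y s + NielsenClass.mk f Y t = NielsenClass.mk f Y (s.sum t)) ∧
      ∃ S : ∀ f : C(X, Z), AddSubgroup (NielsenClass p f Y),
        (∀ f : C(X, Z), (S f : Set (NielsenClass p f Y)) = essentialClasses p f Y) ∧
        ∀ (f g : C(X, Z)) (F : f.Homotopy g),
          (∃ e : S f ≃+ S g, ∀ a : S f,
            nielsenEnd p Y F (e a : NielsenClass p g Y) = nielsenStart p Y F a) ∧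
          (∃ φ : S f →+ NielsenClass p g Y, Function.Injective φ ∧
            ∀ a : S f, nielsenEnd p Y F (φ a) = nielsenStart p Y F a) := by
  refine ⟨fun f => equivalence_nielsenEquiv, fun f => NielsenClass.addCommGroup,
    fun f => NielsenClass.mk_add_mk, fun f => essentialSubgroup p f Y,
    fun f => coe_essentialSubgroup, fun f g F => ⟨?_, ?_⟩⟩
  · exact ⟨essentialSubgroupEquiv F, nielsenEnd_essentialSubgroupEquiv F⟩
  · exact ⟨essentialTransport F, essentialTransport_injective F,
      nielsenEnd_essentialSubgroupEquiv F⟩
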